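/- **Setting.** Let $E$ be a finite-dimensional real normed space, $Q\subseteq E$ open, and let $\mathcal L(x,\dot x,z)$ be a smooth function on $TQ\times\mathbb R=Q\times E\times\mathbb R$ that is regular, i.e. $\partial^2\mathcal L/\partial\dot x^2$ is invertible everywhere. The *generalized Euler–Lagrange equations* of $\mathcal L$ are $$\frac{\partial\mathcal L}{\partial x}-\frac{d}{dt}\frac{\partial\mathcal L}{\partial\dot x}+\frac{\partial\mathcal L}{\partial z}\frac{\partial\mathcal L}{\partial\dot x}=0,\qquad \dot z=\mathcal L(x,\dot x,z);$$ write them in explicit form as $\ddot x=f(x,\dot x,z)$, $\dot z=\mathcal L(x,\dot x,z)$. *Discretization.* Let $L(x_0,x_1,z_0,z_1;h)$, $h>0$, be a consistent discretization of $\mathcal L$: for all smooth curves $x$ in $Q$ and $z$ in $\mathbb R$, $L(x(t),x(t+h),z(t),z(t+h);h)=\mathcal L(x(t),\dot x(t),z(t))+\mathcal O(h)$, and $L$, written as a function of $x_0$, $(x_1-x_0)/h$, $z_0$, $(z_1-z_0)/h$ and $h$, extends smoothly to $h=0$. Its discrete generalized Euler–Lagrange equation is $$D_1L(x_j,x_{j+1},z_j,z_{j+1})+D_2L(x_{j-1},x_j,z_{j-1},z_j)\,\frac{1+h\,D_3L(x_j,x_{j+1},z_j,z_{j+1})}{1-h\,D_4L(x_{j-1},x_j,z_{j-1},z_j)}=0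 .$$ Let this equation be written in second order form, giving the difference system $$\frac{z_{j+1}-z_j}{h}=L(x_j,x_{j+1},z_j,z_{j+1};h),\qquad \frac{x_{j+1}-2x_j+x_{j-1}}{h^2}=F(x_{j-1},x_j,x_{j+1},z_{j-1},z_j,z_{j+1};h). \qquad(1)$$ Here $F$ is any function such that: for small $h>0$ (locally uniformly in the central first and second difference quotients of the $x_i$ and of the $z_i$) and whenever the first equation of (1) holds for both steps, the discrete generalized Euler–Lagrange equation is equivalent to the second equation of (1); $F$, expressed through these difference quotients, $x_j$, $z_j$ and $h$, extends smoothly to $h=0$; and along smooth curves with $\dot z=\mathcal L(x,\dot x,z)$, $F=f(x,\dot x,z)+\mathcal O(h)$. *Modified equations.* Let $$\mathcal L_{\rm mod}=\mathcal L+h\mathcal L_1+h^2\mathcal L_2+\cdots,\qquad f_{\rm mod}=f+hf_1+h^2f_2+\cdots$$ be formal power series in $h$ whose coefficients are smooth functions of $(x,\dot x,z)\in TQ\times\mathbb R$, and denote by $\mathcal L_{\rm mod}^{(k)}$, $f_{\rm mod}^{(k)}$ their truncations after order $h^k$. Assume that $\dot z=\mathcal L_{\rm mod}$, $\ddot x=f_{\rm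 mod}$ is the system of modified equations of (1): for every $k\in\mathbb N$ and every initial point $(x(0),\dot x(0),z(0))$, the solutions $(x,z)$ of the truncated system $\dot z=\mathcal L^{(k)}_{\rm mod}(x,\dot x,z;h)$, $\ddot x=f^{(k)}_{\rm mod}(x,\dot x,z;h)$ satisfy, at $t=0$ and as $h\to0^+$, $$\frac{z(t+h)-z(t)}{h}=L(x(t),x(t+h),z(t),z(t+h);h)+\mathcal O(h^{k+1}),$$ $$\frac{x(t+h)-2x(t)+x(t-h)}{h^2}=F(x(t-h),x(t),x(t+h),z(t-h),z(t),z(t+h);h)+\mathcal O(h^{k+1}).$$ **Theorem.** For every $k\in\mathbb N$ the truncated modified Lagrangian $\mathcal L^{(k)}_{\rm mod}$ is a Herglotz Lagrangian for the modified equation up to order $k$: its generalized Euler–Lagrange equations are $\ddot x=f_{\rm mod}(x,\dot x,z;h)+\mathcal O(h^{k+1})$. Precisely, there are functions $g_h(x,\dot x,z)$, $h>0$, such that for every compact $K\subset TQ\times\mathbb R$ there are $h_0>0$ and $C$ with the following properties for all $0<h<h_0$: on $K$, $\mathcal L^{(k)}_{\rm mod}(\cdot\,;h)$ is regular; on $K$,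 its generalized Euler–Lagrange equations, with $\dot z=\mathcal L_{\rm mod}^{(k)}(x,\dot x,z;h)$, are equivalent to $\ddot x=g_h(x,\dot x,z)$; and $\|g_h-f^{(k)}_{\rm mod}(\cdot\,;h)\|\le C\,h^{k+1}$ on $K$. -/

import Mathlib

open scoped ContDiff Topology

noncomputable section

namespace Herglotz

variable {E : Type*} [NormedAddCommGroup E] [NormedSpace ℝ E]

/-! ### Continuous Herglotz Lagrangians -/

/-- Points `(x, ẋ, z)` of `TQ × ℝ`, where the configuration space `Q = U` is an open subset of
the finite dimensional space `E`. -/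
def phase (U : Set E) : Set (E × E × ℝ) := {m | m.1 ∈ U}

/-- `∂ℒ/∂x`, a covector. -/
def partialX (Lag : E × E × ℝ → ℝ) (m : E × E × ℝ) : E →L[ℝ] ℝ :=
  fderiv ℝ (fun y => Lag (y, m.2.1, m.2.2)) m.1

/-- `∂ℒ/∂ẋ`, a covector. -/
def partialV (Lag : E × E × ℝ → ℝ) (m : E × E × ℝ) : E →L[ℝ] ℝ :=
  fderiv ℝ (fun w => Lag (m.1, w, m.2.2)) m.2.1

/-- `∂ℒ/∂z`, a scalar. -/
def partialZ (Lag : E × E × ℝ → ℝ) (m : E × E × ℝ) : ℝ :=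
  deriv (fun s => Lag (m.1, m.2.1, s)) m.2.2

/-- `ℒ` is regular (non-degenerate) on `S`: the Hessian `∂²ℒ/∂ẋ²`, as a linear map from velocities
to covectors, is invertible at every point of `S`. -/
def IsRegularOn (S : Set (E × E × ℝ)) (Lag : E × E × ℝ → ℝ) : Prop :=
  ∀ m ∈ S, Function.Bijective
    (fderiv ℝ (fun w => partialV Lag (m.1, w, m.2.2)) m.2.1 : E →L[ℝ] (E →L[ℝ] ℝ))

/-- The curve `t ↦ (x(t), ẋ(t), z(t))`. -/
def jet (x : ℝ → E) (z : ℝ → ℝ) (t : ℝ) : E × E × ℝ := (x t, deriv x t, z t)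

/-- The generalized Euler-Lagrange equation
`∂ℒ/∂x - d/dt (∂ℒ/∂ẋ) + (∂ℒ/∂z) (∂ℒ/∂ẋ) = 0` at time `t`. -/
def GeneralizedEL (Lag : E × E × ℝ → ℝ) (x : ℝ → E) (z : ℝ → ℝ) (t : ℝ) : Prop :=
  partialX Lag (jet x z t) - deriv (fun s => partialV Lag (jet x z s)) t
    + partialZ Lag (jet x z t) • partialV Lag (jet x z t) = 0

/-- On `S` the generalized Euler-Lagrange equations of `ℒ` are `ẍ = g(x, ẋ, z)`: along every
twice continuously differentiable curve `x`, with `z` given by `ż = ℒ(x, ẋ, z)`, whenever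
`(x, ẋ, z)` is in `S`, the generalized Euler-Lagrange equation holds if and only if `ẍ = g`. -/
def HasGeneralizedEL (S : Set (E × E × ℝ)) (Lag : E × E × ℝ → ℝ) (g : E × E × ℝ → E) : Prop :=
  ∀ (x : ℝ → E) (z : ℝ → ℝ) (t : ℝ), ContDiffAt ℝ 2 x t →
    (∀ᶠ s in 𝓝 t, HasDerivAt z (Lag (jet x z s)) s) → jet x z t ∈ S →
    (GeneralizedEL Lag x z t ↔ deriv (deriv x) t = g (jet x z t))

/-! ### Discrete Herglotz Lagrangians

A discrete Lagrangian is written `L x₀ x₁ z₀ z₁ h`. -/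

/-- Derivative with respect to the first entry. -/
def D1 (L : E → E → ℝ → ℝ → ℝ → ℝ) (x₀ x₁ : E) (z₀ z₁ h : ℝ) : E →L[ℝ] ℝ :=
  fderiv ℝ (fun y => L y x₁ z₀ z₁ h) x₀

/-- Derivative with respect to the second entry. -/
def D2 (L : E → E → ℝ → ℝ → ℝ → ℝ) (x₀ x₁ : E) (z₀ z₁ h : ℝ) : E →L[ℝ] ℝ :=
  fderiv ℝ (fun y => L x₀ y z₀ z₁ h) x₁

/-- Derivative with respect to the third entry. -/
def D3 (L : E → E → ℝ → ℝ → ℝ → ℝ) (x₀ x₁ : E) (z₀ z₁ h : ℝ) : ℝ :=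
  deriv (fun s => L x₀ x₁ s z₁ h) z₀

/-- Derivative with respect to the fourth entry. -/
def D4 (L : E → E → ℝ → ℝ → ℝ → ℝ) (x₀ x₁ : E) (z₀ z₁ h : ℝ) : ℝ :=
  deriv (fun s => L x₀ x₁ z₀ s h) z₁

/-- The discrete evolution `(z₁ - z₀) / h = L(x₀, x₁, z₀, z₁; h)` of the action. -/
def DiscreteZ (L : E → E → ℝ → ℝ → ℝ → ℝ) (x₀ x₁ : E) (z₀ z₁ h : ℝ) : Prop :=
  (z₁ - z₀) / h = L x₀ x₁ z₀ z₁ h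

/-- The discrete generalized Euler-Lagrange equation for three consecutive points
`(xm, zm), (x, z), (xp, zp)`. -/
def DiscreteGeneralizedEL (L : E → E → ℝ → ℝ → ℝ → ℝ)
    (xm x xp : E) (zm z zp h : ℝ) : Prop :=
  D1 L x xp z zp h
    + ((1 + h * D3 L x xp z zp h) / (1 - h * D4 L xm x zm z h)) • D2 L xm x zm z h = 0

/-- The second difference quotient. -/
def secondDifference (xm x xp : E) (h : ℝ) : E := (h ^ 2)⁻¹ • (xp - (2 : ℝ) • x + xm)

/-- A step-size dependent quantity `Q p h`, given for `h > 0`, extends smoothly to `h = 0` near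
the parameters `p ∈ S`. -/
def SmoothUpToZero {P G : Type*} [NormedAddCommGroup P] [NormedSpace ℝ P]
    [NormedAddCommGroup G] [NormedSpace ℝ G] (S : Set P) (Q : P → ℝ → G) : Prop :=
  ∃ (W : Set (P × ℝ)) (q : P × ℝ → G), IsOpen W ∧ (∀ p ∈ S, (p, (0 : ℝ)) ∈ W) ∧
    ContDiffOn ℝ ∞ q W ∧ ∀ r ∈ W, 0 < r.2 → Q r.1 r.2 = q r

/-- `L` is a consistent discretization of `ℒ`. The field `smooth` is the regularity that makes
Taylor expansion in `h` possible: expressed through the point `x`, the difference quotient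
`v = (x₁ - x₀) / h`, the point `z` and the difference quotient `w = (z₁ - z₀) / h`, the discrete
Lagrangian is smooth up to `h = 0`. -/
structure IsConsistentDiscretization (U : Set E) (Lag : E × E × ℝ → ℝ)
    (L : E → E → ℝ → ℝ → ℝ → ℝ) : Prop where
  smooth : SmoothUpToZero {q : E × E × ℝ × ℝ | q.1 ∈ U}
    (fun q h => L q.1 (q.1 + h • q.2.1) q.2.2.1 (q.2.2.1 + h * q.2.2.2) h)
  consistent : ∀ (x : ℝ → E) (z : ℝ → ℝ), ContDiff ℝ ∞ x → ContDiff ℝ ∞ z →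
    ∀ t, x t ∈ U →
      (fun h : ℝ => L (x t) (x (t + h)) (z t) (z (t + h)) h - Lag (jet x z t))
        =O[𝓝[>] 0] (fun h : ℝ => h)

/-- `node p v a s = p + s v + s² a / 2`. Three points `xm, x, xp` with step `h > 0` are
`node x v a (-h), x, node x v a h`, where `v` is their central difference quotient and `a` their
second difference quotient. -/
def node {G : Type*} [AddCommGroup G] [Module ℝ G] (p v a : G) (s : ℝ) : G :=
  p + s • v + (s ^ 2 / 2) • a

/-- The discrete generalized Euler-Lagrange equation of `L` is written as the second order
difference equation `(x_{j+1} - 2 x_j + x_{j-1}) / h² = F(x_{j-1}, x_j, x_{j+1}, z_{j-1}, z_j, z_{j+1}; h)`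
with a right hand side `F` that is a consistent discretization of `f(x, ẋ, z)`.
* `smooth`: `F` is smooth up to `h = 0` when expressed through difference quotients
  `q = (x, v, a, z, w, c)` of the `x_i` and `z_i`;
* `equiv`: for small `h > 0`, locally uniformly in these difference quotients, and for `z_i`
  evolving by the discrete evolution of the action, the two equations are equivalent;
* `consistent`: along smooth curves with `ż = ℒ(x, ẋ, z)`, `F` is `f + O(h)`. -/
structure IsSecondOrderForm (U : Set E) (Lag : E × E × ℝ → ℝ) (f : E × E × ℝ → E)
    (L : E → E → ℝ → ℝ → ℝ → ℝ) (F : E → E → E → ℝ → ℝ → ℝ → ℝ → E) : Prop where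
  smooth : SmoothUpToZero {q : (E × E × E) × (ℝ × ℝ × ℝ) | q.1.1 ∈ U}
    (fun q h =>
      F (node q.1.1 q.1.2.1 q.1.2.2 (-h)) q.1.1 (node q.1.1 q.1.2.1 q.1.2.2 h)
        (node q.2.1 q.2.2.1 q.2.2.2 (-h)) q.2.1 (node q.2.1 q.2.2.1 q.2.2.2 h) h)
  equiv : ∀ q₀ : (E × E × E) × (ℝ × ℝ × ℝ), q₀.1.1 ∈ U →
    ∀ᶠ r : ((E × E × E) × (ℝ × ℝ × ℝ)) × ℝ in 𝓝 (q₀, 0), 0 < r.2 →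
      ∀ (xm x xp : E) (zm z zp h : ℝ),
        h = r.2 → x = r.1.1.1 → z = r.1.2.1 →
        xm = node x r.1.1.2.1 r.1.1.2.2 (-h) → xp = node x r.1.1.2.1 r.1.1.2.2 h →
        zm = node z r.1.2.2.1 r.1.2.2.2 (-h) → zp = node z r.1.2.2.1 r.1.2.2.2 h →
        DiscreteZ L xm x zm z h → DiscreteZ L x xp z zp h →
        (DiscreteGeneralizedEL L xm x xp zm z zp h ↔
          secondDifference xm x xp h = F xm x xp zm z zp h)
  consistent : ∀ (x : ℝ → E) (z : ℝ → ℝ), ContDiff ℝ ∞ x → ContDiff ℝ ∞ z →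
    ∀ t, x t ∈ U → (∀ᶠ s in 𝓝 t, HasDerivAt z (Lag (jet x z s)) s) →
      (fun h : ℝ => F (x (t - h)) (x t) (x (t + h)) (z (t - h)) (z t) (z (t + h)) h
          - f (jet x z t)) =O[𝓝[>] 0] (fun h : ℝ => h)

/-! ### Modified equations -/

/-- The truncation `c₀ + h c₁ + ⋯ + h^k c_k` after order `h^k` of a formal power series in `h`
whose coefficients are functions of `(x, ẋ, z)`. -/
def truncation {G : Type*} [AddCommGroup G] [Module ℝ G] (c : ℕ → E × E × ℝ → G)
    (k : ℕ) (h : ℝ) (m : E × E × ℝ) : G :=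
  ∑ i ∈ Finset.range (k + 1), h ^ i • c i m

/-- `(x, z)` is a solution of `ż = Λ(x, ẋ, z)`, `ẍ = φ(x, ẋ, z)` on the interval `(-δ, δ)`,
staying in the configuration space `U`. -/
def IsSolutionOn (U : Set E) (Lag : E × E × ℝ → ℝ) (φ : E × E × ℝ → E) (δ : ℝ)
    (x : ℝ → E) (z : ℝ → ℝ) : Prop :=
  ∀ t ∈ Set.Ioo (-δ) δ, x t ∈ U ∧ HasDerivAt z (Lag (jet x z t)) t ∧
    HasDerivAt x (deriv x t) t ∧ HasDerivAt (deriv x) (φ (jet x z t)) t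

/-- The formal power series `∑ hⁱ ℒᵢ` and `∑ hⁱ fᵢ`, with `ℒ₀ = ℒ` and `f₀ = f`, form the system of
modified equations `ż = ℒ_mod(x, ẋ, z; h)`, `ẍ = f_mod(x, ẋ, z; h)` for the difference system
`(z_{j+1} - z_j) / h = L`, `(x_{j+1} - 2 x_j + x_{j-1}) / h² = F`: for every `k` the solutions of the
system truncated after order `h^k` satisfy the difference equations with a defect of order
`k + 1`. The truncated system depends on `h`, so a solution is a family `(X h, Z h)` with a
fixed initial point `(x, ẋ, z)`; the system is autonomous, so that it is enough to take the
initial time `0`. -/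
structure IsModifiedSystem (U : Set E) (Lag : E × E × ℝ → ℝ) (f : E × E × ℝ → E)
    (L : E → E → ℝ → ℝ → ℝ → ℝ) (F : E → E → E → ℝ → ℝ → ℝ → ℝ → E)
    (Lmod : ℕ → E × E × ℝ → ℝ) (fmod : ℕ → E × E × ℝ → E) : Prop where
  smooth_L : ∀ i, ContDiffOn ℝ ∞ (Lmod i) (phase U)
  smooth_f : ∀ i, ContDiffOn ℝ ∞ (fmod i) (phase U)
  leading_L : ∀ m ∈ phase U, Lmod 0 m = Lag m
  leading_f : ∀ m ∈ phase U, fmod 0 m = f m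
  defect : ∀ (k : ℕ), ∀ m ∈ phase U, ∀ (δ : ℝ) (X : ℝ → ℝ → E) (Z : ℝ → ℝ → ℝ), 0 < δ →
    (∀ h ∈ Set.Ioo 0 δ, jet (X h) (Z h) 0 = m ∧
      IsSolutionOn U (truncation Lmod k h) (truncation fmod k h) δ (X h) (Z h)) →
    ((fun h : ℝ => (Z h h - Z h 0) / h - L (X h 0) (X h h) (Z h 0) (Z h h) h)
      =O[𝓝[>] 0] (fun h : ℝ => h ^ (k + 1))) ∧
    ((fun h : ℝ => secondDifference (X h (-h)) (X h 0) (X h h) h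
        - F (X h (-h)) (X h 0) (X h h) (Z h (-h)) (Z h 0) (Z h h) h)
      =O[𝓝[>] 0] (fun h : ℝ => h ^ (k + 1)))

end Herglotz

end

/-!
The proof is geometric: up to high order in `h`, the modified flow preserves a contact structure,
and this forces the modified Lagrangian to satisfy the generalized Euler-Lagrange equations.

Write the discrete Lagrangian as a smooth function `l(x, v, z, w; h)` of the point and the difference
quotients. The discrete evolution of the action equates `w` and `l`; differentiating this equation
shows that one step pulls the contact form `dz - p dx` at its end back to a multiple of the one at
its start, where `p` is the momentum `momentumEnd l`, respectively `momentumStart l`. The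
discrete generalized Euler-Lagrange equation says exactly that the momentum at the end of a step is
the momentum at the start of the next one (`momentum_eq_of_discreteGeneralizedEL`). The modified
flow, for time `h`, satisfies both equations up to a high power of `h`. Hence it preserves the
contact structure up to a high power of `h` (`IsLocalFlow.pullback_momentum_isBigO`), and so do
its iterates for times `2h, 3h, …`. Numerical differentiation in the time variable gives the
infinitesimal statement for the vector field `(ẋ, f_mod, ℒ_mod)`
(`IsLocalFlow.lieDeriv_contactForm_isBigO`). For a second order field with `ż = Λ` it says that `p`
agrees with `∂Λ/∂ẋ` and that the Euler-Lagrange residual of `Λ` is small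
(`IsLocalFlow.residual_isBigO_of_defect`).

The hypotheses bound the defect of the second order equation with right hand side `F`, which is
equivalent to the discrete Euler-Lagrange equation only on exact solutions of the discrete
evolution of the action. The nodes of the modified flow are therefore compared with nearby exact
solutions of the difference system in the unknowns `(a, w, c)`, the second difference quotient of `x`
and both difference quotients of `z`. The system determines these unknowns because consistency of `F`
makes `a` drop out of its right hand side at `h = 0` (`isInvertible_fderiv_nodeEquation`), and the
defect of the momenta is then bounded by that of the system (`IsQuotientForm.momentum_isBigO`).

Differentiations lose powers of `h`, so the argument is applied to the truncation after order
`h^(k+2)`; passing to the truncation after order `h^k` changes the residual by `O(h^(k+1))` only.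
Estimates that hold at each point become locally uniform, and may be differentiated, because
everything is smooth up to `h = 0` (`SmoothNear.exists_eq_pow_smul`). To have smooth local flows with
parameters, the flow is obtained from the implicit function theorem on a space of continuous paths
(`exists_localFlow`). Finally the acceleration defined by the truncated Lagrangian differs from the
truncated `f_mod` by the inverse Hessian applied to the residual.
-/

noncomputable section

namespace Herglotz

open Filter Asymptotics

universe u v

/-! ### Composition operators on spaces of continuous functions -/

section Nemytskii

variable {K : Type*} [TopologicalSpace K] [CompactSpace K]
  {X : Type u} [NormedAddCommGroup X] [NormedSpace ℝ X]

/-- Pointwise application of a family of operators to a family of vectors. -/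
def pointwiseApply (K : Type*) [TopologicalSpace K] [CompactSpace K] (X Z : Type*)
    [NormedAddCommGroup X] [NormedSpace ℝ X] [NormedAddCommGroup Z] [NormedSpace ℝ Z] :
    C(K, X →L[ℝ] Z) →L[ℝ] C(K, X) →L[ℝ] C(K, Z) :=
  LinearMap.mkContinuous₂ (LinearMap.mk₂ ℝ
    (fun (A : C(K, X →L[ℝ] Z)) (δ : C(K, X)) => (⟨fun s => A s (δ s), by fun_prop⟩ : C(K, Z)))
    (fun A B δ => by ext s; simp) (fun c A δ => by ext s; simp)
    (fun A δ ε => by ext s; simp) (fun c A δ => by ext s; simp)) 1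
    (fun A δ => by
      rw [one_mul, ContinuousMap.norm_le _ (by positivity)]
      intro s
      refine ((A s).le_opNorm (δ s)).trans ?_
      gcongr
      exacts [A.norm_coe_le_norm s, δ.norm_coe_le_norm s])

lemma hasFDerivAt_continuousMap_comp {Z : Type v} [NormedAddCommGroup Z] [NormedSpace ℝ Z]
    {f : X → Z} {f' : X → X →L[ℝ] Z} (hf : ∀ x, HasFDerivAt f (f' x) x) (hc : Continuous f)
    (hc' : Continuous f') (γ : C(K, X)) :
    HasFDerivAt (fun δ : C(K, X) => (ContinuousMap.mk f hc).comp δ)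
      (pointwiseApply K X Z ((ContinuousMap.mk f' hc').comp γ)) γ := by
  rw [hasFDerivAt_iff_isLittleO_nhds_zero, isLittleO_iff]
  intro ε hε
  -- uniform continuity of `f'` near the compact range of `γ` makes the remainder uniform
  have h := (isCompact_range γ.continuous).uniformContinuousAt_of_continuousAt f'
    (fun a _ => hc'.continuousAt) (Metric.dist_mem_uniformity hε)
  obtain ⟨r, hr, hr'⟩ := Metric.mem_uniformity_dist.1 h
  filter_upwards [Metric.ball_mem_nhds (0 : C(K, X)) hr] with δ hδ
  rw [ContinuousMap.norm_le _ (by positivity)]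
  intro s
  have hb : ∀ y ∈ Metric.ball (γ s) r, ‖f' y - f' (γ s)‖ ≤ ε := by
    intro y hy
    have := hr' (a := γ s) (b := y) (by rwa [dist_comm]) ⟨s, rfl⟩
    rw [← dist_eq_norm, dist_comm]
    exact this.le
  have hs : ‖δ s‖ < r := lt_of_le_of_lt (δ.norm_coe_le_norm s) (by simpa using hδ)
  have := Convex.norm_image_sub_le_of_norm_hasFDerivWithin_le' (f := f) (f' := f')
    (φ := f' (γ s)) (x := γ s) (y := γ s + δ s)
    (fun y _ => (hf y).hasFDerivWithinAt) hb (convex_ball _ _) (Metric.mem_ball_self hr)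
    (by simpa using hs)
  simp only [add_sub_cancel_left] at this
  exact this.trans (mul_le_mul_of_nonneg_left (δ.norm_coe_le_norm s) hε.le)

lemma contDiff_continuousMap_comp_aux (n : ℕ) :
    ∀ {Z : Type (max u v)} [NormedAddCommGroup Z] [NormedSpace ℝ Z] {f : X → Z}
      (_ : ContDiff ℝ n f) (hc : Continuous f),
      ContDiff ℝ n (fun δ : C(K, X) => (ContinuousMap.mk f hc).comp δ) := by
  induction n with
  | zero =>
    intro Z _ _ f _ hc
    exact contDiff_zero.2 (ContinuousMap.continuous_postcomp _)
  | succ n ih =>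
    intro Z _ _ f hf hc
    push_cast at hf ⊢
    obtain ⟨f', hf', hd⟩ := contDiff_succ_iff_hasFDerivAt.1 hf
    refine contDiff_succ_iff_hasFDerivAt.2 ⟨_, ?_,
      fun γ => hasFDerivAt_continuousMap_comp hd hc hf'.continuous γ⟩
    exact (pointwiseApply K X Z).contDiff.comp (ih hf' hf'.continuous)

/-- Composition with a smooth function is a smooth operator on continuous functions. -/
lemma contDiff_continuousMap_comp {Z : Type v} [NormedAddCommGroup Z] [NormedSpace ℝ Z] {f : X → Z}
    (hf : ContDiff ℝ ∞ f) :
    ContDiff ℝ ∞ (fun δ : C(K, X) => (ContinuousMap.mk f hf.continuous).comp δ) := by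
  rw [contDiff_infty]
  intro n
  -- `ULift` puts domain and codomain into one universe, as the induction on `n` requires
  let e : ULift.{u} Z ≃L[ℝ] Z := ContinuousLinearEquiv.ulift
  have h1 : ContDiff ℝ n (fun x => e.symm (f x)) :=
    e.symm.contDiff.comp (hf.of_le (by exact_mod_cast le_top))
  have h2 := contDiff_continuousMap_comp_aux (K := K) n h1 h1.continuous
  exact ((e : ULift.{u} Z →L[ℝ] Z).compLeftContinuous ℝ K).contDiff.comp h2

end Nemytskii

/-! ### Smoothness near a point -/

section SmoothNear

variable {P : Type*} [NormedAddCommGroup P] [NormedSpace ℝ P]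
  {G : Type*} [NormedAddCommGroup G] [NormedSpace ℝ G]
  {H : Type*} [NormedAddCommGroup H] [NormedSpace ℝ H]

/-- `g` is smooth on a neighbourhood of `p`. (`ContDiffAt ℝ ∞ g p` only says that for each `n` it is
`C^n` on a neighbourhood that may depend on `n`.) -/
@[fun_prop]
def SmoothNear (g : P → G) (p : P) : Prop := ∀ᶠ y in 𝓝 p, ContDiffAt ℝ ∞ g y

lemma SmoothNear.contDiffAt {g : P → G} {p : P} (h : SmoothNear g p) : ContDiffAt ℝ ∞ g p :=
  h.self_of_nhds

lemma SmoothNear.continuousAt {g : P → G} {p : P} (h : SmoothNear g p) : ContinuousAt g p :=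
  h.contDiffAt.continuousAt

lemma SmoothNear.differentiableAt {g : P → G} {p : P} (h : SmoothNear g p) :
    DifferentiableAt ℝ g p :=
  h.contDiffAt.differentiableAt (by simp)

lemma SmoothNear.eventually {g : P → G} {p : P} (h : SmoothNear g p) :
    ∀ᶠ y in 𝓝 p, SmoothNear g y :=
  eventually_eventually_nhds.2 h

lemma _root_.ContDiff.smoothNear {g : P → G} (h : ContDiff ℝ ∞ g) (p : P) : SmoothNear g p :=
  Eventually.of_forall fun _ => h.contDiffAt

lemma _root_.ContDiffOn.smoothNear {g : P → G} {s : Set P} (h : ContDiffOn ℝ ∞ g s)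
    (hs : IsOpen s) {p : P} (hp : p ∈ s) : SmoothNear g p := by
  filter_upwards [hs.mem_nhds hp] with y hy using h.contDiffAt (hs.mem_nhds hy)

@[fun_prop]
lemma SmoothNear.id (p : P) : SmoothNear (fun x : P => x) p := contDiff_id.smoothNear p

@[fun_prop]
lemma SmoothNear.const (c : G) (p : P) : SmoothNear (fun _ : P => c) p := contDiff_const.smoothNear p

@[fun_prop]
lemma SmoothNear.comp {g : G → H} {f : P → G} {p : P} (hg : SmoothNear g (f p))
    (hf : SmoothNear f p) : SmoothNear (fun x => g (f x)) p := by
  filter_upwards [hf, hf.continuousAt.eventually hg] with y h1 h2 using h2.comp y h1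

@[fun_prop]
lemma SmoothNear.prodMk {g : P → H} {f : P → G} {p : P} (hf : SmoothNear f p)
    (hg : SmoothNear g p) : SmoothNear (fun x => (f x, g x)) p := by
  filter_upwards [hf, hg] with y h1 h2 using h1.prodMk h2

@[fun_prop]
lemma SmoothNear.fst {f : P → G × H} {p : P} (hf : SmoothNear f p) :
    SmoothNear (fun x => (f x).1) p := by
  filter_upwards [hf] with y h1 using h1.fst

@[fun_prop]
lemma SmoothNear.snd {f : P → G × H} {p : P} (hf : SmoothNear f p) :
    SmoothNear (fun x => (f x).2) p := by
  filter_upwards [hf] with y h1 using h1.snd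

@[fun_prop]
lemma SmoothNear.add {f g : P → G} {p : P} (hf : SmoothNear f p) (hg : SmoothNear g p) :
    SmoothNear (fun x => f x + g x) p := by
  filter_upwards [hf, hg] with y h1 h2 using h1.add h2

@[fun_prop]
lemma SmoothNear.sub {f g : P → G} {p : P} (hf : SmoothNear f p) (hg : SmoothNear g p) :
    SmoothNear (fun x => f x - g x) p := by
  filter_upwards [hf, hg] with y h1 h2 using h1.sub h2

@[fun_prop]
lemma SmoothNear.neg {f : P → G} {p : P} (hf : SmoothNear f p) :
    SmoothNear (fun x => - f x) p := by
  filter_upwards [hf] with y h1 using h1.neg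

@[fun_prop]
lemma SmoothNear.smul {f : P → ℝ} {g : P → G} {p : P} (hf : SmoothNear f p)
    (hg : SmoothNear g p) : SmoothNear (fun x => f x • g x) p := by
  filter_upwards [hf, hg] with y h1 h2 using h1.smul h2

@[fun_prop]
lemma SmoothNear.mul {f g : P → ℝ} {p : P} (hf : SmoothNear f p)
    (hg : SmoothNear g p) : SmoothNear (fun x => f x * g x) p := by
  filter_upwards [hf, hg] with y h1 h2 using h1.mul h2

@[fun_prop]
lemma SmoothNear.pow {f : P → ℝ} {p : P} (hf : SmoothNear f p) (n : ℕ) :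
    SmoothNear (fun x => f x ^ n) p := by
  filter_upwards [hf] with y h1 using h1.pow n

@[fun_prop]
lemma SmoothNear.div_const {f : P → ℝ} {p : P} (hf : SmoothNear f p) (c : ℝ) :
    SmoothNear (fun x => f x / c) p := by
  filter_upwards [hf] with y h1 using h1.div_const c

@[fun_prop]
lemma SmoothNear.inv {f : P → ℝ} {p : P} (hf : SmoothNear f p) (h0 : f p ≠ 0) :
    SmoothNear (fun x => (f x)⁻¹) p := by
  filter_upwards [hf, hf.continuousAt.eventually_ne h0] with y h1 h2 using h1.inv h2

@[fun_prop]
lemma SmoothNear.clm_apply {f : P → G →L[ℝ] H} {g : P → G} {p : P} (hf : SmoothNear f p)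
    (hg : SmoothNear g p) : SmoothNear (fun x => f x (g x)) p := by
  filter_upwards [hf, hg] with y h1 h2 using h1.clm_apply h2

@[fun_prop]
lemma SmoothNear.clm_comp {Q : Type*} [NormedAddCommGroup Q] [NormedSpace ℝ Q]
    {f : P → G →L[ℝ] H} {g : P → Q →L[ℝ] G} {p : P} (hf : SmoothNear f p)
    (hg : SmoothNear g p) : SmoothNear (fun x => (f x).comp (g x)) p := by
  filter_upwards [hf, hg] with y h1 h2 using h1.clm_comp h2

lemma SmoothNear.sum {ι : Type*} {s : Finset ι} {f : ι → P → G} {p : P}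
    (hf : ∀ i ∈ s, SmoothNear (f i) p) : SmoothNear (fun x => ∑ i ∈ s, f i x) p := by
  filter_upwards [(Filter.eventually_all_finset s).2 hf] with y h1 using ContDiffAt.sum h1

@[fun_prop]
lemma SmoothNear.fderiv {f : P → G} {p : P} (hf : SmoothNear f p) :
    SmoothNear (fun x => fderiv ℝ f x) p := by
  filter_upwards [hf] with y h1 using h1.fderiv_right (by simp)

/-- On a finite dimensional space a germ of smooth functions extends to a smooth function of
compact support. -/
lemma SmoothNear.exists_contDiff [FiniteDimensional ℝ P] {g : P → G} {p : P}
    (h : SmoothNear g p) :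
    ∃ g' : P → G, ContDiff ℝ ∞ g' ∧ HasCompactSupport g' ∧ g' =ᶠ[𝓝 p] g := by
  obtain ⟨r, hr, hb⟩ := Metric.eventually_nhds_iff_ball.1 h
  let χ : ContDiffBump p := ⟨r / 4, r / 2, by positivity, by linarith⟩
  have hsub : tsupport χ ⊆ Metric.ball p r := by
    rw [χ.tsupport_eq]
    exact Metric.closedBall_subset_ball (by simp only [χ]; linarith)
  refine ⟨fun x => χ x • g x, ?_, ?_, ?_⟩
  · rw [contDiff_iff_contDiffAt]
    intro x
    by_cases hx : x ∈ Metric.ball p r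
    · exact χ.contDiff.contDiffAt.smul (hb x hx)
    · have : (fun x => χ x • g x) =ᶠ[𝓝 x] fun _ => 0 := by
        filter_upwards [(isClosed_tsupport χ).isOpen_compl.mem_nhds (fun h => hx (hsub h))]
          with y hy
        rw [image_eq_zero_of_notMem_tsupport hy, zero_smul]
      exact contDiffAt_const.congr_of_eventuallyEq this
  · exact χ.hasCompactSupport.smul_right
  · filter_upwards [χ.eventuallyEq_one] with x hx
    simp [hx]

end SmoothNear

/-! ### Division by the last variable -/

section Factor

variable {P : Type*} [NormedAddCommGroup P] [NormedSpace ℝ P]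
  {G : Type*} [NormedAddCommGroup G] [NormedSpace ℝ G] [CompleteSpace G]

/-- The mean over the unit interval of a continuous function. -/
def meanCLM (G : Type*) [NormedAddCommGroup G] [NormedSpace ℝ G] : C(unitInterval, G) →L[ℝ] G :=
  LinearMap.mkContinuous
    { toFun := fun γ => ∫ s in (0 : ℝ)..1, γ (Set.projIcc 0 1 zero_le_one s)
      map_add' := fun γ δ => by
        simp only [ContinuousMap.add_apply]
        exact intervalIntegral.integral_add
          ((γ.continuous.comp continuous_projIcc).intervalIntegrable _ _)
          ((δ.continuous.comp continuous_projIcc).intervalIntegrable _ _)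
      map_smul' := fun c γ => by
        simp only [ContinuousMap.smul_apply, RingHom.id_apply]
        exact intervalIntegral.integral_smul _ _ } 1
    (fun γ => by
      have := intervalIntegral.norm_integral_le_of_norm_le_const (a := (0 : ℝ)) (b := 1)
        (f := fun s => γ (Set.projIcc 0 1 zero_le_one s)) (C := ‖γ‖)
        (fun s _ => γ.norm_coe_le_norm _)
      simpa using this)

/-- **Hadamard's lemma** with parameters: `g(p, h) - g(p, 0) = h q(p, h)` with `q` smooth, namely
`q(p, h) = ∫₀¹ ∂_h g(p, s h) ds`. -/
lemma exists_contDiff_eq_add_smul {g : P × ℝ → G} (hg : ContDiff ℝ ∞ g) :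
    ∃ q : P × ℝ → G, ContDiff ℝ ∞ q ∧ ∀ y, g y = g (y.1, 0) + y.2 • q y := by
  let g' : P × ℝ → G := fun y => fderiv ℝ g y (0, 1)
  have hg' : ContDiff ℝ ∞ g' := (hg.fderiv_right (by simp)).clm_apply contDiff_const
  -- the segment `s ↦ (p, s h)` as a continuous function that depends linearly on `(p, h)`
  let A : (P × ℝ) →L[ℝ] C(unitInterval, P × ℝ) :=
    (ContinuousLinearMap.const ℝ unitInterval).comp
        ((ContinuousLinearMap.inl ℝ P ℝ).comp (ContinuousLinearMap.fst ℝ P ℝ))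
      + (ContinuousLinearMap.toSpanSingleton ℝ
          (⟨fun s => ((0 : P), (s : ℝ)), by fun_prop⟩ : C(unitInterval, P × ℝ))).comp
        (ContinuousLinearMap.snd ℝ P ℝ)
  have hA : ∀ y s, A y s = (y.1, (s : ℝ) * y.2) := by
    intro y s
    simp [A, mul_comm]
  refine ⟨fun y => meanCLM G ((ContinuousMap.mk g' hg'.continuous).comp (A y)), ?_, ?_⟩
  · exact (meanCLM G).contDiff.comp ((contDiff_continuousMap_comp hg').comp A.contDiff)
  · rintro ⟨p, h⟩
    have hd : ∀ s ∈ Set.uIcc (0 : ℝ) 1,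
        HasDerivAt (fun s : ℝ => g (p, s * h)) (h • g' (p, s * h)) s := by
      intro s _
      have h1 : HasDerivAt (fun s : ℝ => (p, s * h)) ((0 : P), h) s :=
        (hasDerivAt_const s p).prodMk (by simpa using (hasDerivAt_id s).mul_const h)
      have h2 := ((hg.differentiable (by simp)) (p, s * h)).hasFDerivAt.comp_hasDerivAt s h1
      have h3 : ((0 : P), h) = h • ((0 : P), (1 : ℝ)) := by simp
      rw [h3, map_smul] at h2
      exact h2
    have hi : IntervalIntegrable (fun s : ℝ => h • g' (p, s * h)) MeasureTheory.volume 0 1 := by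
      have := hg'.continuous
      exact Continuous.intervalIntegrable (by fun_prop) _ _
    have := intervalIntegral.integral_eq_sub_of_hasDerivAt hd hi
    have he : meanCLM G ((ContinuousMap.mk g' hg'.continuous).comp (A (p, h)))
        = ∫ s in (0 : ℝ)..1, g' (p, s * h) := by
      refine intervalIntegral.integral_congr fun s hs => ?_
      rw [Set.uIcc_of_le zero_le_one] at hs
      simp [hA, Set.projIcc_of_mem _ hs]
    rw [intervalIntegral.integral_smul] at this
    simp only [he, this, one_mul, zero_mul]
    abel

variable [FiniteDimensional ℝ P]

lemma SmoothNear.exists_eq_add_smul {g : P × ℝ → G} {p : P} (hg : SmoothNear g (p, 0)) :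
    ∃ q : P × ℝ → G, SmoothNear q (p, 0) ∧
      ∀ᶠ y in 𝓝 (p, (0 : ℝ)), g y = g (y.1, 0) + y.2 • q y := by
  obtain ⟨g', h1, -, h2⟩ := hg.exists_contDiff
  obtain ⟨q, hq, hq'⟩ := exists_contDiff_eq_add_smul h1
  refine ⟨q, hq.smoothNear _, ?_⟩
  have hc : Tendsto (fun y : P × ℝ => (y.1, (0 : ℝ))) (𝓝 (p, 0)) (𝓝 (p, 0)) :=
    Continuous.tendsto' (by fun_prop) _ _ rfl
  filter_upwards [h2, hc.eventually h2] with y hy hy'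
  rw [← hy, ← hy', hq' y]

/-- A smooth function `g(p, h)` which for each fixed `p` is `O(hⁿ)` as `h → 0⁺` is divisible
by `hⁿ`. This turns estimates at each point into locally uniform ones that may be differentiated
in `p`. -/
lemma SmoothNear.exists_eq_pow_smul {g : P × ℝ → G} {p : P} (hg : SmoothNear g (p, 0)) (n : ℕ)
    (hO : ∀ᶠ x in 𝓝 p, (fun h : ℝ => g (x, h)) =O[𝓝[>] 0] (fun h : ℝ => h ^ n)) :
    ∃ e : P × ℝ → G, SmoothNear e (p, 0) ∧ ∀ᶠ y in 𝓝 (p, (0 : ℝ)), g y = y.2 ^ n • e y := by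
  induction n with
  | zero => exact ⟨g, hg, Eventually.of_forall fun y => by simp⟩
  | succ n ih =>
    obtain ⟨e, he, hge⟩ := ih (hO.mono fun x hx => hx.trans <| by
      refine IsBigO.of_bound 1 ?_
      filter_upwards [Ioo_mem_nhdsGT (zero_lt_one (α := ℝ))] with h hh
      rw [one_mul, norm_pow, norm_pow, Real.norm_of_nonneg hh.1.le]
      exact pow_le_pow_of_le_one hh.1.le hh.2.le (Nat.le_succ n))
    have h0 : ∀ᶠ x in 𝓝 p, e (x, 0) = 0 := by
      have hc : ContinuousAt (fun x : P => (x, (0 : ℝ))) p := by fun_prop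
      have h1 : ∀ᶠ x in 𝓝 p, SmoothNear e (x, 0) := hc.eventually he.eventually
      have h2 : ∀ᶠ x in 𝓝 p, ∀ᶠ y in 𝓝 (x, (0 : ℝ)), g y = y.2 ^ n • e y :=
        hc.eventually hge.eventually_nhds
      filter_upwards [hO, h1, h2] with x hx1 hx2 hx3
      have hcx : Tendsto (fun h : ℝ => (x, h)) (𝓝[>] 0) (𝓝 (x, 0)) :=
        (Continuous.tendsto' (by fun_prop) _ _ rfl).mono_left nhdsWithin_le_nhds
      have hlim : Tendsto (fun h : ℝ => e (x, h)) (𝓝[>] 0) (𝓝 (e (x, 0))) :=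
        hx2.continuousAt.tendsto.comp hcx
      refine tendsto_nhds_unique hlim ?_
      obtain ⟨C, hC⟩ := hx1.bound
      refine squeeze_zero_norm' (a := fun h : ℝ => C * h) ?_ ?_
      · filter_upwards [hC, hcx.eventually hx3, self_mem_nhdsWithin] with h k1 k2 k3
        have k3' : (0 : ℝ) < h := k3
        rw [k2, norm_smul, norm_pow, norm_pow, Real.norm_of_nonneg k3'.le] at k1
        have : h ^ n * ‖e (x, h)‖ ≤ h ^ n * (C * h) := by
          calc _ ≤ _ := k1
            _ = _ := by ring
        exact le_of_mul_le_mul_left this (by positivity)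
      · have : Tendsto (fun h : ℝ => C * h) (𝓝 0) (𝓝 (C * 0)) :=
          (continuous_const.mul continuous_id).tendsto 0
        rw [mul_zero] at this
        exact this.mono_left nhdsWithin_le_nhds
    obtain ⟨q, hq, heq⟩ := he.exists_eq_add_smul
    refine ⟨q, hq, ?_⟩
    have hc : Tendsto (fun y : P × ℝ => y.1) (𝓝 (p, 0)) (𝓝 p) :=
      Continuous.tendsto' (by fun_prop) _ _ rfl
    filter_upwards [hge, heq, hc.eventually h0] with y k1 k2 k3
    rw [k1, k2, k3, zero_add, smul_smul, pow_succ]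

end Factor

/-! ### Implicit functions and local flows -/

section Flow

/-- The implicit function of a smooth equation is smooth near the base point. -/
lemma exists_smoothNear_implicit {P C G : Type*} [NormedAddCommGroup P] [NormedSpace ℝ P]
    [CompleteSpace P] [NormedAddCommGroup C] [NormedSpace ℝ C] [CompleteSpace C]
    [NormedAddCommGroup G] [NormedSpace ℝ G] [CompleteSpace G]
    {f : P × C → G} {u : P × C} (hf : SmoothNear f u) (h0 : f u = 0)
    (hinv : (fderiv ℝ f u ∘L .inr ℝ P C).IsInvertible) :
    ∃ ψ : P → C, ψ u.1 = u.2 ∧ SmoothNear ψ u.1 ∧ ∀ᶠ v in 𝓝 u, f v = 0 ↔ ψ v.1 = v.2 := by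
  have hne : (∞ : WithTop ℕ∞) ≠ 0 := by simp
  let ψ := hf.contDiffAt.implicitFunction hne hinv
  have hψu : ψ u.1 = u.2 := hf.contDiffAt.implicitFunction_apply_self hne hinv
  have hiff : ∀ᶠ v in 𝓝 u, f v = 0 ↔ ψ v.1 = v.2 := by
    have := hf.contDiffAt.eventually_apply_eq_iff_implicitFunction hne hinv
    rwa [h0] at this
  have hψc : ContDiffAt ℝ ∞ ψ u.1 := hf.contDiffAt.contDiffAt_implicitFunction hne hinv
  refine ⟨ψ, hψu, ?_, hiff⟩
  have hinv' : ∀ᶠ v in 𝓝 u, (fderiv ℝ f v ∘L .inr ℝ P C).IsInvertible := by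
    have hc : ContinuousAt (fun v => fderiv ℝ f v ∘L .inr ℝ P C) u :=
      (hf.fderiv.clm_comp (SmoothNear.const (ContinuousLinearMap.inr ℝ P C) u)).continuousAt
    obtain ⟨e, he⟩ := hinv
    have := hc.eventually (he ▸ ContinuousLinearEquiv.nhds e)
    filter_upwards [this] with v ⟨e', he'⟩ using ⟨e', he'⟩
  have hgraph : ContinuousAt (fun p => (p, ψ p)) u.1 := continuousAt_id.prodMk hψc.continuousAt
  have hgt : Tendsto (fun p => (p, ψ p)) (𝓝 u.1) (𝓝 u) := by
    have := hgraph.tendsto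
    rwa [hψu] at this
  have hcont : ∀ᶠ p in 𝓝 u.1, ContinuousAt ψ p := by
    have h1 : ContDiffAt ℝ 1 ψ u.1 := hψc.of_le (by simp)
    exact (h1.eventually (by simp)).mono fun p hp => hp.continuousAt
  filter_upwards [hgt.eventually hinv', hgt.eventually hf, hgt.eventually hiff.eventually_nhds,
    hcont] with p h1 h2 h3 h4
  have hz : f (p, ψ p) = 0 := (h3.self_of_nhds).2 rfl
  have h5 : Tendsto (fun p' => (p', ψ p')) (𝓝 p) (𝓝 (p, ψ p)) :=
    (continuousAt_id.prodMk h4).tendsto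
  have h6 := h2.eventually_apply_eq_iff_implicitFunction hne h1
  rw [hz] at h6
  refine (h2.contDiffAt_implicitFunction hne h1).congr_of_eventuallyEq ?_
  filter_upwards [h5.eventually h6, h5.eventually h3] with p' k1 k2
  exact (k1.1 (k2.2 rfl)).symm

variable {M : Type*} [NormedAddCommGroup M] [NormedSpace ℝ M]

/-- The primitive `s ↦ ∫₀ˢ γ` of a continuous function on the unit interval. -/
def primitiveCLM (M : Type*) [NormedAddCommGroup M] [NormedSpace ℝ M] :
    C(unitInterval, M) →L[ℝ] C(unitInterval, M) :=
  LinearMap.mkContinuous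
    { toFun := fun γ => ⟨fun s => ∫ u in (0 : ℝ)..s, γ (Set.projIcc 0 1 zero_le_one u), by
        have h : Continuous fun u => γ (Set.projIcc 0 1 zero_le_one u) :=
          γ.continuous.comp continuous_projIcc
        exact (intervalIntegral.continuous_primitive (fun a b => h.intervalIntegrable a b) 0).comp
          continuous_subtype_val⟩
      map_add' := fun γ δ => by
        ext s
        exact intervalIntegral.integral_add
          ((γ.continuous.comp continuous_projIcc).intervalIntegrable _ _)
          ((δ.continuous.comp continuous_projIcc).intervalIntegrable _ _)
      map_smul' := fun c γ => by
        ext s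
        exact intervalIntegral.integral_smul _ _ } 1
    (fun γ => by
      rw [one_mul, ContinuousMap.norm_le _ (norm_nonneg _)]
      intro s
      have := intervalIntegral.norm_integral_le_of_norm_le_const (a := (0 : ℝ)) (b := s)
        (f := fun s => γ (Set.projIcc 0 1 zero_le_one s)) (C := ‖γ‖)
        (fun s _ => γ.norm_coe_le_norm _)
      refine this.trans ?_
      rw [sub_zero, abs_of_nonneg s.2.1]
      exact mul_le_of_le_one_right (norm_nonneg _) s.2.2)

lemma primitiveCLM_apply (γ : C(unitInterval, M)) (s : unitInterval) :
    primitiveCLM M γ s = ∫ u in (0 : ℝ)..s, γ (Set.projIcc 0 1 zero_le_one u) := rfl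

/-- The path `s ↦ (γ s, h)`. -/
def pathWithParameter (M : Type*) [NormedAddCommGroup M] [NormedSpace ℝ M] :
    C(unitInterval, M) × ℝ →L[ℝ] C(unitInterval, M × ℝ) :=
  ((ContinuousLinearMap.inl ℝ M ℝ).compLeftContinuous ℝ unitInterval).comp
      (ContinuousLinearMap.fst ℝ _ _)
    + (ContinuousLinearMap.const ℝ unitInterval).comp
      ((ContinuousLinearMap.inr ℝ M ℝ).comp (ContinuousLinearMap.snd ℝ _ _))

lemma pathWithParameter_apply (γ : C(unitInterval, M)) (h : ℝ) (s : unitInterval) :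
    pathWithParameter M (γ, h) s = (γ s, h) := by
  simp [pathWithParameter]

/-- The rescaled integral equation `γ(s) = m + τ ∫₀ˢ V(γ, h)` on the unit interval, for the
parameters `(τ, m, h)`: the value at `s = 1` of its solution is the flow of `V(·, h)` at time `τ`. -/
def flowEquation (V : M × ℝ → M) (hV : ContDiff ℝ ∞ V)
    (q : (ℝ × (M × ℝ)) × C(unitInterval, M)) : C(unitInterval, M) :=
  q.2 - ContinuousLinearMap.const ℝ unitInterval q.1.2.1
    - q.1.1 • primitiveCLM M
      ((ContinuousMap.mk V hV.continuous).comp (pathWithParameter M (q.2, q.1.2.2)))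

lemma contDiff_flowEquation (V : M × ℝ → M) (hV : ContDiff ℝ ∞ V) :
    ContDiff ℝ ∞ (flowEquation V hV) := by
  have h1 : ContDiff ℝ ∞ fun q : (ℝ × (M × ℝ)) × C(unitInterval, M) =>
      primitiveCLM M
        ((ContinuousMap.mk V hV.continuous).comp (pathWithParameter M (q.2, q.1.2.2))) :=
    (primitiveCLM M).contDiff.comp ((contDiff_continuousMap_comp hV).comp
      ((pathWithParameter M).contDiff.comp (by fun_prop)))
  have h2 : ContDiff ℝ ∞ fun q : (ℝ × (M × ℝ)) × C(unitInterval, M) =>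
      ContinuousLinearMap.const ℝ unitInterval q.1.2.1 :=
    (ContinuousLinearMap.contDiff _).comp (by fun_prop)
  exact (contDiff_snd.sub h2).sub (contDiff_fst.fst.smul h1)

lemma flowEquation_eq_zero_iff {V : M × ℝ → M} {hV : ContDiff ℝ ∞ V}
    {p : ℝ × (M × ℝ)} {γ : C(unitInterval, M)} :
    flowEquation V hV (p, γ) = 0 ↔ ∀ s : unitInterval, γ s = p.2.1
      + p.1 • ∫ u in (0 : ℝ)..s, V (γ (Set.projIcc 0 1 zero_le_one u), p.2.2) := by
  rw [ContinuousMap.ext_iff]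
  refine forall_congr' fun s => ?_
  have h : flowEquation V hV (p, γ) s = γ s - p.2.1 - p.1 • primitiveCLM M
      ((ContinuousMap.mk V hV.continuous).comp (pathWithParameter M (γ, p.2.2))) s := rfl
  rw [h, primitiveCLM_apply, ContinuousMap.zero_apply, sub_sub, sub_eq_zero]
  simp only [ContinuousMap.comp_apply, ContinuousMap.coe_mk, pathWithParameter_apply]

/-- A smooth vector field depending on a parameter has a local flow that is jointly smooth, and
satisfies `Φ(τ, m, h) = m + ∫₀^τ V(Φ(t, m, h), h) dt`. -/
lemma exists_smoothNear_integral_flow [CompleteSpace M] (V : M × ℝ → M) (hV : ContDiff ℝ ∞ V)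
    (y₀ : M × ℝ) :
    ∃ Φ : ℝ × (M × ℝ) → M, SmoothNear Φ (0, y₀) ∧
      ∀ᶠ p in 𝓝 ((0 : ℝ), y₀),
        Φ p = p.2.1 + ∫ t in (0 : ℝ)..p.1, V (Φ (t, p.2), p.2.2) := by
  let c₀ : C(unitInterval, M) := ContinuousLinearMap.const ℝ unitInterval y₀.1
  let p₀ : ℝ × (M × ℝ) := (0, y₀)
  have hsm := contDiff_flowEquation V hV
  have h0 : flowEquation V hV (p₀, c₀) = 0 := by
    rw [flowEquation_eq_zero_iff]
    intro s
    simp [c₀, p₀]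
  have hinv : (fderiv ℝ (flowEquation V hV) (p₀, c₀) ∘L
      .inr ℝ (ℝ × (M × ℝ)) C(unitInterval, M)).IsInvertible := by
    have h1 : HasFDerivAt (fun γ => flowEquation V hV (p₀, γ))
        (fderiv ℝ (flowEquation V hV) (p₀, c₀) ∘L
          .inr ℝ (ℝ × (M × ℝ)) C(unitInterval, M)) c₀ :=
      ((hsm.differentiable (by simp)) (p₀, c₀)).hasFDerivAt.comp c₀ (hasFDerivAt_prodMk_right p₀ c₀)
    have h2 : HasFDerivAt (fun γ => flowEquation V hV (p₀, γ))
        (ContinuousLinearMap.id ℝ C(unitInterval, M)) c₀ := by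
      have : (fun γ => flowEquation V hV (p₀, γ)) = fun γ => γ - c₀ := by
        funext γ
        simp [flowEquation, p₀, c₀]
      rw [this]
      exact (hasFDerivAt_id c₀).sub_const c₀
    rw [h1.unique h2]
    exact ⟨ContinuousLinearEquiv.refl ℝ _, rfl⟩
  obtain ⟨ψ, hψ0, hψ, hiff⟩ := exists_smoothNear_implicit (hsm.smoothNear (p₀, c₀)) h0 hinv
  refine ⟨fun p => ψ p 1, ?_, ?_⟩
  · exact ((ContinuousMap.evalCLM ℝ (1 : unitInterval)).contDiff.smoothNear (ψ p₀)).comp hψ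
  obtain ⟨r, hr, hr'⟩ := Metric.eventually_nhds_iff_ball.1 hiff
  have hclose : ∀ᶠ p in 𝓝 p₀, dist p p₀ < r ∧ dist (ψ p) c₀ < r := by
    have h1 : Tendsto ψ (𝓝 p₀) (𝓝 c₀) := by
      have := hψ.continuousAt.tendsto
      rwa [hψ0] at this
    filter_upwards [Metric.ball_mem_nhds p₀ hr, h1.eventually (Metric.ball_mem_nhds c₀ hr)]
      with p k1 k2 using ⟨k1, k2⟩
  filter_upwards [hclose] with p hp
  obtain ⟨τ, y⟩ := p
  have hsol : flowEquation V hV ((τ, y), ψ (τ, y)) = 0 := by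
    refine (hr' _ ?_).2 rfl
    rw [Metric.mem_ball, Prod.dist_eq]
    exact max_lt hp.1 hp.2
  rw [flowEquation_eq_zero_iff] at hsol
  -- `ψ (τ, y)` traced up to time `s` solves the equation with parameter `s τ`
  have hscale : ∀ s : unitInterval, ψ ((s : ℝ) * τ, y) 1 = ψ (τ, y) s := by
    intro s
    let γ : C(unitInterval, M) := (ψ (τ, y)).comp ⟨fun u => s * u, by fun_prop⟩
    have hγ : ψ ((s : ℝ) * τ, y) = γ := by
      refine (hr' (((s : ℝ) * τ, y), γ) ?_).1 ?_
      · rw [Metric.mem_ball, Prod.dist_eq]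
        refine max_lt (lt_of_le_of_lt ?_ hp.1) (lt_of_le_of_lt ?_ hp.2)
        · simp only [p₀, Prod.dist_eq, dist_zero_right, norm_mul]
          refine max_le_max_right _ ?_
          refine mul_le_of_le_one_left (norm_nonneg _) ?_
          rw [Real.norm_of_nonneg s.2.1]
          exact s.2.2
        · rw [ContinuousMap.dist_le dist_nonneg]
          intro u
          exact ContinuousMap.dist_apply_le_dist (f := ψ (τ, y)) (g := c₀) (s * u)
      · rw [flowEquation_eq_zero_iff]
        intro u
        have h1 := hsol (s * u)
        change ψ (τ, y) (s * u) = _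
        rw [h1]
        congr 1
        rw [mul_comm (s : ℝ) τ, mul_smul]
        congr 1
        have h2 : ∀ t ∈ Set.uIcc (0 : ℝ) u, V (γ (Set.projIcc 0 1 zero_le_one t), y.2)
            = (fun t => V (ψ (τ, y) (Set.projIcc 0 1 zero_le_one t), y.2)) ((s : ℝ) * t) := by
          intro t ht
          rw [Set.uIcc_of_le u.2.1] at ht
          have ht1 : t ∈ Set.Icc (0 : ℝ) 1 := ⟨ht.1, ht.2.trans u.2.2⟩
          have ht2 : (s : ℝ) * t ∈ Set.Icc (0 : ℝ) 1 :=
            (s * (⟨t, ht1⟩ : unitInterval)).2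
          simp only [γ, Set.projIcc_of_mem _ ht1, Set.projIcc_of_mem _ ht2]
          rfl
        rw [intervalIntegral.integral_congr h2]
        have h3 := intervalIntegral.smul_integral_comp_mul_left (a := 0) (b := (u : ℝ))
          (fun t => V (ψ (τ, y) (Set.projIcc 0 1 zero_le_one t), y.2)) (s : ℝ)
        rw [mul_zero] at h3
        exact h3.symm
    rw [hγ]
    simp [γ]
  have h1 := hsol 1
  refine h1.trans ?_
  congr 1
  have h2 : ∀ u ∈ Set.uIcc (0 : ℝ) (1 : unitInterval),
      V (ψ (τ, y) (Set.projIcc 0 1 zero_le_one u), y.2)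
        = (fun t => V (ψ (t, y) 1, y.2)) (u * τ) := by
    intro u hu
    have hu' : u ∈ Set.Icc (0 : ℝ) 1 := by
      rw [Set.uIcc_of_le (by simp)] at hu
      simpa using hu
    simp only [Set.projIcc_of_mem _ hu', ← hscale ⟨u, hu'⟩]
  rw [intervalIntegral.integral_congr h2]
  have h3 := intervalIntegral.smul_integral_comp_mul_right (a := 0) (b := 1)
    (fun t => V (ψ (t, y) 1, y.2)) τ
  rw [zero_mul, one_mul] at h3
  exact h3

/-- `Φ(t, m, h)` is the flow of the vector field `V(·, h)` for small times and `(m, h)` near `y₀`. -/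
structure IsLocalFlow (V : M × ℝ → M) (Φ : ℝ × (M × ℝ) → M) (y₀ : M × ℝ) : Prop where
  smooth : SmoothNear Φ (0, y₀)
  zero : ∀ᶠ y in 𝓝 y₀, Φ (0, y) = y.1
  hasDerivAt : ∀ᶠ p in 𝓝 ((0 : ℝ), y₀), HasDerivAt (fun t => Φ (t, p.2)) (V (Φ p, p.2.2)) p.1
  add : ∀ᶠ q in 𝓝 ((0 : ℝ), (0 : ℝ), y₀),
    Φ (q.1 + q.2.1, q.2.2) = Φ (q.2.1, (Φ (q.1, q.2.2), q.2.2.2))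

/-- The local flow of a smooth vector field `V(·, h)` with a parameter `h`. -/
theorem exists_localFlow [FiniteDimensional ℝ M] {V : M × ℝ → M} {y₀ : M × ℝ}
    (hV : SmoothNear V y₀) :
    ∃ Φ : ℝ × (M × ℝ) → M, IsLocalFlow V Φ y₀ := by
  have : CompleteSpace M := FiniteDimensional.complete ℝ M
  obtain ⟨W, hW, hWc, hWV⟩ := hV.exists_contDiff
  obtain ⟨Φ, hΦ, hint⟩ := exists_smoothNear_integral_flow W hW y₀
  obtain ⟨r, hr, hball⟩ := Metric.eventually_nhds_iff_ball.1 (hint.and hΦ)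
  have hmem : ∀ t : ℝ, |t| < r → ∀ y ∈ Metric.ball y₀ r, (t, y) ∈ Metric.ball ((0 : ℝ), y₀) r := by
    intro t ht y hy
    rw [Metric.mem_ball, Prod.dist_eq]
    exact max_lt (by simpa using ht) hy
  have hzero : ∀ y ∈ Metric.ball y₀ r, Φ (0, y) = y.1 := by
    intro y hy
    simpa using (hball _ (hmem 0 (by simpa using hr) y hy)).1
  have hderiv : ∀ t : ℝ, |t| < r → ∀ y ∈ Metric.ball y₀ r,
      HasDerivAt (fun t => Φ (t, y)) (W (Φ (t, y), y.2)) t := by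
    intro t ht y hy
    have hcont : ContinuousOn (fun t => W (Φ (t, y), y.2)) (Set.Ioo (-r) r) := by
      intro s hs
      have h1 : ContinuousAt Φ (s, y) := (hball _ (hmem s (abs_lt.2 hs) y hy)).2.continuousAt
      have h2 : ContinuousAt (fun s : ℝ => Φ (s, y)) s :=
        ContinuousAt.comp (f := fun s : ℝ => (s, y)) h1 (by fun_prop)
      exact (hW.continuous.continuousAt.comp (h2.prodMk continuousAt_const)).continuousWithinAt
    have hts : t ∈ Set.Ioo (-r) r := abs_lt.1 ht
    have hsub : Set.uIcc 0 t ⊆ Set.Ioo (-r) r :=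
      (Set.ordConnected_Ioo.uIcc_subset ⟨by linarith, hr⟩ hts)
    have h3 := intervalIntegral.integral_hasDerivAt_right
      ((hcont.mono hsub).intervalIntegrable)
      (hcont.stronglyMeasurableAtFilter isOpen_Ioo t hts)
      (hcont.continuousAt (isOpen_Ioo.mem_nhds hts))
    have h4 := h3.const_add y.1
    refine h4.congr_of_eventuallyEq ?_
    filter_upwards [isOpen_Ioo.mem_nhds hts] with s hs
    exact (hball _ (hmem s (abs_lt.2 hs) y hy)).1
  refine ⟨Φ, hΦ, ?_, ?_, ?_⟩
  · filter_upwards [Metric.ball_mem_nhds y₀ hr] with y hy using hzero y hy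
  · have h1 : Tendsto (fun p : ℝ × (M × ℝ) => (Φ p, p.2.2)) (𝓝 (0, y₀)) (𝓝 y₀) := by
      have := (hΦ.continuousAt.prodMk
        (by fun_prop : ContinuousAt (fun p : ℝ × (M × ℝ) => p.2.2) (0, y₀))).tendsto
      rwa [hzero y₀ (Metric.mem_ball_self hr)] at this
    filter_upwards [Metric.ball_mem_nhds ((0 : ℝ), y₀) hr, h1.eventually hWV] with p hp hp'
    rw [Metric.mem_ball, Prod.dist_eq, max_lt_iff] at hp
    rw [← hp']
    exact hderiv p.1 (by simpa using hp.1) p.2 hp.2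
  · obtain ⟨C, hC⟩ := hW.lipschitzWith_of_hasCompactSupport hWc (by simp)
    have h1 : Tendsto (fun q : ℝ × ℝ × (M × ℝ) => (Φ (q.1, q.2.2), q.2.2.2))
        (𝓝 (0, 0, y₀)) (𝓝 y₀) := by
      have h2 : ContinuousAt (fun q : ℝ × ℝ × (M × ℝ) => Φ (q.1, q.2.2)) (0, 0, y₀) :=
        ContinuousAt.comp (f := fun q : ℝ × ℝ × (M × ℝ) => (q.1, q.2.2)) hΦ.continuousAt
          (by fun_prop)
      have := (h2.prodMk
        (by fun_prop : ContinuousAt (fun q : ℝ × ℝ × (M × ℝ) => q.2.2.2) (0, 0, y₀))).tendsto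
      rwa [hzero y₀ (Metric.mem_ball_self hr)] at this
    filter_upwards [Metric.ball_mem_nhds ((0 : ℝ), (0 : ℝ), y₀) (half_pos hr),
      h1.eventually (Metric.ball_mem_nhds y₀ hr)] with q hq hq'
    obtain ⟨s, t, y⟩ := q
    simp only [Metric.mem_ball, Prod.dist_eq (β := ℝ × (M × ℝ)), Prod.dist_eq (β := M × ℝ),
      max_lt_iff, dist_zero_right, Real.norm_eq_abs] at hq
    obtain ⟨hs, ht, hy1⟩ := hq
    have hy : y ∈ Metric.ball y₀ r := by
      rw [Metric.mem_ball]; linarith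
    have hlip : ∀ u ∈ Set.Ioo (-(r / 2)) (r / 2),
        LipschitzOnWith C (fun m => W (m, y.2)) Set.univ := by
      intro u _
      rw [lipschitzOnWith_univ]
      have := hC.comp (LipschitzWith.prodMk_right (α := M) y.2)
      rwa [mul_one] at this
    have key := ODE_solution_unique_of_mem_Ioo (v := fun _ m => W (m, y.2)) (s := fun _ => Set.univ)
      (f := fun t => Φ (s + t, y)) (g := fun t => Φ (t, (Φ (s, y), y.2))) (t₀ := 0)
      hlip ⟨by linarith, by linarith⟩ ?_ ?_ ?_
    · exact key (abs_lt.1 ht)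
    · intro u hu
      refine ⟨?_, trivial⟩
      have hu' : |s + u| < r := by
        have := abs_add_le s u
        have := abs_lt.2 hu
        linarith
      exact (hderiv (s + u) hu' y hy).comp_const_add s u
    · intro u hu
      refine ⟨?_, trivial⟩
      have hu' : |u| < r := by
        have := abs_lt.2 hu
        linarith
      exact hderiv u hu' _ hq'
    · simp only [add_zero]
      exact (hzero _ hq').symm

end Flow

/-! ### Numerical differentiation -/

section FiniteDifference

/-- Taylor's formula in the last variable, with coefficients and remainder depending smoothly on the
parameter. -/
lemma SmoothNear.exists_taylor {P : Type*} [NormedAddCommGroup P] [NormedSpace ℝ P]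
    [FiniteDimensional ℝ P] {g : P × ℝ → ℝ} {p : P} (hg : SmoothNear g (p, 0)) (n : ℕ) :
    ∃ (b : ℕ → P → ℝ) (e : P × ℝ → ℝ), SmoothNear e (p, 0) ∧ ∀ᶠ y in 𝓝 (p, (0 : ℝ)),
      g y = ∑ i ∈ Finset.range n, y.2 ^ i * b i y.1 + y.2 ^ n * e y := by
  induction n with
  | zero => exact ⟨0, g, hg, by simp⟩
  | succ n ih =>
    obtain ⟨b, e, he, hge⟩ := ih
    obtain ⟨q, hq, heq⟩ := he.exists_eq_add_smul
    refine ⟨fun i => if i = n then fun x => e (x, 0) else b i, q, hq, ?_⟩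
    filter_upwards [hge, heq] with y h1 h2
    rw [h1, Finset.sum_range_succ]
    have : ∑ i ∈ Finset.range n, y.2 ^ i * (if i = n then fun x => e (x, 0) else b i) y.1
        = ∑ i ∈ Finset.range n, y.2 ^ i * b i y.1 :=
      Finset.sum_congr rfl fun i hi => by rw [if_neg (Finset.mem_range.1 hi).ne]
    rw [this, if_pos rfl, add_assoc]
    congr 1
    nth_rewrite 1 [h2]
    rw [smul_eq_mul]
    ring

/-- Weights of a finite difference formula with the nodes `1, …, n`. -/
lemma exists_interpolation_weights (n : ℕ) :
    ∃ c : Fin n → ℝ, ∀ i < n, ∑ j, c j * ((j : ℝ) + 1) ^ i = if i = 0 then 1 else 0 := by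
  let v : Fin n → ℝ := fun j => (j : ℝ) + 1
  have hdet : (Matrix.vandermonde v).det ≠ 0 := by
    rw [Matrix.det_vandermonde_ne_zero_iff]
    intro a b hab
    have : (a : ℝ) = b := by simpa [v] using hab
    exact Fin.ext (by exact_mod_cast this)
  let e : Fin n → ℝ := fun i => if (i : ℕ) = 0 then 1 else 0
  refine ⟨Matrix.vecMul e (Matrix.vandermonde v)⁻¹, fun i hi => ?_⟩
  have h1 : Matrix.vecMul (Matrix.vecMul e (Matrix.vandermonde v)⁻¹) (Matrix.vandermonde v) = e := by
    rw [Matrix.vecMul_vecMul, Matrix.nonsing_inv_mul _ (Ne.isUnit hdet), Matrix.vecMul_one]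
  have h2 := congrFun h1 ⟨i, hi⟩
  simpa [Matrix.vecMul, dotProduct, Matrix.vandermonde_apply, v, e] using h2

/-- If a smooth function `g(h, t)` is `O(hⁿ⁺¹)` at the times `t = j h`, `j ∈ ℕ`, then its derivative
at `t = 0` is `O(hⁿ)`. -/
lemma isBigO_deriv_of_forall_nat_mul {g : ℝ × ℝ → ℝ} (hg : SmoothNear g (0, 0)) (n : ℕ)
    (hO : ∀ j : ℕ, (fun h : ℝ => g (h, j * h)) =O[𝓝[>] 0] fun h => h ^ (n + 1)) :
    (fun h : ℝ => deriv (fun t => g (h, t)) 0) =O[𝓝[>] 0] fun h => h ^ n := by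
  obtain ⟨q, hq, hgq⟩ := hg.exists_eq_add_smul
  obtain ⟨b, e, he, hqe⟩ := hq.exists_taylor (n + 1)
  obtain ⟨c, hc⟩ := exists_interpolation_weights (n + 1)
  have hline : ∀ a : ℝ, Tendsto (fun h : ℝ => (h, a * h)) (𝓝[>] 0) (𝓝 (0, 0)) := fun a =>
    (Continuous.tendsto' (by fun_prop) _ _ (by simp)).mono_left nhdsWithin_le_nhds
  -- the derivative is the constant Taylor coefficient of the difference quotient
  have hderiv : ∀ᶠ h in 𝓝[>] (0 : ℝ), deriv (fun t => g (h, t)) 0 = b 0 h := by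
    have h0 : Tendsto (fun h : ℝ => (h, (0 : ℝ))) (𝓝[>] 0) (𝓝 (0, 0)) := by simpa using hline 0
    filter_upwards [h0.eventually hgq.eventually_nhds, h0.eventually hq.eventually,
      h0.eventually hqe] with h h1 h2 h3
    have hcurve : ContinuousAt (fun t : ℝ => (h, t)) 0 := by fun_prop
    have hd : HasDerivAt (fun t : ℝ => g (h, 0) + t * q (h, t)) (q (h, 0)) 0 := by
      have hq' : DifferentiableAt ℝ (fun t : ℝ => q (h, t)) 0 :=
        DifferentiableAt.comp (f := fun t : ℝ => (h, t)) 0 h2.differentiableAt (by fun_prop)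
      have := ((hasDerivAt_id (0 : ℝ)).mul hq'.hasDerivAt).const_add (g (h, 0))
      simpa using this
    have hcg : (fun t : ℝ => g (h, t)) =ᶠ[𝓝 0] fun t => g (h, 0) + t * q (h, t) :=
      hcurve.eventually h1
    rw [(hd.congr_of_eventuallyEq hcg).deriv, h3, Finset.sum_range_succ']
    simp
  -- the remainder of the finite difference formula
  have hrem : ∀ j : ℕ, (fun h : ℝ => ∑ i ∈ Finset.range (n + 1),
      ((j : ℝ) + 1) ^ (i + 1) * h ^ (i + 1) * b i h) =O[𝓝[>] 0] fun h => h ^ (n + 1) := by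
    intro j
    have h1 : (fun h : ℝ => g (h, ((j : ℝ) + 1) * h) - g (h, 0)) =O[𝓝[>] 0]
        fun h => h ^ (n + 1) := by
      have hj := hO (j + 1)
      have h0 := hO 0
      push_cast at hj h0
      simp only [zero_mul] at h0
      exact hj.sub h0
    have h2 : (fun h : ℝ => ((j : ℝ) + 1) ^ (n + 2) * h * e (h, ((j : ℝ) + 1) * h) * h ^ (n + 1))
        =O[𝓝[>] 0] fun h => h ^ (n + 1) := by
      have hb : (fun h : ℝ => ((j : ℝ) + 1) ^ (n + 2) * h * e (h, ((j : ℝ) + 1) * h))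
          =O[𝓝[>] 0] fun _ => (1 : ℝ) := by
        have ht : Tendsto (fun h : ℝ => ((j : ℝ) + 1) ^ (n + 2) * h * e (h, ((j : ℝ) + 1) * h))
            (𝓝[>] 0) (𝓝 (((j : ℝ) + 1) ^ (n + 2) * 0 * e (0, 0))) :=
          (tendsto_const_nhds.mul (tendsto_id.mono_left nhdsWithin_le_nhds)).mul
            (he.continuousAt.tendsto.comp (hline _))
        exact ht.isBigO_one ℝ
      simpa using hb.mul (isBigO_refl (fun h : ℝ => h ^ (n + 1)) (𝓝[>] 0))
    refine (h1.sub h2).congr' ?_ EventuallyEq.rfl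
    filter_upwards [(hline ((j : ℝ) + 1)).eventually hgq, (hline ((j : ℝ) + 1)).eventually hqe]
      with h k1 k2
    rw [k1, k2, add_sub_cancel_left, smul_eq_mul, mul_add, Finset.mul_sum]
    simp only [mul_pow]
    ring_nf
  have hsum : (fun h : ℝ => ∑ j : Fin (n + 1), c j / ((j : ℝ) + 1) * ∑ i ∈ Finset.range (n + 1),
      ((j : ℝ) + 1) ^ (i + 1) * h ^ (i + 1) * b i h) =O[𝓝[>] 0] fun h => h ^ (n + 1) :=
    IsBigO.fun_sum fun j _ => (hrem j).const_mul_left _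
  have hsum' : (fun h : ℝ => h * b 0 h) =O[𝓝[>] 0] fun h => h * h ^ n := by
    refine hsum.congr (fun h => ?_) fun h => by ring
    simp only [Finset.mul_sum]
    rw [Finset.sum_comm]
    have : ∀ i ∈ Finset.range (n + 1), ∑ j : Fin (n + 1), c j / ((j : ℝ) + 1) *
        (((j : ℝ) + 1) ^ (i + 1) * h ^ (i + 1) * b i h)
        = (if i = 0 then 1 else 0) * (h ^ (i + 1) * b i h) := by
      intro i hi
      rw [← hc i (Finset.mem_range.1 hi), Finset.sum_mul]
      refine Finset.sum_congr rfl fun j _ => ?_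
      have hj : (j : ℝ) + 1 ≠ 0 := by positivity
      field_simp
      ring
    rw [Finset.sum_congr rfl this]
    simp
  obtain ⟨C, hC⟩ := hsum'.bound
  refine IsBigO.of_bound C ?_
  filter_upwards [hC, hderiv, self_mem_nhdsWithin] with h h1 h2 h3
  have h3' : (0 : ℝ) < h := h3
  rw [h2]
  rw [norm_mul, norm_mul] at h1
  have h4 : ‖h‖ * ‖b 0 h‖ ≤ ‖h‖ * (C * ‖h ^ n‖) := by
    calc _ ≤ _ := h1
      _ = _ := by ring
  exact le_of_mul_le_mul_left h4 (norm_pos_iff.2 h3'.ne')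

end FiniteDifference

/-! ### Time differences and the derivative of a local flow -/

section LocalFlow

variable {M : Type*} [NormedAddCommGroup M] [NormedSpace ℝ M]
  {V : M × ℝ → M} {Φ : ℝ × (M × ℝ) → M} {y₀ : M × ℝ}

lemma IsLocalFlow.eventually (hΦ : IsLocalFlow V Φ y₀) : ∀ᶠ y in 𝓝 y₀, IsLocalFlow V Φ y := by
  have h1 : ContinuousAt (fun y : M × ℝ => ((0 : ℝ), y)) y₀ := by fun_prop
  have h2 : ContinuousAt (fun y : M × ℝ => ((0 : ℝ), (0 : ℝ), y)) y₀ := by fun_prop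
  filter_upwards [h1.eventually hΦ.smooth.eventually, hΦ.zero.eventually_nhds,
    h1.eventually hΦ.hasDerivAt.eventually_nhds, h2.eventually hΦ.add.eventually_nhds]
    with y k1 k2 k3 k4 using ⟨k1, k2, k3, k4⟩

lemma IsLocalFlow.tendsto (hΦ : IsLocalFlow V Φ y₀) {α : Type*} {l : Filter α} {t : α → ℝ}
    {y : α → M × ℝ} (ht : Tendsto t l (𝓝 0)) (hy : Tendsto y l (𝓝 y₀)) :
    Tendsto (fun a => (Φ (t a, y a), (y a).2)) l (𝓝 y₀) := by
  have h1 := hΦ.smooth.continuousAt.tendsto.comp (ht.prodMk_nhds hy)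
  rw [hΦ.zero.self_of_nhds] at h1
  exact h1.prodMk_nhds ((continuous_snd.tendsto y₀).comp hy)

/-- The derivative of the flow at time `t` in the initial point. -/
def flowDeriv (Φ : ℝ × (M × ℝ) → M) (t : ℝ) (y : M × ℝ) : M →L[ℝ] M :=
  (fderiv ℝ Φ (t, y)).comp
    ((ContinuousLinearMap.inr ℝ ℝ (M × ℝ)).comp (ContinuousLinearMap.inl ℝ M ℝ))

lemma hasFDerivAt_flowDeriv {t : ℝ} {y : M × ℝ} (h : DifferentiableAt ℝ Φ (t, y)) :
    HasFDerivAt (fun m => Φ (t, (m, y.2))) (flowDeriv Φ t y) y.1 := by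
  have h1 : HasFDerivAt (fun m : M => (t, (m, y.2)))
      ((ContinuousLinearMap.inr ℝ ℝ (M × ℝ)).comp (ContinuousLinearMap.inl ℝ M ℝ)) y.1 :=
    (hasFDerivAt_prodMk_right t y).comp y.1 (hasFDerivAt_prodMk_left y.1 y.2)
  exact h.hasFDerivAt.comp y.1 h1

lemma hasFDerivAt_slice {G : Type*} [NormedAddCommGroup G] [NormedSpace ℝ G] {g : M × ℝ → G}
    {y : M × ℝ} (h : DifferentiableAt ℝ g y) :
    HasFDerivAt (fun m => g (m, y.2)) ((fderiv ℝ g y).comp (ContinuousLinearMap.inl ℝ M ℝ)) y.1 :=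
  h.hasFDerivAt.comp y.1 (hasFDerivAt_prodMk_left y.1 y.2)

lemma eventually_slice {X : Type*} [TopologicalSpace X] {Q : X × ℝ → Prop} {y : X × ℝ}
    (h : ∀ᶠ y' in 𝓝 y, Q y') : ∀ᶠ m in 𝓝 y.1, Q (m, y.2) :=
  (by fun_prop : ContinuousAt (fun m : X => (m, y.2)) y.1).eventually h

lemma IsLocalFlow.flowDeriv_zero (hΦ : IsLocalFlow V Φ y₀) :
    ∀ᶠ y in 𝓝 y₀, flowDeriv Φ 0 y = ContinuousLinearMap.id ℝ M := by
  have h1 : ContinuousAt (fun y : M × ℝ => ((0 : ℝ), y)) y₀ := by fun_prop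
  filter_upwards [hΦ.zero.eventually_nhds, h1.eventually hΦ.smooth.eventually] with y k1 k2
  refine (hasFDerivAt_flowDeriv k2.differentiableAt).unique ?_
  exact (hasFDerivAt_id y.1).congr_of_eventuallyEq (eventually_slice k1)

lemma IsLocalFlow.flowDeriv_add (hΦ : IsLocalFlow V Φ y₀) :
    ∀ᶠ q in 𝓝 ((0 : ℝ), (0 : ℝ), y₀), flowDeriv Φ (q.1 + q.2.1) q.2.2
      = (flowDeriv Φ q.2.1 (Φ (q.1, q.2.2), q.2.2.2)).comp (flowDeriv Φ q.1 q.2.2) := by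
  have t1 : Tendsto (fun q : ℝ × ℝ × (M × ℝ) => (q.1 + q.2.1, q.2.2)) (𝓝 (0, 0, y₀))
      (𝓝 (0, y₀)) := Continuous.tendsto' (by fun_prop) _ _ (by simp)
  have t2 : Tendsto (fun q : ℝ × ℝ × (M × ℝ) => (q.1, q.2.2)) (𝓝 (0, 0, y₀))
      (𝓝 (0, y₀)) := Continuous.tendsto' (by fun_prop) _ _ rfl
  have t3 : Tendsto (fun q : ℝ × ℝ × (M × ℝ) => (q.2.1, (Φ (q.1, q.2.2), q.2.2.2)))
      (𝓝 (0, 0, y₀)) (𝓝 (0, y₀)) :=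
    (Continuous.tendsto' (by fun_prop) _ _ rfl).prodMk_nhds
      (hΦ.tendsto (Continuous.tendsto' (by fun_prop) _ _ rfl)
        (Continuous.tendsto' (by fun_prop) _ _ rfl))
  filter_upwards [hΦ.add.eventually_nhds, t1.eventually hΦ.smooth, t2.eventually hΦ.smooth,
    t3.eventually hΦ.smooth] with q k1 k2 k3 k4
  obtain ⟨s, t, m, h⟩ := q
  have d1 := hasFDerivAt_flowDeriv (k2.differentiableAt (by simp))
  have d2 := hasFDerivAt_flowDeriv (k3.differentiableAt (by simp))
  have d3 := hasFDerivAt_flowDeriv (k4.differentiableAt (by simp))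
  refine d1.unique ((HasFDerivAt.comp m d3 d2).congr_of_eventuallyEq ?_)
  exact (by fun_prop : ContinuousAt (fun m' : M => (s, t, (m', h))) m).eventually k1

/-- The flow is `Φ(t, y) = m + t Ψ(t, y)` with `Ψ` smooth and `Ψ(0, y) = V(y)`. -/
lemma IsLocalFlow.exists_quotient [FiniteDimensional ℝ M] (hΦ : IsLocalFlow V Φ y₀) :
    ∃ Ψ : (M × ℝ) × ℝ → M, SmoothNear Ψ (y₀, 0) ∧
      (∀ᶠ q in 𝓝 (y₀, (0 : ℝ)), Φ (q.2, q.1) = q.1.1 + q.2 • Ψ q) ∧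
      ∀ᶠ y in 𝓝 y₀, Ψ (y, 0) = V y := by
  have : CompleteSpace M := FiniteDimensional.complete ℝ M
  have hg : SmoothNear (fun q : (M × ℝ) × ℝ => Φ (q.2, q.1)) (y₀, 0) :=
    SmoothNear.comp (f := fun q : (M × ℝ) × ℝ => (q.2, q.1)) hΦ.smooth (by fun_prop)
  obtain ⟨Ψ, hΨ, hΨ'⟩ := hg.exists_eq_add_smul
  have t1 : Tendsto (fun q : (M × ℝ) × ℝ => q.1) (𝓝 (y₀, 0)) (𝓝 y₀) :=
    Continuous.tendsto' (by fun_prop) _ _ rfl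
  have hΨ2 : ∀ᶠ q in 𝓝 (y₀, (0 : ℝ)), Φ (q.2, q.1) = q.1.1 + q.2 • Ψ q := by
    filter_upwards [hΨ', t1.eventually hΦ.zero] with q k1 k2
    rw [k1, k2]
  refine ⟨Ψ, hΨ, hΨ2, ?_⟩
  have h1 : ContinuousAt (fun y : M × ℝ => ((0 : ℝ), y)) y₀ := by fun_prop
  have h2 : ContinuousAt (fun y : M × ℝ => (y, (0 : ℝ))) y₀ := by fun_prop
  filter_upwards [h1.eventually hΦ.hasDerivAt, h2.eventually hΨ2.eventually_nhds,
    h2.eventually hΨ.eventually, hΦ.zero] with y k1 k2 k3 k4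
  have d1 : DifferentiableAt ℝ (fun t : ℝ => Ψ (y, t)) 0 :=
    DifferentiableAt.comp (f := fun t : ℝ => (y, t)) 0 k3.differentiableAt (by fun_prop)
  have d2 := ((hasDerivAt_id (0 : ℝ)).smul d1.hasDerivAt).const_add y.1
  have d3 : (fun t : ℝ => Φ (t, y)) =ᶠ[𝓝 0] fun t => y.1 + t • Ψ (y, t) :=
    (by fun_prop : ContinuousAt (fun t : ℝ => (y, t)) 0).eventually k2
  have d4 := k1.unique (d2.congr_of_eventuallyEq d3)
  simp only [k4] at d4
  simpa using d4.symm

/-- Mixed derivative of a flow: the derivative `D_mΦ(t, y) ξ` starts with velocity `D_mV(y) ξ`. -/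
lemma IsLocalFlow.hasDerivAt_flowDeriv [FiniteDimensional ℝ M] (hΦ : IsLocalFlow V Φ y₀) :
    ∀ᶠ y in 𝓝 y₀, ∀ ξ : M,
      HasDerivAt (fun t => flowDeriv Φ t y ξ) (fderiv ℝ V y (ξ, 0)) 0 := by
  obtain ⟨Ψ, hΨ, hΨ1, hΨ2⟩ := hΦ.exists_quotient
  have h2 : ContinuousAt (fun y : M × ℝ => (y, (0 : ℝ))) y₀ := by fun_prop
  filter_upwards [h2.eventually hΨ1.eventually_nhds, h2.eventually hΨ.eventually,
    hΨ2.eventually_nhds, hΦ.eventually] with y k1 k2 k3 k4 ξ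
  -- the derivative of `Ψ` in direction `ξ`
  let D : ℝ → M := fun t => fderiv ℝ Ψ (y, t) ((ξ, 0), 0)
  have hD : SmoothNear D 0 := by
    have := k2.fderiv
    have h3 : SmoothNear (fun t : ℝ => fderiv ℝ Ψ (y, t)) 0 :=
      SmoothNear.comp (f := fun t : ℝ => (y, t)) this (by fun_prop)
    exact h3.clm_apply (SmoothNear.const _ _)
  have hD0 : D 0 = fderiv ℝ V y (ξ, 0) := by
    have e1 : HasFDerivAt (fun y' : M × ℝ => Ψ (y', (0 : ℝ)))
        ((fderiv ℝ Ψ (y, 0)).comp (ContinuousLinearMap.inl ℝ (M × ℝ) ℝ)) y :=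
      k2.differentiableAt.hasFDerivAt.comp y (hasFDerivAt_prodMk_left y (0 : ℝ))
    have e2 : HasFDerivAt V ((fderiv ℝ Ψ (y, 0)).comp (ContinuousLinearMap.inl ℝ (M × ℝ) ℝ)) y :=
      e1.congr_of_eventuallyEq (k3.mono fun _ h => h.symm)
    rw [e2.fderiv]
    rfl
  have hflow : (fun t => flowDeriv Φ t y ξ) =ᶠ[𝓝 0] fun t => ξ + t • D t := by
    have t1 : ContinuousAt (fun t : ℝ => (y, t)) 0 := by fun_prop
    have t2 : ContinuousAt (fun t : ℝ => (t, y)) 0 := by fun_prop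
    filter_upwards [t1.eventually k1.eventually_nhds, t1.eventually k2.eventually,
      t2.eventually k4.smooth.eventually] with t j1 j2 j3
    have e1 := hasFDerivAt_flowDeriv j3.differentiableAt
    have e2 : HasFDerivAt (fun m => Ψ ((m, y.2), t))
        ((fderiv ℝ Ψ (y, t)).comp ((ContinuousLinearMap.inl ℝ (M × ℝ) ℝ).comp
          (ContinuousLinearMap.inl ℝ M ℝ))) y.1 :=
      HasFDerivAt.comp (f := fun m => ((m, y.2), t)) y.1 j2.differentiableAt.hasFDerivAt
        (HasFDerivAt.comp (g := fun q => (q, t)) (f := fun m => (m, y.2)) y.1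
          (hasFDerivAt_prodMk_left y t) (hasFDerivAt_prodMk_left y.1 y.2))
    have e3 := (hasFDerivAt_id y.1).add (e2.const_smul t)
    have e4 := e1.unique (e3.congr_of_eventuallyEq
      ((by fun_prop : ContinuousAt (fun m : M => ((m, y.2), t)) y.1).eventually j1))
    rw [e4]
    simp [D]
  have e5 := ((hasDerivAt_id (0 : ℝ)).smul hD.differentiableAt.hasDerivAt).const_add ξ
  refine (e5.congr_of_eventuallyEq hflow).congr_deriv ?_
  simpa using hD0

end LocalFlow

/-! ### Maps that preserve a contact structure up to high order -/

section Contact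

variable {E : Type*} [NormedAddCommGroup E] [NormedSpace ℝ E]

/-- The contact form `dz - p dx` on `TQ × ℝ`. -/
def contactForm (p : E →L[ℝ] ℝ) : E × E × ℝ →L[ℝ] ℝ :=
  (ContinuousLinearMap.snd ℝ E ℝ).comp (ContinuousLinearMap.snd ℝ E (E × ℝ))
    - p.comp (ContinuousLinearMap.fst ℝ E (E × ℝ))

lemma contactForm_apply (p : E →L[ℝ] ℝ) (ξ : E × E × ℝ) : contactForm p ξ = ξ.2.2 - p ξ.1 := rfl

@[fun_prop]
lemma SmoothNear.contactForm {P : Type*} [NormedAddCommGroup P] [NormedSpace ℝ P]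
    {p : P → E →L[ℝ] ℝ} {y : P} (hp : SmoothNear p y) :
    SmoothNear (fun x => contactForm (p x)) y := by
  unfold Herglotz.contactForm
  fun_prop

/-- The pull back of the contact form with momentum `p(·, h)` under the time `t` flow. -/
def pullback (Φ : ℝ × ((E × E × ℝ) × ℝ) → E × E × ℝ) (p : (E × E × ℝ) × ℝ → E →L[ℝ] ℝ)
    (t : ℝ) (y : (E × E × ℝ) × ℝ) : E × E × ℝ →L[ℝ] ℝ :=
  (contactForm (p (Φ (t, y), y.2))).comp (flowDeriv Φ t y)

variable {V : (E × E × ℝ) × ℝ → E × E × ℝ} {Φ : ℝ × ((E × E × ℝ) × ℝ) → E × E × ℝ}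
  {y₀ : (E × E × ℝ) × ℝ} {p : (E × E × ℝ) × ℝ → E →L[ℝ] ℝ}

lemma IsLocalFlow.smoothNear_flowDeriv {P : Type*} [NormedAddCommGroup P] [NormedSpace ℝ P]
    (hΦ : IsLocalFlow V Φ y₀) {t : P → ℝ} {y : P → (E × E × ℝ) × ℝ} {a : P}
    (ht : SmoothNear t a) (hy : SmoothNear y a) (ht0 : t a = 0) (hy0 : y a = y₀) :
    SmoothNear (fun x => flowDeriv Φ (t x) (y x)) a := by
  have h1 : SmoothNear (fun x => fderiv ℝ Φ (t x, y x)) a := by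
    refine SmoothNear.comp (f := fun x => (t x, y x)) ?_ (by fun_prop)
    rw [ht0, hy0]
    exact hΦ.smooth.fderiv
  exact h1.clm_comp (SmoothNear.const _ _)

lemma IsLocalFlow.smoothNear_comp {P : Type*} [NormedAddCommGroup P] [NormedSpace ℝ P]
    (hΦ : IsLocalFlow V Φ y₀) {t : P → ℝ} {y : P → (E × E × ℝ) × ℝ} {a : P}
    (ht : SmoothNear t a) (hy : SmoothNear y a) (ht0 : t a = 0) (hy0 : y a = y₀) :
    SmoothNear (fun x => Φ (t x, y x)) a := by
  refine SmoothNear.comp (f := fun x => (t x, y x)) ?_ (by fun_prop)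
  rw [ht0, hy0]
  exact hΦ.smooth

lemma IsLocalFlow.smoothNear_pullback {P : Type*} [NormedAddCommGroup P] [NormedSpace ℝ P]
    (hΦ : IsLocalFlow V Φ y₀) (hp : SmoothNear p y₀)
    {t : P → ℝ} {y : P → (E × E × ℝ) × ℝ} {a : P}
    (ht : SmoothNear t a) (hy : SmoothNear y a) (ht0 : t a = 0) (hy0 : y a = y₀) :
    SmoothNear (fun x => pullback Φ p (t x) (y x)) a := by
  have h1 : SmoothNear (fun x => p (Φ (t x, y x), (y x).2)) a := by
    refine SmoothNear.comp (f := fun x => (Φ (t x, y x), (y x).2)) ?_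
      ((hΦ.smoothNear_comp ht hy ht0 hy0).prodMk hy.snd)
    rw [ht0, hy0, hΦ.zero.self_of_nhds]
    exact hp
  exact h1.contactForm.clm_comp (hΦ.smoothNear_flowDeriv ht hy ht0 hy0)

/-- If one step of the flow preserves the contact structure up to `O(hⁿ)`, so do `j` steps. -/
lemma IsLocalFlow.pullback_nat_mul (hΦ : IsLocalFlow V Φ y₀) (hy₀ : y₀.2 = 0)
    {μ : (E × E × ℝ) × ℝ → ℝ} (hμ : ContinuousAt μ y₀) {n : ℕ}
    (hB : (fun y => pullback Φ p y.2 y - μ y • contactForm (p y)) =O[𝓝 y₀] fun y => y.2 ^ n)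
    (j : ℕ) :
    ∃ s : (E × E × ℝ) × ℝ → ℝ,
      (fun y => pullback Φ p (j * y.2) y - s y • contactForm (p y)) =O[𝓝 y₀] fun y => y.2 ^ n := by
  induction j with
  | zero =>
    refine ⟨fun _ => 1, ?_⟩
    refine (isBigO_zero (E' := E × E × ℝ →L[ℝ] ℝ) _ (𝓝 y₀)).congr' ?_ EventuallyEq.rfl
    filter_upwards [hΦ.zero, hΦ.flowDeriv_zero] with y k1 k2
    ext ξ <;> simp [pullback, k1, k2]
  | succ j ih =>
    obtain ⟨s, hs⟩ := ih
    have tj : Tendsto (fun y : (E × E × ℝ) × ℝ => (j : ℝ) * y.2) (𝓝 y₀) (𝓝 0) :=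
      Continuous.tendsto' (by fun_prop) _ _ (by simp [hy₀])
    have ty := hΦ.tendsto tj tendsto_id
    have t3 : Tendsto (fun y : (E × E × ℝ) × ℝ => ((j : ℝ) * y.2, y.2, y)) (𝓝 y₀)
        (𝓝 (0, 0, y₀)) :=
      Continuous.tendsto' (by fun_prop) _ _ (by simp [hy₀])
    refine ⟨fun y => μ (Φ (j * y.2, y), y.2) * s y, ?_⟩
    have b1 : (fun y => μ (Φ (j * y.2, y), y.2)) =O[𝓝 y₀] fun _ => (1 : ℝ) :=
      (hμ.tendsto.comp ty).isBigO_one ℝ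
    have b2 : (fun y : (E × E × ℝ) × ℝ => flowDeriv Φ (j * y.2) y) =O[𝓝 y₀] fun _ => (1 : ℝ) := by
      have : SmoothNear (fun y : (E × E × ℝ) × ℝ => flowDeriv Φ (j * y.2) y) y₀ :=
        hΦ.smoothNear_flowDeriv (by fun_prop) (by fun_prop) (by simp [hy₀]) rfl
      exact this.continuousAt.tendsto.isBigO_one ℝ
    have b3 := hB.comp_tendsto ty
    have b4 : (fun y => (pullback Φ p y.2 (Φ (j * y.2, y), y.2)
        - μ (Φ (j * y.2, y), y.2) • contactForm (p (Φ (j * y.2, y), y.2))).comp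
          (flowDeriv Φ (j * y.2) y)) =O[𝓝 y₀] fun y => y.2 ^ n := by
      refine IsBigO.trans (IsBigO.of_norm_le fun y => ContinuousLinearMap.opNorm_comp_le _ _) ?_
      simpa using b3.norm_left.mul b2.norm_left
    have b5 := b1.smul hs
    simp only [one_smul] at b5
    refine (b4.add b5).congr' ?_ EventuallyEq.rfl
    filter_upwards [t3.eventually hΦ.add, t3.eventually hΦ.flowDeriv_add] with y k1 k2
    have e1 : ((j + 1 : ℕ) : ℝ) * y.2 = j * y.2 + y.2 := by push_cast; ring
    rw [e1]
    simp only [pullback, k1, k2, ContinuousLinearMap.sub_comp, ContinuousLinearMap.smul_comp,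
      ContinuousLinearMap.comp_assoc, smul_sub, mul_smul]
    abel

variable [FiniteDimensional ℝ E]

/-- If one step of the flow of `V(·, h)` preserves the kernel of `η = dz - p dx` up to `O(hⁿ⁺¹)`, then
the Lie derivative of `η` along `V` vanishes on this kernel up to `O(hⁿ)`. -/
lemma IsLocalFlow.lieDeriv_contactForm_isBigO {m₀ : E × E × ℝ} (hΦ : IsLocalFlow V Φ (m₀, 0))
    (hp : SmoothNear p (m₀, 0))
    {μ : (E × E × ℝ) × ℝ → ℝ} (hμ : ContinuousAt μ (m₀, 0)) {n : ℕ}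
    (hB : (fun y => pullback Φ p y.2 y - μ y • contactForm (p y)) =O[𝓝 (m₀, 0)]
      fun y => y.2 ^ (n + 1))
    {ξ : ℝ → E × E × ℝ} (hξ : SmoothNear ξ 0)
    (hker : ∀ᶠ h in 𝓝 0, contactForm (p (m₀, h)) (ξ h) = 0) :
    (fun h : ℝ => contactForm (p (m₀, h)) (fderiv ℝ V (m₀, h) (ξ h, 0))
      - fderiv ℝ p (m₀, h) (V (m₀, h), 0) (ξ h).1) =O[𝓝[>] 0] fun h => h ^ n := by
  let g : ℝ × ℝ → ℝ := fun r => pullback Φ p r.2 (m₀, r.1) (ξ r.1)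
  have hg : SmoothNear g (0, 0) := by
    have h1 : SmoothNear (fun r : ℝ × ℝ => pullback Φ p r.2 (m₀, r.1)) (0, 0) :=
      hΦ.smoothNear_pullback hp (by fun_prop) (by fun_prop) rfl rfl
    have h2 : SmoothNear (fun r : ℝ × ℝ => ξ r.1) (0, 0) :=
      SmoothNear.comp (f := fun r : ℝ × ℝ => r.1) hξ (by fun_prop)
    exact h1.clm_apply h2
  have hline : Tendsto (fun h : ℝ => (m₀, h)) (𝓝[>] 0) (𝓝 (m₀, 0)) :=
    (Continuous.tendsto' (by fun_prop) _ _ rfl).mono_left nhdsWithin_le_nhds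
  have hO : ∀ j : ℕ, (fun h : ℝ => g (h, j * h)) =O[𝓝[>] 0] fun h => h ^ (n + 1) := by
    intro j
    obtain ⟨s, hs⟩ := hΦ.pullback_nat_mul rfl hμ hB j
    have h1 := hs.comp_tendsto hline
    have h2 : ξ =O[𝓝[>] 0] fun _ => (1 : ℝ) :=
      (hξ.continuousAt.tendsto.mono_left nhdsWithin_le_nhds).isBigO_one ℝ
    have h3 : (fun h : ℝ => (pullback Φ p (j * h) (m₀, h) - s (m₀, h) • contactForm (p (m₀, h)))
        (ξ h)) =O[𝓝[>] 0] fun h => h ^ (n + 1) := by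
      refine IsBigO.trans (IsBigO.of_norm_le fun y => ContinuousLinearMap.le_opNorm _ _) ?_
      simpa using h1.norm_left.mul h2.norm_left
    refine h3.congr' ?_ EventuallyEq.rfl
    filter_upwards [nhdsWithin_le_nhds hker] with h hh
    have hh' : contactForm (p (m₀, h)) (ξ h) = 0 := hh
    simp [g, hh']
  refine (isBigO_deriv_of_forall_nat_mul hg n hO).congr' ?_ EventuallyEq.rfl
  have hz : ∀ᶠ y in 𝓝 (m₀, (0 : ℝ)), HasDerivAt (fun t => Φ (t, y)) (V y) 0 := by
    have h1 : ContinuousAt (fun y : (E × E × ℝ) × ℝ => ((0 : ℝ), y)) (m₀, 0) := by fun_prop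
    filter_upwards [h1.eventually hΦ.hasDerivAt, hΦ.zero] with y k1 k2
    simpa only [k2] using k1
  filter_upwards [hline.eventually hz, hline.eventually hΦ.hasDerivAt_flowDeriv,
    hline.eventually hp, hline.eventually hΦ.zero, hline.eventually hΦ.flowDeriv_zero]
    with h k1 k2 k3 k4 k5
  have k2 := k2 (ξ h)
  have d1 : HasDerivAt (fun t => (Φ (t, (m₀, h)), h)) (V (m₀, h), (0 : ℝ)) 0 :=
    k1.prodMk (hasDerivAt_const _ _)
  have d2 : HasDerivAt (fun t => p (Φ (t, (m₀, h)), h)) (fderiv ℝ p (m₀, h) (V (m₀, h), 0)) 0 := by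
    refine HasFDerivAt.comp_hasDerivAt (f := fun t => (Φ (t, (m₀, h)), h)) 0 ?_ d1
    simp only [k4]
    exact (k3.differentiableAt (by simp)).hasFDerivAt
  have d3 := (ContinuousLinearMap.fst ℝ E (E × ℝ)).hasFDerivAt.comp_hasDerivAt (0 : ℝ) k2
  have d4 := ((ContinuousLinearMap.snd ℝ E ℝ).comp
    (ContinuousLinearMap.snd ℝ E (E × ℝ))).hasFDerivAt.comp_hasDerivAt (0 : ℝ) k2
  have d5 := d4.sub (d2.clm_apply d3)
  have d6 : deriv (fun t => g (h, t)) 0 = _ := d5.deriv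
  rw [d6]
  simp only [k4, k5, contactForm_apply, Function.comp_apply, ContinuousLinearMap.comp_apply,
    ContinuousLinearMap.coe_fst', ContinuousLinearMap.coe_snd', ContinuousLinearMap.id_apply]
  ring

end Contact

/-! ### The discrete contact structure -/

section DiscreteContact

variable {E : Type*} [NormedAddCommGroup E] [NormedSpace ℝ E]

/-- `∂ℓ/∂x` for a discrete Lagrangian `ℓ(x, v, z, w; h)` expressed by difference quotients. -/
def quotX (l : (E × E × ℝ × ℝ) × ℝ → ℝ) (Q : (E × E × ℝ × ℝ) × ℝ) : E →L[ℝ] ℝ :=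
  (fderiv ℝ l Q).comp ((ContinuousLinearMap.inl ℝ (E × E × ℝ × ℝ) ℝ).comp
    (ContinuousLinearMap.inl ℝ E (E × ℝ × ℝ)))

/-- `∂ℓ/∂v` for a discrete Lagrangian `ℓ(x, v, z, w; h)` expressed by difference quotients. -/
def quotV (l : (E × E × ℝ × ℝ) × ℝ → ℝ) (Q : (E × E × ℝ × ℝ) × ℝ) : E →L[ℝ] ℝ :=
  (fderiv ℝ l Q).comp ((ContinuousLinearMap.inl ℝ (E × E × ℝ × ℝ) ℝ).comp
    ((ContinuousLinearMap.inr ℝ E (E × ℝ × ℝ)).comp (ContinuousLinearMap.inl ℝ E (ℝ × ℝ))))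

/-- `∂ℓ/∂z` for a discrete Lagrangian `ℓ(x, v, z, w; h)` expressed by difference quotients. -/
def quotZ (l : (E × E × ℝ × ℝ) × ℝ → ℝ) (Q : (E × E × ℝ × ℝ) × ℝ) : ℝ :=
  fderiv ℝ l Q ((0, 0, 1, 0), 0)

/-- `∂ℓ/∂w` for a discrete Lagrangian `ℓ(x, v, z, w; h)` expressed by difference quotients. -/
def quotW (l : (E × E × ℝ × ℝ) × ℝ → ℝ) (Q : (E × E × ℝ × ℝ) × ℝ) : ℝ :=
  fderiv ℝ l Q ((0, 0, 0, 1), 0)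

lemma fderiv_eq_quot (l : (E × E × ℝ × ℝ) × ℝ → ℝ) (Q : (E × E × ℝ × ℝ) × ℝ) (a b : E) (c d : ℝ) :
    fderiv ℝ l Q ((a, b, c, d), 0) = quotX l Q a + quotV l Q b + c * quotZ l Q + d * quotW l Q := by
  have h : (((a, b, c, d), 0) : (E × E × ℝ × ℝ) × ℝ) = ((a, 0, 0, 0), 0) + ((0, b, 0, 0), 0)
      + c • ((0, 0, 1, 0), 0) + d • ((0, 0, 0, 1), 0) := by simp
  rw [h, map_add, map_add, map_add, map_smul, map_smul]
  rfl

/-- The momentum `p₀` at the start of a step: for fixed `x₁` and `z₁`, the discrete evolution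
`z₁ = z₀ + h ℓ` persists to first order exactly in the directions with `dz₀ = p₀ dx₀`. -/
def momentumStart (l : (E × E × ℝ × ℝ) × ℝ → ℝ) (Q : (E × E × ℝ × ℝ) × ℝ) : E →L[ℝ] ℝ :=
  (1 - quotW l Q + Q.2 * quotZ l Q)⁻¹ • (quotV l Q - Q.2 • quotX l Q)

/-- The momentum `p₁` at the end of a step: for fixed `x₀` and `z₀`, the discrete evolution
`z₁ = z₀ + h ℓ` persists to first order exactly in the directions with `dz₁ = p₁ dx₁`. -/
def momentumEnd (l : (E × E × ℝ × ℝ) × ℝ → ℝ) (Q : (E × E × ℝ × ℝ) × ℝ) : E →L[ℝ] ℝ :=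
  (1 - quotW l Q)⁻¹ • quotV l Q

section Smooth

variable {l : (E × E × ℝ × ℝ) × ℝ → ℝ} {Q : (E × E × ℝ × ℝ) × ℝ}

lemma SmoothNear.quotX (hl : SmoothNear l Q) : SmoothNear (quotX l) Q := by
  unfold Herglotz.quotX
  fun_prop

lemma SmoothNear.quotV (hl : SmoothNear l Q) : SmoothNear (quotV l) Q := by
  unfold Herglotz.quotV
  fun_prop

lemma SmoothNear.quotZ (hl : SmoothNear l Q) : SmoothNear (quotZ l) Q := by
  unfold Herglotz.quotZ
  fun_prop

lemma SmoothNear.quotW (hl : SmoothNear l Q) : SmoothNear (quotW l) Q := by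
  unfold Herglotz.quotW
  fun_prop

lemma SmoothNear.momentumStart (hl : SmoothNear l Q)
    (h0 : 1 - Herglotz.quotW l Q + Q.2 * Herglotz.quotZ l Q ≠ 0) :
    SmoothNear (momentumStart l) Q := by
  have h1 := hl.quotX
  have h2 := hl.quotV
  have h3 := hl.quotZ
  have h4 := hl.quotW
  have h5 : SmoothNear (fun Q => 1 - Herglotz.quotW l Q + Q.2 * Herglotz.quotZ l Q) Q := by fun_prop
  exact (h5.inv h0).smul (by fun_prop)

lemma SmoothNear.momentumEnd (hl : SmoothNear l Q) (h0 : 1 - Herglotz.quotW l Q ≠ 0) :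
    SmoothNear (momentumEnd l) Q := by
  have h2 := hl.quotV
  have h4 := hl.quotW
  have h5 : SmoothNear (fun Q => 1 - Herglotz.quotW l Q) Q := by fun_prop
  exact (h5.inv h0).smul (by fun_prop)

end Smooth

/-- The arguments `(x₀, (x₁ - x₀) / h, z₀, (z₁ - z₀) / h; h)` of the discrete Lagrangian for one step
of size `h` from `m`, where `Ψ (y, t)` is the difference quotient of the flow at `y = (m, h)`. -/
def stepPoint (Ψ : ((E × E × ℝ) × ℝ) × ℝ → E × E × ℝ) (y : (E × E × ℝ) × ℝ) :
    (E × E × ℝ × ℝ) × ℝ :=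
  ((y.1.1, (Ψ (y, y.2)).1, y.1.2.2, (Ψ (y, y.2)).2.2), y.2)

lemma SmoothNear.stepPoint {Ψ : ((E × E × ℝ) × ℝ) × ℝ → E × E × ℝ} {m₀ : E × E × ℝ}
    (hΨ : SmoothNear Ψ ((m₀, 0), 0)) : SmoothNear (stepPoint Ψ) (m₀, 0) := by
  have h1 : SmoothNear (fun y : (E × E × ℝ) × ℝ => Ψ (y, y.2)) (m₀, 0) :=
    SmoothNear.comp (f := fun y : (E × E × ℝ) × ℝ => (y, y.2)) hΨ (by fun_prop)
  unfold Herglotz.stepPoint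
  fun_prop

variable {V : (E × E × ℝ) × ℝ → E × E × ℝ} {Φ : ℝ × ((E × E × ℝ) × ℝ) → E × E × ℝ}
  {Ψ : ((E × E × ℝ) × ℝ) × ℝ → E × E × ℝ} {m₀ : E × E × ℝ}
  {l : (E × E × ℝ × ℝ) × ℝ → ℝ}

lemma SmoothNear.isBigO_one {P G : Type*} [NormedAddCommGroup P] [NormedSpace ℝ P]
    [NormedAddCommGroup G] [NormedSpace ℝ G] {g : P → G} {p : P} (hg : SmoothNear g p) :
    g =O[𝓝 p] fun _ => (1 : ℝ) :=
  hg.continuousAt.tendsto.isBigO_one ℝ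

lemma SmoothNear.pow_smul_isBigO {P G : Type*} [NormedAddCommGroup P] [NormedSpace ℝ P]
    [NormedAddCommGroup G] [NormedSpace ℝ G] {e : P × ℝ → G} {p : P × ℝ} (he : SmoothNear e p)
    (n : ℕ) : (fun y => y.2 ^ n • e y) =O[𝓝 p] fun y => y.2 ^ n := by
  simpa using (isBigO_refl (fun y : P × ℝ => y.2 ^ n) (𝓝 p)).smul he.isBigO_one

variable [FiniteDimensional ℝ E]

/-- If along the flow the discrete evolution of the action and the matching of the discrete momenta
hold up to `O(hⁿ)`, then one step of the flow preserves the contact structure `dz - p dx`, with the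
momentum `p` at the start of the step, up to `O(hⁿ)`. -/
lemma IsLocalFlow.pullback_momentum_isBigO (hΦ : IsLocalFlow V Φ (m₀, 0))
    (hΨ : SmoothNear Ψ ((m₀, 0), 0))
    (hΦΨ : ∀ᶠ q in 𝓝 ((m₀, (0 : ℝ)), (0 : ℝ)), Φ (q.2, q.1) = q.1.1 + q.2 • Ψ q)
    (hl : SmoothNear l (stepPoint Ψ (m₀, 0))) (hw : quotW l (stepPoint Ψ (m₀, 0)) = 0) {n : ℕ}
    (hd : ∀ᶠ m in 𝓝 m₀, (fun h : ℝ => (Ψ ((m, h), h)).2.2 - l (stepPoint Ψ (m, h)))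
      =O[𝓝[>] 0] fun h => h ^ n)
    (hp : ∀ᶠ m in 𝓝 m₀, (fun h : ℝ => momentumEnd l (stepPoint Ψ (Φ (-h, (m, h)), h))
      - momentumStart l (stepPoint Ψ (m, h))) =O[𝓝[>] 0] fun h => h ^ n) :
    (fun y => pullback Φ (fun y => momentumStart l (stepPoint Ψ y)) y.2 y
      - ((1 - quotW l (stepPoint Ψ y))⁻¹ *
          (1 - quotW l (stepPoint Ψ y) + y.2 * quotZ l (stepPoint Ψ y)))
        • contactForm (momentumStart l (stepPoint Ψ y))) =O[𝓝 (m₀, 0)] fun y => y.2 ^ n := by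
  have hQ := hΨ.stepPoint
  have hQ2 : (stepPoint Ψ (m₀, 0)).2 = 0 := rfl
  have hW0 : 1 - quotW l (stepPoint Ψ (m₀, 0)) ≠ 0 := by simp [hw]
  have hS0 : 1 - quotW l (stepPoint Ψ (m₀, 0))
      + (stepPoint Ψ (m₀, 0)).2 * quotZ l (stepPoint Ψ (m₀, 0)) ≠ 0 := by simp [hw, hQ2]
  have hstart : SmoothNear (fun y => momentumStart l (stepPoint Ψ y)) (m₀, 0) :=
    SmoothNear.comp (f := stepPoint Ψ) (hl.momentumStart hS0) hQ
  have hend : SmoothNear (fun y => momentumEnd l (stepPoint Ψ y)) (m₀, 0) :=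
    SmoothNear.comp (f := stepPoint Ψ) (hl.momentumEnd hW0) hQ
  have hqW : SmoothNear (fun y => quotW l (stepPoint Ψ y)) (m₀, 0) :=
    SmoothNear.comp (f := stepPoint Ψ) hl.quotW hQ
  have hqZ : SmoothNear (fun y => quotZ l (stepPoint Ψ y)) (m₀, 0) :=
    SmoothNear.comp (f := stepPoint Ψ) hl.quotZ hQ
  have hlQ : SmoothNear (fun y => l (stepPoint Ψ y)) (m₀, 0) :=
    SmoothNear.comp (f := stepPoint Ψ) hl hQ
  have hstep : SmoothNear (fun y : (E × E × ℝ) × ℝ => Ψ (y, y.2)) (m₀, 0) :=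
    SmoothNear.comp (f := fun y : (E × E × ℝ) × ℝ => (y, y.2)) hΨ (by fun_prop)
  -- the two defects are divisible by `hⁿ`
  obtain ⟨e, he, hde⟩ := SmoothNear.exists_eq_pow_smul
    (g := fun y => (Ψ (y, y.2)).2.2 - l (stepPoint Ψ y)) (by fun_prop) n hd
  have hback : SmoothNear (fun y : (E × E × ℝ) × ℝ => (Φ (-y.2, y), y.2)) (m₀, 0) :=
    (hΦ.smoothNear_comp (t := fun y : (E × E × ℝ) × ℝ => -y.2) (y := fun y => y)
      (by fun_prop) (by fun_prop) (by simp) rfl).prodMk (by fun_prop)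
  have hback0 : (Φ (-(0 : ℝ), (m₀, 0)), (0 : ℝ)) = (m₀, 0) := by
    rw [neg_zero, hΦ.zero.self_of_nhds]
  obtain ⟨e', he', hpe⟩ := SmoothNear.exists_eq_pow_smul
    (g := fun y => momentumEnd l (stepPoint Ψ (Φ (-y.2, y), y.2))
      - momentumStart l (stepPoint Ψ y)) (by
        refine SmoothNear.sub ?_ hstart
        refine SmoothNear.comp (g := fun y => momentumEnd l (stepPoint Ψ y))
          (f := fun y : (E × E × ℝ) × ℝ => (Φ (-y.2, y), y.2)) ?_ hback
        simp only [hback0]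
        exact hend) n hp
  have hforw : Tendsto (fun y : (E × E × ℝ) × ℝ => (Φ (y.2, y), y.2)) (𝓝 (m₀, 0)) (𝓝 (m₀, 0)) :=
    hΦ.tendsto (Continuous.tendsto' (by fun_prop) _ _ rfl) tendsto_id
  have hmatch : (fun y => momentumEnd l (stepPoint Ψ y)
      - momentumStart l (stepPoint Ψ (Φ (y.2, y), y.2))) =O[𝓝 (m₀, 0)] fun y => y.2 ^ n := by
    have h1 := (he'.pow_smul_isBigO n).comp_tendsto hforw
    refine h1.congr' ?_ EventuallyEq.rfl
    have t3 : Tendsto (fun y : (E × E × ℝ) × ℝ => (y.2, -y.2, y)) (𝓝 (m₀, 0))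
        (𝓝 (0, 0, (m₀, 0))) := Continuous.tendsto' (by fun_prop) _ _ (by simp)
    filter_upwards [hforw.eventually hpe, t3.eventually hΦ.add, hΦ.zero] with y k1 k2 k3
    have k4 : Φ (-y.2, (Φ (y.2, y), y.2)) = y.1 := by
      rw [← k2, add_neg_cancel, k3]
    simp only [k4] at k1
    exact k1.symm
  have hT : SmoothNear (fun y : (E × E × ℝ) × ℝ => flowDeriv Φ y.2 y) (m₀, 0) :=
    hΦ.smoothNear_flowDeriv (by fun_prop) (by fun_prop) rfl rfl
  have hO1 : (fun y : (E × E × ℝ) × ℝ => (momentumEnd l (stepPoint Ψ y)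
      - momentumStart l (stepPoint Ψ (Φ (y.2, y), y.2))).comp
        ((ContinuousLinearMap.fst ℝ E (E × ℝ)).comp (flowDeriv Φ y.2 y)))
      =O[𝓝 (m₀, 0)] fun y => y.2 ^ n := by
    have h1 : SmoothNear (fun y : (E × E × ℝ) × ℝ =>
        (ContinuousLinearMap.fst ℝ E (E × ℝ)).comp (flowDeriv Φ y.2 y)) (m₀, 0) := by fun_prop
    refine IsBigO.trans (IsBigO.of_norm_le fun y => ContinuousLinearMap.opNorm_comp_le _ _) ?_
    simpa using hmatch.norm_left.mul h1.isBigO_one.norm_left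
  have hO2 : (fun y : (E × E × ℝ) × ℝ => y.2 ^ n • ((y.2 * (1 - quotW l (stepPoint Ψ y))⁻¹) •
      (fderiv ℝ e y).comp (ContinuousLinearMap.inl ℝ (E × E × ℝ) ℝ)))
      =O[𝓝 (m₀, 0)] fun y => y.2 ^ n := by
    have h1 : SmoothNear (fun y => (1 - quotW l (stepPoint Ψ y))⁻¹) (m₀, 0) :=
      SmoothNear.inv (by fun_prop) hW0
    have h2 : SmoothNear (fun y : (E × E × ℝ) × ℝ => (y.2 * (1 - quotW l (stepPoint Ψ y))⁻¹) •
      (fderiv ℝ e y).comp (ContinuousLinearMap.inl ℝ (E × E × ℝ) ℝ)) (m₀, 0) := by fun_prop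
    exact h2.pow_smul_isBigO n
  refine (hO1.add hO2).congr' ?_ EventuallyEq.rfl
  have t2 : Tendsto (fun y : (E × E × ℝ) × ℝ => (y, y.2)) (𝓝 (m₀, 0)) (𝓝 ((m₀, 0), 0)) :=
    Continuous.tendsto' (by fun_prop) _ _ rfl
  have t1 : Tendsto (fun y : (E × E × ℝ) × ℝ => (y.2, y)) (𝓝 (m₀, 0)) (𝓝 (0, (m₀, 0))) :=
    Continuous.tendsto' (by fun_prop) _ _ rfl
  filter_upwards [hde.eventually_nhds, he.eventually, hstep.eventually,
    t2.eventually hΦΨ.eventually_nhds, t1.eventually hΦ.smooth.eventually,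
    hQ.continuousAt.eventually hl.eventually,
    (by fun_prop : SmoothNear (fun y => 1 - quotW l (stepPoint Ψ y)) (m₀, 0)).continuousAt
      |>.eventually_ne hW0,
    (by fun_prop : SmoothNear (fun y => 1 - quotW l (stepPoint Ψ y)
      + y.2 * quotZ l (stepPoint Ψ y)) (m₀, 0)).continuousAt |>.eventually_ne hS0]
    with y k1 k2 k3 k4 k5 k6 k7 k8
  have dΨ := hasFDerivAt_slice k3.differentiableAt
  set S := (fderiv ℝ (fun y : (E × E × ℝ) × ℝ => Ψ (y, y.2)) y).comp
    (ContinuousLinearMap.inl ℝ (E × E × ℝ) ℝ) with hS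
  have hTS : flowDeriv Φ y.2 y = ContinuousLinearMap.id ℝ (E × E × ℝ) + y.2 • S := by
    refine (hasFDerivAt_flowDeriv k5.differentiableAt).unique ?_
    refine ((hasFDerivAt_id y.1).add (dΨ.const_smul y.2)).congr_of_eventuallyEq ?_
    exact (by fun_prop : ContinuousAt (fun m : E × E × ℝ => ((m, y.2), y.2)) y.1).eventually k4
  -- derivative of the equation `ŵ = ℓ(x, v̂, z, ŵ; h) + hⁿ e` in the direction `ξ`
  have hlin : ∀ ξ : E × E × ℝ, (S ξ).2.2 = fderiv ℝ l (stepPoint Ψ y)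
      ((ξ.1, (S ξ).1, ξ.2.2, (S ξ).2.2), 0) + y.2 ^ n * fderiv ℝ e y (ξ, 0) := by
    intro ξ
    have dx : HasFDerivAt (fun m : E × E × ℝ => m.1) (ContinuousLinearMap.fst ℝ E (E × ℝ)) y.1 :=
      hasFDerivAt_fst
    have dz : HasFDerivAt (fun m : E × E × ℝ => m.2.2)
        ((ContinuousLinearMap.snd ℝ E ℝ).comp (ContinuousLinearMap.snd ℝ E (E × ℝ))) y.1 :=
      ((ContinuousLinearMap.snd ℝ E ℝ).comp (ContinuousLinearMap.snd ℝ E (E × ℝ))).hasFDerivAt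
    have dQ := (dx.prodMk (dΨ.fst.prodMk (dz.prodMk dΨ.snd.snd))).prodMk
      (hasFDerivAt_const y.2 y.1)
    have dl : HasFDerivAt (fun m => l (stepPoint Ψ (m, y.2))) _ y.1 :=
      HasFDerivAt.comp y.1 (f := fun m => stepPoint Ψ (m, y.2)) k6.differentiableAt.hasFDerivAt dQ
    have de := (hasFDerivAt_slice k2.differentiableAt).const_smul (y.2 ^ n)
    have d1 := dΨ.snd.snd.sub dl
    have d2 := congrArg (fun A : E × E × ℝ →L[ℝ] ℝ => A ξ)
      (d1.unique (de.congr_of_eventuallyEq (eventually_slice k1)))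
    have d3 : (S ξ).2.2 - fderiv ℝ l (stepPoint Ψ y) ((ξ.1, (S ξ).1, ξ.2.2, (S ξ).2.2), 0)
        = y.2 ^ n * fderiv ℝ e y (ξ, 0) := d2
    linarith
  refine ContinuousLinearMap.ext fun ξ => ?_
  have h1 := hlin ξ
  rw [fderiv_eq_quot] at h1
  have h2 : flowDeriv Φ y.2 y ξ = ξ + y.2 • S ξ := by rw [hTS]; rfl
  simp only [pullback, sub_apply, smul_apply,
    add_apply, ContinuousLinearMap.comp_apply, contactForm_apply, h2,
    ContinuousLinearMap.inl_apply, smul_eq_mul, ContinuousLinearMap.coe_fst', map_add, map_smul]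
  have hend' : ∀ ζ, momentumEnd l (stepPoint Ψ y) ζ
      = (1 - quotW l (stepPoint Ψ y))⁻¹ * quotV l (stepPoint Ψ y) ζ := fun ζ => rfl
  have hstart' : ∀ ζ, momentumStart l (stepPoint Ψ y) ζ
      = (1 - quotW l (stepPoint Ψ y) + y.2 * quotZ l (stepPoint Ψ y))⁻¹ *
        (quotV l (stepPoint Ψ y) ζ - y.2 * quotX l (stepPoint Ψ y) ζ) := fun ζ => rfl
  rw [hend', hend', hstart']
  generalize quotW l (stepPoint Ψ y) = W at *
  generalize quotZ l (stepPoint Ψ y) = Z at *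
  generalize quotV l (stepPoint Ψ y) = A at *
  generalize quotX l (stepPoint Ψ y) = X at *
  generalize momentumStart l (stepPoint Ψ (Φ (y.2, y), y.2)) = p' at *
  generalize (fderiv ℝ e y) (ξ, 0) = e1 at *
  field_simp
  linear_combination (-y.2) * h1

end DiscreteContact

/-! ### The Euler-Lagrange residual -/

section Residual

variable {E : Type*} [NormedAddCommGroup E] [NormedSpace ℝ E]

/-- The inclusion of the directions of `x` into those of `(x, ẋ, z; h)`. -/
def dirX (E : Type*) [NormedAddCommGroup E] [NormedSpace ℝ E] : E →L[ℝ] (E × E × ℝ) × ℝ :=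
  (ContinuousLinearMap.inl ℝ (E × E × ℝ) ℝ).comp (ContinuousLinearMap.inl ℝ E (E × ℝ))

/-- The inclusion of the directions of `ẋ` into those of `(x, ẋ, z; h)`. -/
def dirV (E : Type*) [NormedAddCommGroup E] [NormedSpace ℝ E] : E →L[ℝ] (E × E × ℝ) × ℝ :=
  (ContinuousLinearMap.inl ℝ (E × E × ℝ) ℝ).comp
    ((ContinuousLinearMap.inr ℝ E (E × ℝ)).comp (ContinuousLinearMap.inl ℝ E ℝ))

lemma dirX_apply (a : E) : dirX E a = ((a, 0, 0), 0) := rfl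

lemma dirV_apply (a : E) : dirV E a = ((0, a, 0), 0) := rfl

/-- The conjugate momentum `∂Λ/∂ẋ` of a Lagrangian `Λ(x, ẋ, z; h)`. -/
def momentum (Λ : (E × E × ℝ) × ℝ → ℝ) (y : (E × E × ℝ) × ℝ) : E →L[ℝ] ℝ :=
  (fderiv ℝ Λ y).comp (dirV E)

/-- The left hand side of the generalized Euler-Lagrange equations of `Λ(·; h)`, with the total time
derivative taken along the vector field `V(·; h)`. -/
def residual (Λ : (E × E × ℝ) × ℝ → ℝ) (V : (E × E × ℝ) × ℝ → E × E × ℝ) (y : (E × E × ℝ) × ℝ) :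
    E →L[ℝ] ℝ :=
  (fderiv ℝ Λ y).comp (dirX E) - fderiv ℝ (momentum Λ) y (V y, 0)
    + fderiv ℝ Λ y ((0, 0, 1), 0) • momentum Λ y

lemma SmoothNear.momentum {Λ : (E × E × ℝ) × ℝ → ℝ} {y : (E × E × ℝ) × ℝ} (hΛ : SmoothNear Λ y) :
    SmoothNear (momentum Λ) y := by
  unfold Herglotz.momentum
  fun_prop

lemma SmoothNear.residual {Λ : (E × E × ℝ) × ℝ → ℝ} {V : (E × E × ℝ) × ℝ → E × E × ℝ}
    {y : (E × E × ℝ) × ℝ} (hΛ : SmoothNear Λ y) (hV : SmoothNear V y) :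
    SmoothNear (residual Λ V) y := by
  have h := hΛ.momentum
  unfold Herglotz.residual
  fun_prop

variable {φ : (E × E × ℝ) × ℝ → E} {Λ : (E × E × ℝ) × ℝ → ℝ}
  {Φ : ℝ × ((E × E × ℝ) × ℝ) → E × E × ℝ} {p : (E × E × ℝ) × ℝ → E →L[ℝ] ℝ} {m₀ : E × E × ℝ}

/-- The second order vector field `ẋ = v`, `v̇ = φ`, `ż = Λ`. -/
def secondOrderField (φ : (E × E × ℝ) × ℝ → E) (Λ : (E × E × ℝ) × ℝ → ℝ) (y : (E × E × ℝ) × ℝ) :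
    E × E × ℝ := (y.1.2.1, φ y, Λ y)

@[fun_prop]
lemma SmoothNear.secondOrderField {y : (E × E × ℝ) × ℝ} (hφ : SmoothNear φ y)
    (hΛ : SmoothNear Λ y) : SmoothNear (secondOrderField φ Λ) y := by
  unfold Herglotz.secondOrderField
  fun_prop

lemma fderiv_secondOrderField {y : (E × E × ℝ) × ℝ} (hφ : SmoothNear φ y) (hΛ : SmoothNear Λ y)
    (ξ : (E × E × ℝ) × ℝ) :
    fderiv ℝ (secondOrderField φ Λ) y ξ = (ξ.1.2.1, fderiv ℝ φ y ξ, fderiv ℝ Λ y ξ) := by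
  have h1 : HasFDerivAt (fun y : (E × E × ℝ) × ℝ => y.1.2.1)
      ((ContinuousLinearMap.fst ℝ E ℝ).comp ((ContinuousLinearMap.snd ℝ E (E × ℝ)).comp
        (ContinuousLinearMap.fst ℝ (E × E × ℝ) ℝ))) y :=
    ((ContinuousLinearMap.fst ℝ E ℝ).comp ((ContinuousLinearMap.snd ℝ E (E × ℝ)).comp
        (ContinuousLinearMap.fst ℝ (E × E × ℝ) ℝ))).hasFDerivAt
  have h2 : HasFDerivAt (secondOrderField φ Λ) _ y :=
    h1.prodMk (hφ.differentiableAt.hasFDerivAt.prodMk hΛ.differentiableAt.hasFDerivAt)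
  rw [h2.fderiv]
  rfl

variable [FiniteDimensional ℝ E]

/-- In finite dimension the size of a covector is controlled by its values on each vector. -/
lemma isBigO_clm_of_apply {α : Type*} {l : Filter α} {A : α → E →L[ℝ] ℝ} {g : α → ℝ}
    (h : ∀ ξ : E, (fun a => A a ξ) =O[l] g) : A =O[l] g := by
  let b := Module.finBasis ℝ E
  obtain ⟨C, hC, hC'⟩ := b.exists_opNorm_le (F := ℝ)
  have h1 : (fun a => ∑ i, ‖A a (b i)‖) =O[l] g := IsBigO.fun_sum fun i _ => (h (b i)).norm_left
  refine IsBigO.trans (IsBigO.of_bound C (Eventually.of_forall fun a => ?_)) h1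
  have h2 : 0 ≤ ∑ i, ‖A a (b i)‖ := Finset.sum_nonneg fun i _ => norm_nonneg _
  rw [Real.norm_of_nonneg h2]
  exact hC' h2 fun i => Finset.single_le_sum (f := fun i => ‖A a (b i)‖)
    (fun i _ => norm_nonneg _) (Finset.mem_univ i)

/-- A second order field whose flow preserves the contact structure `dz - p dx` up to high order has
the momentum `p = ∂Λ/∂ẋ` up to high order. -/
lemma IsLocalFlow.momentum_isBigO (hΦ : IsLocalFlow (secondOrderField φ Λ) Φ (m₀, 0))
    (hφ : SmoothNear φ (m₀, 0)) (hΛ : SmoothNear Λ (m₀, 0)) (hp : SmoothNear p (m₀, 0))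
    {μ : (E × E × ℝ) × ℝ → ℝ} (hμ : ContinuousAt μ (m₀, 0)) {n : ℕ}
    (hB : (fun y => pullback Φ p y.2 y - μ y • contactForm (p y)) =O[𝓝 (m₀, 0)]
      fun y => y.2 ^ (n + 1)) :
    (fun h : ℝ => momentum Λ (m₀, h) - p (m₀, h)) =O[𝓝[>] 0] fun h => h ^ n := by
  have hline : Tendsto (fun h : ℝ => (m₀, h)) (𝓝[>] 0) (𝓝 (m₀, 0)) :=
    (Continuous.tendsto' (by fun_prop) _ _ rfl).mono_left nhdsWithin_le_nhds
  refine isBigO_clm_of_apply fun a => ?_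
  have h1 := hΦ.lieDeriv_contactForm_isBigO hp hμ hB
    (ξ := fun _ => (0, a, 0)) (SmoothNear.const _ _)
    (Eventually.of_forall fun h => by simp [contactForm_apply])
  refine h1.congr' ?_ EventuallyEq.rfl
  filter_upwards [hline.eventually hφ.eventually, hline.eventually hΛ.eventually] with h k1 k2
  rw [fderiv_secondOrderField k1 k2, contactForm_apply]
  simp [momentum, dirV_apply]

/-- A second order field whose flow preserves a contact structure `dz - p dx` up to high order
satisfies the generalized Euler-Lagrange equations of `Λ = ż` up to high order. -/
lemma IsLocalFlow.residual_isBigO (hΦ : IsLocalFlow (secondOrderField φ Λ) Φ (m₀, 0))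
    (hφ : SmoothNear φ (m₀, 0)) (hΛ : SmoothNear Λ (m₀, 0)) (hp : SmoothNear p (m₀, 0))
    {μ : (E × E × ℝ) × ℝ → ℝ} (hμ : SmoothNear μ (m₀, 0)) {n : ℕ}
    (hB : ∀ᶠ m in 𝓝 m₀, (fun y => pullback Φ p y.2 y - μ y • contactForm (p y)) =O[𝓝 (m, 0)]
      fun y => y.2 ^ (n + 1)) :
    (fun h : ℝ => residual Λ (secondOrderField φ Λ) (m₀, h)) =O[𝓝[>] 0] fun h => h ^ n := by
  have hline : Tendsto (fun h : ℝ => (m₀, h)) (𝓝[>] 0) (𝓝 (m₀, 0)) :=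
    (Continuous.tendsto' (by fun_prop) _ _ rfl).mono_left nhdsWithin_le_nhds
  have hm : ContinuousAt (fun m : E × E × ℝ => (m, (0 : ℝ))) m₀ := by fun_prop
  have hmom := hΛ.momentum
  -- the momentum defect is divisible by `hⁿ`, hence so are its derivatives
  obtain ⟨e, he, hpe⟩ := SmoothNear.exists_eq_pow_smul
    (g := fun y => momentum Λ y - p y) (by fun_prop) n (by
      filter_upwards [hm.eventually hΦ.eventually, hm.eventually hφ.eventually,
        hm.eventually hΛ.eventually, hm.eventually hp.eventually, hm.eventually hμ.eventually, hB]
        with m k1 k2 k3 k4 k5 k6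
      exact k1.momentum_isBigO k2 k3 k4 k5.continuousAt k6)
  have hV : SmoothNear (secondOrderField φ Λ) (m₀, 0) := hφ.secondOrderField hΛ
  refine isBigO_clm_of_apply fun a => ?_
  have hpl : SmoothNear (fun h : ℝ => p (m₀, h)) 0 :=
    SmoothNear.comp (f := fun h : ℝ => (m₀, h)) hp (by fun_prop)
  have h1 := hΦ.lieDeriv_contactForm_isBigO hp hμ.continuousAt hB.self_of_nhds
    (ξ := fun h => (a, 0, p (m₀, h) a)) (by fun_prop)
    (Eventually.of_forall fun h => by simp [contactForm_apply])
  have h2 : (fun y : (E × E × ℝ) × ℝ => y.2 ^ n • (fderiv ℝ Λ y ((0, 0, 1), 0) * e y a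
      - fderiv ℝ e y (secondOrderField φ Λ y, 0) a)) =O[𝓝 (m₀, 0)] fun y => y.2 ^ n := by
    refine SmoothNear.pow_smul_isBigO (p := (m₀, (0 : ℝ))) (e := fun y : (E × E × ℝ) × ℝ =>
      fderiv ℝ Λ y ((0, 0, 1), 0) * e y a - fderiv ℝ e y (secondOrderField φ Λ y, 0) a) ?_ n
    have h3 : SmoothNear (fun y => secondOrderField φ Λ y) (m₀, 0) := hV
    fun_prop
  refine (h1.add (h2.comp_tendsto hline)).congr' ?_ EventuallyEq.rfl
  filter_upwards [hline.eventually hφ.eventually, hline.eventually hΛ.eventually,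
    hline.eventually hp.eventually, hline.eventually he.eventually,
    hline.eventually hpe.eventually_nhds] with h k1 k2 k3 k4 k5
  have d1 : momentum Λ (m₀, h) a = p (m₀, h) a + h ^ n * e (m₀, h) a := by
    have := congrArg (fun A : E →L[ℝ] ℝ => A a) k5.self_of_nhds
    simp only [sub_apply, smul_apply, smul_eq_mul] at this
    linarith
  have d2 : fderiv ℝ (momentum Λ) (m₀, h) (secondOrderField φ Λ (m₀, h), 0) a
      = fderiv ℝ p (m₀, h) (secondOrderField φ Λ (m₀, h), 0) a
        + h ^ n * fderiv ℝ e (m₀, h) (secondOrderField φ Λ (m₀, h), 0) a := by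
    have e1 := hasFDerivAt_slice (y := (m₀, h)) k2.momentum.differentiableAt
    have e2 := hasFDerivAt_slice (y := (m₀, h)) k3.differentiableAt
    have e3 := (hasFDerivAt_slice (y := (m₀, h)) k4.differentiableAt).const_smul (h ^ n)
    have e4 := e3.unique ((e1.sub e2).congr_of_eventuallyEq
      ((eventually_slice k5).mono fun _ hx => hx.symm))
    have e5 := congrArg (fun A : E × E × ℝ →L[ℝ] E →L[ℝ] ℝ =>
      A (secondOrderField φ Λ (m₀, h)) a) e4
    simp only [sub_apply, smul_apply, ContinuousLinearMap.comp_apply,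
      ContinuousLinearMap.inl_apply, smul_eq_mul] at e5
    linarith
  have d3 : fderiv ℝ Λ (m₀, h) ((a, 0, p (m₀, h) a), 0) = fderiv ℝ Λ (m₀, h) ((a, 0, 0), 0)
      + p (m₀, h) a * fderiv ℝ Λ (m₀, h) ((0, 0, 1), 0) := by
    rw [← smul_eq_mul, ← map_smul, ← map_add]
    simp
  rw [fderiv_secondOrderField k1 k2, contactForm_apply]
  simp only [residual, Function.comp_apply, d3, sub_apply, add_apply, smul_apply, smul_eq_mul, d1,
    d2, ContinuousLinearMap.comp_apply, dirX_apply, map_zero]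
  ring

/-- If along the flow of a second order field the discrete evolution of the action and the matching
of the discrete momenta hold up to `O(hⁿ⁺¹)`, then the Euler-Lagrange residual is `O(hⁿ)`. -/
lemma IsLocalFlow.residual_isBigO_of_defect {Ψ : ((E × E × ℝ) × ℝ) × ℝ → E × E × ℝ}
    {l : (E × E × ℝ × ℝ) × ℝ → ℝ}
    (hΦ : IsLocalFlow (secondOrderField φ Λ) Φ (m₀, 0))
    (hφ : SmoothNear φ (m₀, 0)) (hΛ : SmoothNear Λ (m₀, 0)) (hΨ : SmoothNear Ψ ((m₀, 0), 0))
    (hΦΨ : ∀ᶠ q in 𝓝 ((m₀, (0 : ℝ)), (0 : ℝ)), Φ (q.2, q.1) = q.1.1 + q.2 • Ψ q)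
    (hl : SmoothNear l (stepPoint Ψ (m₀, 0)))
    (hw : ∀ᶠ m in 𝓝 m₀, quotW l (stepPoint Ψ (m, 0)) = 0) {n : ℕ}
    (hd : ∀ᶠ m in 𝓝 m₀, (fun h : ℝ => (Ψ ((m, h), h)).2.2 - l (stepPoint Ψ (m, h)))
      =O[𝓝[>] 0] fun h => h ^ (n + 1))
    (hp : ∀ᶠ m in 𝓝 m₀, (fun h : ℝ => momentumEnd l (stepPoint Ψ (Φ (-h, (m, h)), h))
      - momentumStart l (stepPoint Ψ (m, h))) =O[𝓝[>] 0] fun h => h ^ (n + 1)) :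
    (fun h : ℝ => residual Λ (secondOrderField φ Λ) (m₀, h)) =O[𝓝[>] 0] fun h => h ^ n := by
  have hQ := hΨ.stepPoint
  have hQ2 : (stepPoint Ψ (m₀, 0)).2 = 0 := rfl
  have hw0 := hw.self_of_nhds
  have hqW : SmoothNear (fun y => quotW l (stepPoint Ψ y)) (m₀, 0) :=
    SmoothNear.comp (f := stepPoint Ψ) hl.quotW hQ
  have hqZ : SmoothNear (fun y => quotZ l (stepPoint Ψ y)) (m₀, 0) :=
    SmoothNear.comp (f := stepPoint Ψ) hl.quotZ hQ
  have hinv : SmoothNear (fun y => (1 - quotW l (stepPoint Ψ y))⁻¹) (m₀, 0) :=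
    SmoothNear.inv (by fun_prop) (by simp [hw0])
  have hstart : SmoothNear (fun y => momentumStart l (stepPoint Ψ y)) (m₀, 0) :=
    SmoothNear.comp (f := stepPoint Ψ) (hl.momentumStart (by simp [hw0, hQ2])) hQ
  refine hΦ.residual_isBigO hφ hΛ hstart
    (μ := fun y => (1 - quotW l (stepPoint Ψ y))⁻¹ *
      (1 - quotW l (stepPoint Ψ y) + y.2 * quotZ l (stepPoint Ψ y))) (by fun_prop) ?_
  have hm : ContinuousAt (fun m : E × E × ℝ => (m, (0 : ℝ))) m₀ := by fun_prop
  have hm' : ContinuousAt (fun m : E × E × ℝ => ((m, (0 : ℝ)), (0 : ℝ))) m₀ := by fun_prop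
  have hQm : ContinuousAt (fun m : E × E × ℝ => stepPoint Ψ (m, 0)) m₀ :=
    ContinuousAt.comp (f := fun m : E × E × ℝ => (m, (0 : ℝ))) hQ.continuousAt hm
  filter_upwards [hm.eventually hΦ.eventually, hm'.eventually hΨ.eventually,
    hm'.eventually hΦΨ.eventually_nhds, hQm.eventually hl.eventually, hw,
    hd.eventually_nhds, hp.eventually_nhds] with m k1 k2 k3 k4 k5 k6 k7
  exact k1.pullback_momentum_isBigO k2 k3 k4 k5 k6 k7

end Residual

/-! ### The discrete Lagrangian in difference quotients -/

section QuotientForm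

variable {E : Type*} [NormedAddCommGroup E] [NormedSpace ℝ E]

/-- The difference quotients `(x₀, (x₁ - x₀) / h, z₀, (z₁ - z₀) / h; h)` of one step. -/
def quotientPoint (x₀ x₁ : E) (z₀ z₁ h : ℝ) : (E × E × ℝ × ℝ) × ℝ :=
  ((x₀, h⁻¹ • (x₁ - x₀), z₀, h⁻¹ * (z₁ - z₀)), h)

/-- `l` is a smooth extension to `h = 0` of the discrete Lagrangian `L` written in difference
quotients, and it restricts to `Lag` at `h = 0`. -/
structure IsQuotientForm (U : Set E) (Lag : E × E × ℝ → ℝ) (L : E → E → ℝ → ℝ → ℝ → ℝ)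
    (W : Set ((E × E × ℝ × ℝ) × ℝ)) (l : (E × E × ℝ × ℝ) × ℝ → ℝ) : Prop where
  isOpen : IsOpen W
  mem : ∀ x ∈ U, ∀ v z w, ((x, v, z, w), (0 : ℝ)) ∈ W
  smooth : ContDiffOn ℝ ∞ l W
  eq : ∀ x₀ x₁ z₀ z₁ h, 0 < h → quotientPoint x₀ x₁ z₀ z₁ h ∈ W →
    L x₀ x₁ z₀ z₁ h = l (quotientPoint x₀ x₁ z₀ z₁ h)
  zero : ∀ x ∈ U, ∀ v z w, l ((x, v, z, w), 0) = Lag (x, v, z)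

variable {U : Set E} {Lag : E × E × ℝ → ℝ} {L : E → E → ℝ → ℝ → ℝ → ℝ}
  {W : Set ((E × E × ℝ × ℝ) × ℝ)} {l : (E × E × ℝ × ℝ) × ℝ → ℝ}

lemma IsConsistentDiscretization.exists_isQuotientForm (hL : IsConsistentDiscretization U Lag L) :
    ∃ W l, IsQuotientForm U Lag L W l := by
  obtain ⟨W, l, hW, hmem, hl, heq⟩ := hL.smooth
  refine ⟨W, l, hW, fun x hx v z w => hmem (x, v, z, w) hx, hl, ?_, ?_⟩
  · intro x₀ x₁ z₀ z₁ h hh hQ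
    have := heq _ hQ hh
    simp only [quotientPoint] at this ⊢
    rw [← this, smul_inv_smul₀ hh.ne', mul_inv_cancel_left₀ hh.ne', add_sub_cancel,
      add_sub_cancel]
  · intro x hx v z w
    have h1 := hL.consistent (fun t => x + t • v) (fun t => z + t * w) (by fun_prop) (by fun_prop)
      0 (by simpa using hx)
    have hj : jet (fun t : ℝ => x + t • v) (fun t => z + t * w) 0 = (x, v, z) := by
      have : HasDerivAt (fun t : ℝ => x + t • v) v 0 := by
        simpa using ((hasDerivAt_id (0 : ℝ)).smul_const v).const_add x
      simp [jet, this.deriv]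
    have hW0 : W ∈ 𝓝 ((x, v, z, w), (0 : ℝ)) := hW.mem_nhds (hmem (x, v, z, w) hx)
    have hline : Tendsto (fun h : ℝ => ((x, v, z, w), h)) (𝓝[>] 0) (𝓝 ((x, v, z, w), 0)) :=
      (Continuous.tendsto' (by fun_prop) _ _ rfl).mono_left nhdsWithin_le_nhds
    have h2 : Tendsto (fun h : ℝ => l ((x, v, z, w), h) - Lag (x, v, z)) (𝓝[>] 0)
        (𝓝 (l ((x, v, z, w), 0) - Lag (x, v, z))) :=
      ((hl.continuousOn.continuousAt hW0).tendsto.comp hline).sub_const _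
    have h3 : Tendsto (fun h : ℝ => l ((x, v, z, w), h) - Lag (x, v, z)) (𝓝[>] 0) (𝓝 0) := by
      have h4 := h1.trans_tendsto (tendsto_id.mono_left nhdsWithin_le_nhds)
      refine h4.congr' ?_
      filter_upwards [hline.eventually hW0, self_mem_nhdsWithin] with h k1 k2
      have := heq _ k1 k2
      simp only at this
      rw [← this, hj]
      simp
    exact sub_eq_zero.1 (tendsto_nhds_unique h2 h3)

lemma IsQuotientForm.smoothNear (hl : IsQuotientForm U Lag L W l) {Q : (E × E × ℝ × ℝ) × ℝ}
    (hQ : Q ∈ W) : SmoothNear l Q := hl.smooth.smoothNear hl.isOpen hQ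

/-- At `h = 0` the difference quotient of `z` drops out. -/
lemma IsQuotientForm.quotW_zero (hl : IsQuotientForm U Lag L W l) {x : E} (hx : x ∈ U) (v : E)
    (z w : ℝ) : quotW l ((x, v, z, w), 0) = 0 := by
  have h1 := (hl.smoothNear (hl.mem x hx v z w)).differentiableAt.hasFDerivAt
  have h2 : HasDerivAt (fun s : ℝ => (((x, v, z, s), 0) : (E × E × ℝ × ℝ) × ℝ))
      ((0, 0, 0, 1), 0) w :=
    ((hasDerivAt_const w x).prodMk ((hasDerivAt_const w v).prodMk
      ((hasDerivAt_const w z).prodMk (hasDerivAt_id w)))).prodMk (hasDerivAt_const w (0 : ℝ))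
  have h3 := HasFDerivAt.comp_hasDerivAt w h1 h2
  have h4 : (l ∘ fun s : ℝ => (((x, v, z, s), 0) : (E × E × ℝ × ℝ) × ℝ))
      = fun _ => Lag (x, v, z) := by
    funext s
    exact hl.zero x hx v z s
  rw [h4] at h3
  exact h3.unique (hasDerivAt_const w _)

/-- At `h = 0` the derivatives of `l` are those of the continuous Lagrangian. -/
lemma IsQuotientForm.fderiv_zero (hl : IsQuotientForm U Lag L W l) (hU : IsOpen U)
    {x : E} (hx : x ∈ U) (v : E) (z w : ℝ) (hLag : DifferentiableAt ℝ Lag (x, v, z))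
    (a b : E) (c d : ℝ) :
    fderiv ℝ l ((x, v, z, w), 0) ((a, b, c, d), 0) = fderiv ℝ Lag (x, v, z) (a, b, c) := by
  have h1 := (hl.smoothNear (hl.mem x hx v z w)).differentiableAt.hasFDerivAt
  have line : ∀ {G : Type _} [NormedAddCommGroup G] [NormedSpace ℝ G] (p q : G),
      HasDerivAt (fun s : ℝ => p + s • q) q 0 := fun p q => by
    simpa using ((hasDerivAt_id (0 : ℝ)).smul_const q).const_add p
  have h2 := HasFDerivAt.comp_hasDerivAt (0 : ℝ) (f := fun s : ℝ =>
    (((x, v, z, w), 0) : (E × E × ℝ × ℝ) × ℝ) + s • ((a, b, c, d), 0)) (l := l)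
    (by simpa using h1) (line _ _)
  have h3 := HasFDerivAt.comp_hasDerivAt (0 : ℝ) (f := fun s : ℝ => (x, v, z) + s • (a, b, c))
    (l := Lag) (by simpa using hLag.hasFDerivAt) (line _ _)
  refine h2.unique (h3.congr_of_eventuallyEq ?_)
  have h4 : ∀ᶠ s : ℝ in 𝓝 0, x + s • a ∈ U :=
    (by fun_prop : ContinuousAt (fun s : ℝ => x + s • a) 0).eventually
      (hU.mem_nhds (by simpa using hx))
  filter_upwards [h4] with s hs
  have := hl.zero (x + s • a) hs (v + s • b) (z + s * c) (w + s * d)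
  simpa using this

section Partials

variable {x₀ x₁ : E} {z₀ z₁ h : ℝ}

lemma IsQuotientForm.eventually_eq (hl : IsQuotientForm U Lag L W l) (hh : 0 < h)
    (hQ : quotientPoint x₀ x₁ z₀ z₁ h ∈ W) :
    ∀ᶠ r : (E × E) × (ℝ × ℝ) in 𝓝 ((x₀, x₁), (z₀, z₁)),
      L r.1.1 r.1.2 r.2.1 r.2.2 h = l (quotientPoint r.1.1 r.1.2 r.2.1 r.2.2 h) := by
  have h1 : ContinuousAt (fun r : (E × E) × (ℝ × ℝ) => quotientPoint r.1.1 r.1.2 r.2.1 r.2.2 h)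
      ((x₀, x₁), (z₀, z₁)) := by
    unfold quotientPoint
    fun_prop
  filter_upwards [h1.eventually (hl.isOpen.mem_nhds hQ)] with r hr
  exact hl.eq _ _ _ _ _ hh hr

lemma IsQuotientForm.D1_eq (hl : IsQuotientForm U Lag L W l) (hh : 0 < h)
    (hQ : quotientPoint x₀ x₁ z₀ z₁ h ∈ W) : D1 L x₀ x₁ z₀ z₁ h
      = quotX l (quotientPoint x₀ x₁ z₀ z₁ h) - h⁻¹ • quotV l (quotientPoint x₀ x₁ z₀ z₁ h) := by
  have h1 := (hl.smoothNear hQ).differentiableAt.hasFDerivAt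
  have ha : HasFDerivAt (fun y : E => y) (ContinuousLinearMap.id ℝ E) x₀ := hasFDerivAt_id x₀
  have hb : HasFDerivAt (fun y : E => h⁻¹ • (x₁ - y)) (h⁻¹ • -(ContinuousLinearMap.id ℝ E)) x₀ :=
    (ha.const_sub x₁).const_smul h⁻¹
  have h2 := (ha.prodMk (hb.prodMk ((hasFDerivAt_const z₀ x₀).prodMk
    (hasFDerivAt_const (h⁻¹ * (z₁ - z₀)) x₀)))).prodMk (hasFDerivAt_const h x₀)
  have h3 := (HasFDerivAt.comp x₀ (f := fun y => quotientPoint y x₁ z₀ z₁ h) h1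
    h2).congr_of_eventuallyEq
    ((by fun_prop : ContinuousAt (fun y : E => ((y, x₁), (z₀, z₁))) x₀).eventually
      (hl.eventually_eq hh hQ))
  refine h3.fderiv.trans (ContinuousLinearMap.ext fun a => ?_)
  have h4 := fderiv_eq_quot l (quotientPoint x₀ x₁ z₀ z₁ h) a (h⁻¹ • (-a)) 0 0
  simp only [smul_neg, map_neg, map_smul, smul_eq_mul, zero_mul, add_zero] at h4
  simp only [sub_apply, smul_apply, smul_eq_mul]
  rw [sub_eq_add_neg, ← h4]
  simp

lemma IsQuotientForm.D2_eq (hl : IsQuotientForm U Lag L W l) (hh : 0 < h)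
    (hQ : quotientPoint x₀ x₁ z₀ z₁ h ∈ W) : D2 L x₀ x₁ z₀ z₁ h
      = h⁻¹ • quotV l (quotientPoint x₀ x₁ z₀ z₁ h) := by
  have h1 := (hl.smoothNear hQ).differentiableAt.hasFDerivAt
  have ha : HasFDerivAt (fun y : E => y) (ContinuousLinearMap.id ℝ E) x₁ := hasFDerivAt_id x₁
  have hb : HasFDerivAt (fun y : E => h⁻¹ • (y - x₀)) (h⁻¹ • ContinuousLinearMap.id ℝ E) x₁ :=
    (ha.sub_const x₀).const_smul h⁻¹
  have h2 := ((hasFDerivAt_const x₀ x₁).prodMk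
    (hb.prodMk ((hasFDerivAt_const z₀ x₁).prodMk
      (hasFDerivAt_const (h⁻¹ * (z₁ - z₀)) x₁)))).prodMk (hasFDerivAt_const h x₁)
  have h3 := (HasFDerivAt.comp x₁ (f := fun y => quotientPoint x₀ y z₀ z₁ h) h1
    h2).congr_of_eventuallyEq
    ((by fun_prop : ContinuousAt (fun y : E => ((x₀, y), (z₀, z₁))) x₁).eventually
      (hl.eventually_eq hh hQ))
  refine h3.fderiv.trans (ContinuousLinearMap.ext fun a => ?_)
  have h4 := fderiv_eq_quot l (quotientPoint x₀ x₁ z₀ z₁ h) 0 (h⁻¹ • a) 0 0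
  simp only [map_zero, map_smul, smul_eq_mul, zero_mul, add_zero, zero_add] at h4
  simp only [smul_apply, smul_eq_mul]
  rw [← h4]
  simp

lemma IsQuotientForm.D3_eq (hl : IsQuotientForm U Lag L W l) (hh : 0 < h)
    (hQ : quotientPoint x₀ x₁ z₀ z₁ h ∈ W) : D3 L x₀ x₁ z₀ z₁ h
      = quotZ l (quotientPoint x₀ x₁ z₀ z₁ h) - h⁻¹ * quotW l (quotientPoint x₀ x₁ z₀ z₁ h) := by
  have h1 := (hl.smoothNear hQ).differentiableAt.hasFDerivAt
  have h2 : HasDerivAt (fun s => quotientPoint x₀ x₁ s z₁ h) _ z₀ :=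
    ((hasDerivAt_const z₀ x₀).prodMk ((hasDerivAt_const z₀ (h⁻¹ • (x₁ - x₀))).prodMk
      ((hasDerivAt_id z₀).prodMk (((hasDerivAt_id z₀).const_sub z₁).const_mul h⁻¹)))).prodMk
      (hasDerivAt_const z₀ h)
  have h3 := (HasFDerivAt.comp_hasDerivAt z₀ h1 h2).congr_of_eventuallyEq
    ((by fun_prop : ContinuousAt (fun s : ℝ => ((x₀, x₁), (s, z₁))) z₀).eventually
      (hl.eventually_eq hh hQ))
  refine h3.deriv.trans ?_
  rw [fderiv_eq_quot]
  simp
  ring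

lemma IsQuotientForm.D4_eq (hl : IsQuotientForm U Lag L W l) (hh : 0 < h)
    (hQ : quotientPoint x₀ x₁ z₀ z₁ h ∈ W) : D4 L x₀ x₁ z₀ z₁ h
      = h⁻¹ * quotW l (quotientPoint x₀ x₁ z₀ z₁ h) := by
  have h1 := (hl.smoothNear hQ).differentiableAt.hasFDerivAt
  have h2 : HasDerivAt (fun s => quotientPoint x₀ x₁ z₀ s h) _ z₁ :=
    ((hasDerivAt_const z₁ x₀).prodMk ((hasDerivAt_const z₁ (h⁻¹ • (x₁ - x₀))).prodMk
      ((hasDerivAt_const z₁ z₀).prodMk (((hasDerivAt_id z₁).sub_const z₀).const_mul h⁻¹)))).prodMk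
      (hasDerivAt_const z₁ h)
  have h3 := (HasFDerivAt.comp_hasDerivAt z₁ h1 h2).congr_of_eventuallyEq
    ((by fun_prop : ContinuousAt (fun s : ℝ => ((x₀, x₁), (z₀, s))) z₁).eventually
      (hl.eventually_eq hh hQ))
  refine h3.deriv.trans ?_
  rw [fderiv_eq_quot]
  simp

end Partials

/-- The discrete generalized Euler-Lagrange equation says that the momentum at the end of a step is
the momentum at the start of the next step. -/
lemma IsQuotientForm.momentum_eq_of_discreteGeneralizedEL (hl : IsQuotientForm U Lag L W l)
    {xm x xp : E} {zm z zp h : ℝ} (hh : 0 < h)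
    (hQm : quotientPoint xm x zm z h ∈ W) (hQp : quotientPoint x xp z zp h ∈ W)
    (hm : 1 - quotW l (quotientPoint xm x zm z h) ≠ 0)
    (hp : 1 - quotW l (quotientPoint x xp z zp h) + h * quotZ l (quotientPoint x xp z zp h) ≠ 0)
    (hEL : DiscreteGeneralizedEL L xm x xp zm z zp h) :
    momentumEnd l (quotientPoint xm x zm z h) = momentumStart l (quotientPoint x xp z zp h) := by
  unfold DiscreteGeneralizedEL at hEL
  rw [hl.D1_eq hh hQp, hl.D2_eq hh hQm, hl.D3_eq hh hQp, hl.D4_eq hh hQm] at hEL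
  have hQ2 : (quotientPoint x xp z zp h).2 = h := rfl
  refine ContinuousLinearMap.ext fun a => ?_
  have h1 := congrArg (fun A : E →L[ℝ] ℝ => A a) hEL
  simp only [add_apply, sub_apply, smul_apply, smul_eq_mul, zero_apply, mul_sub,
    mul_inv_cancel_left₀ hh.ne'] at h1
  simp only [momentumEnd, momentumStart, hQ2, smul_apply, sub_apply, smul_eq_mul]
  generalize quotW l (quotientPoint xm x zm z h) = Wm at *
  generalize quotW l (quotientPoint x xp z zp h) = Wp at *
  generalize quotZ l (quotientPoint x xp z zp h) = Zp at *
  generalize quotX l (quotientPoint x xp z zp h) a = Xp at *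
  generalize quotV l (quotientPoint x xp z zp h) a = Vp at *
  generalize quotV l (quotientPoint xm x zm z h) a = Vm at *
  field_simp at h1 ⊢
  linear_combination h1

end QuotientForm

/-! ### Difference quotients along a flow -/

section Node

variable {M : Type*} [NormedAddCommGroup M] [NormedSpace ℝ M] [FiniteDimensional ℝ M]
  {V : M × ℝ → M} {Φ : ℝ × (M × ℝ) → M} {y₀ : M × ℝ}

/-- The central difference quotient `B` and the second difference quotient `A` of a flow are smooth
up to step size zero, where they are the first and the second time derivative. -/
lemma IsLocalFlow.exists_node (hΦ : IsLocalFlow V Φ y₀) (hV : DifferentiableAt ℝ V y₀) :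
    ∃ B A : (M × ℝ) × ℝ → M, SmoothNear B (y₀, 0) ∧ SmoothNear A (y₀, 0) ∧
      (∀ᶠ q in 𝓝 (y₀, (0 : ℝ)), Φ (q.2, q.1) = node q.1.1 (B q) (A q) q.2 ∧
        Φ (-q.2, q.1) = node q.1.1 (B q) (A q) (-q.2)) ∧
      B (y₀, 0) = V y₀ ∧ A (y₀, 0) = fderiv ℝ V y₀ (V y₀, 0) := by
  have : CompleteSpace M := FiniteDimensional.complete ℝ M
  obtain ⟨Ψ, hΨ, hΦΨ, hΨ0⟩ := hΦ.exists_quotient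
  obtain ⟨Ψ₂, hΨ₂, hΨΨ₂⟩ := hΨ.exists_eq_add_smul
  have hneg : Tendsto (fun q : (M × ℝ) × ℝ => (q.1, -q.2)) (𝓝 (y₀, 0)) (𝓝 (y₀, 0)) :=
    Continuous.tendsto' (by fun_prop) _ _ (by simp)
  have s1 : SmoothNear (fun q : (M × ℝ) × ℝ => Ψ (q.1, 0)) (y₀, 0) :=
    SmoothNear.comp (f := fun q : (M × ℝ) × ℝ => (q.1, (0 : ℝ))) hΨ (by fun_prop)
  have s2 : SmoothNear (fun q : (M × ℝ) × ℝ => Ψ₂ (q.1, -q.2)) (y₀, 0) :=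
    SmoothNear.comp (f := fun q : (M × ℝ) × ℝ => (q.1, -q.2)) (by simpa using hΨ₂) (by fun_prop)
  have h2 : ∀ᶠ q in 𝓝 (y₀, (0 : ℝ)),
      Φ (q.2, q.1) = q.1.1 + q.2 • (Ψ (q.1, 0) + q.2 • Ψ₂ q) := by
    filter_upwards [hΦΨ, hΨΨ₂] with q k1 k2
    rw [k1, k2]
  have s3 : SmoothNear (fun q : (M × ℝ) × ℝ => q.2 / 2) (y₀, 0) := by fun_prop
  refine ⟨fun q => Ψ (q.1, 0) + (q.2 / 2) • (Ψ₂ q - Ψ₂ (q.1, -q.2)),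
    fun q => Ψ₂ q + Ψ₂ (q.1, -q.2), s1.add (s3.smul (hΨ₂.sub s2)), hΨ₂.add s2, ?_, ?_, ?_⟩
  · filter_upwards [h2, hneg.eventually h2] with q k1 k2
    rw [k1, k2]
    constructor <;> simp only [node] <;> module
  · simp [hΨ0.self_of_nhds]
  · have hc : ContinuousAt (fun t : ℝ => (y₀, t)) 0 := by fun_prop
    have hc' : ContinuousAt (fun t : ℝ => (t, y₀)) 0 := by fun_prop
    -- both sides are the derivative at `0` of the velocity of the flow line
    have e1 : SmoothNear (fun t : ℝ => Ψ₂ (y₀, t)) 0 :=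
      SmoothNear.comp (f := fun t : ℝ => (y₀, t)) hΨ₂ (by fun_prop)
    have e2 : ∀ᶠ t : ℝ in 𝓝 0, V (Φ (t, y₀), y₀.2)
        = V y₀ + (2 * t) • Ψ₂ (y₀, t) + t ^ 2 • deriv (fun s => Ψ₂ (y₀, s)) t := by
      filter_upwards [hc'.eventually hΦ.hasDerivAt, hc.eventually h2 |>.eventually_nhds,
        e1.eventually] with t k1 k2 k3
      have d1 := k3.differentiableAt.hasDerivAt
      have d2 := ((hasDerivAt_id t).smul (((hasDerivAt_id t).smul d1).const_add (V y₀))).const_add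
        y₀.1
      have d3 := k1.unique (d2.congr_of_eventuallyEq (by
        filter_upwards [k2] with s hs
        simp only [hs, hΨ0.self_of_nhds]
        rfl))
      rw [d3]
      simp only [id, Pi.smul_apply']
      module
    have e3 : HasDerivAt (fun t : ℝ => V (Φ (t, y₀), y₀.2)) (fderiv ℝ V y₀ (V y₀, 0)) 0 := by
      have k1 := (hc'.eventually hΦ.hasDerivAt).self_of_nhds
      simp only [hΦ.zero.self_of_nhds] at k1
      refine HasFDerivAt.comp_hasDerivAt (0 : ℝ) (f := fun t : ℝ => (Φ (t, y₀), y₀.2)) (l := V) ?_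
        (k1.prodMk (hasDerivAt_const _ _))
      simpa [hΦ.zero.self_of_nhds] using hV.hasFDerivAt
    have e4 : SmoothNear (deriv (fun s => Ψ₂ (y₀, s))) 0 := by
      have := (e1.fderiv).clm_apply (SmoothNear.const (1 : ℝ) 0)
      simpa [fderiv_apply_one_eq_deriv] using this
    have d1 := e1.differentiableAt.hasDerivAt
    have d2 := e4.differentiableAt.hasDerivAt
    have d3 := ((((hasDerivAt_id (0 : ℝ)).const_mul 2).smul d1).const_add (V y₀)).add
      (((hasDerivAt_id (0 : ℝ)).pow 2).smul d2)
    have d4 := e3.unique (d3.congr_of_eventuallyEq (by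
      filter_upwards [e2] with t ht
      rw [ht]
      rfl))
    rw [d4]
    simp
    module

end Node

section FlowSolution

variable {E : Type*} [NormedAddCommGroup E] [NormedSpace ℝ E]
  {φ : (E × E × ℝ) × ℝ → E} {Λ : (E × E × ℝ) × ℝ → ℝ}
  {Φ : ℝ × ((E × E × ℝ) × ℝ) → E × E × ℝ} {y₀ : (E × E × ℝ) × ℝ}

/-- The flow lines of a second order field are the jets of the solutions of the second order
equation. -/
lemma IsLocalFlow.eventually_jet_eq (hΦ : IsLocalFlow (secondOrderField φ Λ) Φ y₀) :
    ∀ᶠ p in 𝓝 ((0 : ℝ), y₀),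
      jet (fun t => (Φ (t, p.2)).1) (fun t => (Φ (t, p.2)).2.2) p.1 = Φ p ∧
      HasDerivAt (fun t => (Φ (t, p.2)).2.2) (Λ (Φ p, p.2.2)) p.1 ∧
      HasDerivAt (fun t => (Φ (t, p.2)).1) (Φ p).2.1 p.1 ∧
      HasDerivAt (deriv fun t => (Φ (t, p.2)).1) (φ (Φ p, p.2.2)) p.1 := by
  have h1 : ∀ᶠ p in 𝓝 ((0 : ℝ), y₀), HasDerivAt (fun t => (Φ (t, p.2)).1) (Φ p).2.1 p.1 :=
    hΦ.hasDerivAt.mono fun p hp => hp.fst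
  filter_upwards [hΦ.hasDerivAt, h1, h1.eventually_nhds] with p k1 k2 k3
  refine ⟨?_, k1.snd.snd, k2, ?_⟩
  · simp [jet, k2.deriv]
  · refine HasDerivAt.congr_of_eventuallyEq k1.snd.fst ?_
    have hc : Tendsto (fun t : ℝ => (t, p.2)) (𝓝 p.1) (𝓝 p) :=
      Continuous.tendsto' (by fun_prop) _ _ rfl
    filter_upwards [hc.eventually k3] with t ht
    exact ht.deriv

end FlowSolution

/-! ### Approximate solutions of a smooth equation -/

section Stability

/-- If a smooth quantity `μ` vanishes on the solutions of a smooth equation `g(p, c) = 0` which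
determines `c`, then `μ` is bounded by the defect `g` of approximate solutions. -/
lemma isBigO_of_forall_eq_zero {P C D : Type*} [NormedAddCommGroup P] [NormedSpace ℝ P]
    [CompleteSpace P] [NormedAddCommGroup C] [NormedSpace ℝ C] [CompleteSpace C]
    [NormedAddCommGroup D] [NormedSpace ℝ D]
    {g : P × C → C} {μ : P × C → D} {u : P × C} (hg : SmoothNear g u) (h0 : g u = 0)
    (hinv : (fderiv ℝ g u ∘L .inr ℝ P C).IsInvertible) (hμ : SmoothNear μ u)
    {α : Type*} {F : Filter α} {p : α → P} {c : α → C} (hp : Tendsto p F (𝓝 u.1))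
    (hc : Tendsto c F (𝓝 u.2)) (H : P → Prop) (hH : ∀ᶠ a in F, H (p a))
    (hsol : ∀ᶠ r in 𝓝 u, H r.1 → g r = 0 → μ r = 0) :
    (fun a => μ (p a, c a)) =O[F] fun a => g (p a, c a) := by
  obtain ⟨p₀, c₀⟩ := u
  -- solve `g(p, c) = d` for `c` with the defect `d` as an additional parameter
  let G : (P × C) × C → C := fun w => g (w.1.1, w.2) - w.1.2
  have hproj : ContDiff ℝ ∞ fun w : (P × C) × C => (w.1.1, w.2) := by fun_prop
  have hG : SmoothNear G ((p₀, 0), c₀) := by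
    have : SmoothNear (fun w : (P × C) × C => g (w.1.1, w.2)) ((p₀, 0), c₀) :=
      SmoothNear.comp (f := fun w : (P × C) × C => (w.1.1, w.2)) hg (hproj.smoothNear _)
    show SmoothNear (fun w : (P × C) × C => g (w.1.1, w.2) - w.1.2) _
    fun_prop
  have hG0 : G ((p₀, 0), c₀) = 0 := by simp [G, h0]
  have hGinv : (fderiv ℝ G ((p₀, 0), c₀) ∘L .inr ℝ (P × C) C).IsInvertible := by
    have e1 : HasFDerivAt (fun c => G ((p₀, 0), c))
        (fderiv ℝ G ((p₀, 0), c₀) ∘L .inr ℝ (P × C) C) c₀ :=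
      hG.differentiableAt.hasFDerivAt.comp c₀ (hasFDerivAt_prodMk_right (p₀, (0 : C)) c₀)
    have e2 : HasFDerivAt (fun c => G ((p₀, 0), c)) (fderiv ℝ g (p₀, c₀) ∘L .inr ℝ P C) c₀ :=
      (hg.differentiableAt.hasFDerivAt.comp c₀ (hasFDerivAt_prodMk_right p₀ c₀)).congr_of_eventuallyEq
        (Eventually.of_forall fun c => by simp [G])
    rwa [e1.unique e2]
  obtain ⟨ψ, hψ0, hψ, hiff⟩ := exists_smoothNear_implicit hG hG0 hGinv
  simp only at hψ0 hψ
  have hψ' : SmoothNear (fun w : P × C => (w.1, ψ w)) (p₀, 0) := by fun_prop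
  have hN : SmoothNear (fun w : P × C => μ (w.1, ψ w)) (p₀, 0) :=
    SmoothNear.comp (f := fun w : P × C => (w.1, ψ w)) (by rw [hψ0]; exact hμ) hψ'
  obtain ⟨K, s, hs, hK⟩ := (hN.contDiffAt.of_le (m := 1) (by simp)).exists_lipschitzOnWith
  have hpc : Tendsto (fun a => (p a, c a)) F (𝓝 (p₀, c₀)) := hp.prodMk_nhds hc
  have hgt : Tendsto (fun a => g (p a, c a)) F (𝓝 0) := by
    have := hg.continuousAt.tendsto.comp hpc
    rwa [h0] at this
  have t1 : Tendsto (fun a => (p a, g (p a, c a))) F (𝓝 (p₀, 0)) := hp.prodMk_nhds hgt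
  have t0 : Tendsto (fun a => (p a, (0 : C))) F (𝓝 (p₀, 0)) := hp.prodMk_nhds tendsto_const_nhds
  have t2 : Tendsto (fun a => ((p a, g (p a, c a)), c a)) F (𝓝 ((p₀, 0), c₀)) := t1.prodMk_nhds hc
  have t3 : Tendsto (fun a => (p a, ψ (p a, 0))) F (𝓝 (p₀, c₀)) := by
    have := hψ'.continuousAt.tendsto.comp t0
    simp only [hψ0] at this
    exact this
  have t4 : Tendsto (fun a => ((p a, (0 : C)), ψ (p a, 0))) F (𝓝 ((p₀, 0), c₀)) :=
    t0.prodMk_nhds ((continuous_snd.tendsto _).comp t3)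
  refine IsBigO.of_bound K ?_
  filter_upwards [t2.eventually hiff, t4.eventually hiff, t3.eventually hsol, hH, t0.eventually hs,
    t1.eventually hs] with a k1 k2 k3 k4 k5 k6
  have e1 : ψ (p a, g (p a, c a)) = c a := k1.1 (by simp [G])
  have e2 : g (p a, ψ (p a, 0)) = 0 := by simpa [G] using k2.2 rfl
  have e3 := k3 k4 e2
  have e4 := hK.dist_le_mul _ k6 _ k5
  simp only [e1, e3] at e4
  simpa [Prod.dist_eq] using e4

end Stability

/-! ### The second order difference equation in difference quotients -/

section NodeData

variable {E : Type*} [NormedAddCommGroup E] [NormedSpace ℝ E]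

/-- Three consecutive nodes with step `h`, given as `((x, v, a), (z, w, c); h)`: the central node
`(x, z)`, the central difference quotients `(v, w)` and the second difference quotients `(a, c)`. -/
abbrev NodeData (E : Type*) := ((E × E × E) × (ℝ × ℝ × ℝ)) × ℝ

/-- The difference quotients of the step that ends at the central node. -/
def prevStep (s : NodeData E) : (E × E × ℝ × ℝ) × ℝ :=
  ((node s.1.1.1 s.1.1.2.1 s.1.1.2.2 (-s.2), s.1.1.2.1 - (s.2 / 2) • s.1.1.2.2,
    node s.1.2.1 s.1.2.2.1 s.1.2.2.2 (-s.2), s.1.2.2.1 - s.2 / 2 * s.1.2.2.2), s.2)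

/-- The difference quotients of the step that starts at the central node. -/
def nextStep (s : NodeData E) : (E × E × ℝ × ℝ) × ℝ :=
  ((s.1.1.1, s.1.1.2.1 + (s.2 / 2) • s.1.1.2.2, s.1.2.1, s.1.2.2.1 + s.2 / 2 * s.1.2.2.2), s.2)

lemma prevStep_zero (q : (E × E × E) × (ℝ × ℝ × ℝ)) :
    prevStep (q, 0) = ((q.1.1, q.1.2.1, q.2.1, q.2.2.1), 0) := by
  simp [prevStep, node]

lemma nextStep_zero (q : (E × E × E) × (ℝ × ℝ × ℝ)) :
    nextStep (q, 0) = ((q.1.1, q.1.2.1, q.2.1, q.2.2.1), 0) := by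
  simp [nextStep]

lemma contDiff_prevStep : ContDiff ℝ ∞ (prevStep (E := E)) := by
  unfold prevStep node
  fun_prop

lemma contDiff_nextStep : ContDiff ℝ ∞ (nextStep (E := E)) := by
  unfold nextStep
  fun_prop

/-- `q` is a smooth extension to `h = 0` of `F` written in difference quotients. -/
structure IsAccelerationForm (U : Set E) (F : E → E → E → ℝ → ℝ → ℝ → ℝ → E)
    (q : NodeData E → E) : Prop where
  smooth : ∀ p : (E × E × E) × (ℝ × ℝ × ℝ), p.1.1 ∈ U → SmoothNear q (p, 0)
  eq : ∀ p : (E × E × E) × (ℝ × ℝ × ℝ), p.1.1 ∈ U → ∀ᶠ s : NodeData E in 𝓝 (p, 0), 0 < s.2 →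
    F (node s.1.1.1 s.1.1.2.1 s.1.1.2.2 (-s.2)) s.1.1.1 (node s.1.1.1 s.1.1.2.1 s.1.1.2.2 s.2)
      (node s.1.2.1 s.1.2.2.1 s.1.2.2.2 (-s.2)) s.1.2.1 (node s.1.2.1 s.1.2.2.1 s.1.2.2.2 s.2) s.2
      = q s

variable {U : Set E} {Lag : E × E × ℝ → ℝ} {f : E × E × ℝ → E} {L : E → E → ℝ → ℝ → ℝ → ℝ}
  {F : E → E → E → ℝ → ℝ → ℝ → ℝ → E} {q : NodeData E → E}

lemma IsSecondOrderForm.exists_isAccelerationForm (hF : IsSecondOrderForm U Lag f L F) :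
    ∃ q, IsAccelerationForm U F q := by
  obtain ⟨W, q, hW, hmem, hq, heq⟩ := hF.smooth
  refine ⟨q, fun p hp => hq.smoothNear hW (hmem p hp), fun p hp => ?_⟩
  filter_upwards [hW.mem_nhds (hmem p hp)] with s hs h0
  exact heq s hs h0

lemma _root_.ContDiffOn.smoothNear_phase {G : Type*} [NormedAddCommGroup G] [NormedSpace ℝ G]
    {g : E × E × ℝ → G} (hg : ContDiffOn ℝ ∞ g (phase U)) (hU : IsOpen U) {m : E × E × ℝ}
    (hm : m ∈ phase U) : SmoothNear g m :=
  hg.smoothNear (hU.preimage continuous_fst) hm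

/-- At `h = 0` the acceleration form is `f` whenever `(z, w, c)` is the second order jet of a
solution of `ż = ℒ`: the acceleration `a` itself drops out. -/
lemma IsAccelerationForm.apply_zero [FiniteDimensional ℝ E] (hq : IsAccelerationForm U F q)
    (hF : IsSecondOrderForm U Lag f L F) (hU : IsOpen U) (hLag : ContDiffOn ℝ ∞ Lag (phase U))
    {m : E × E × ℝ} (hm : m ∈ phase U) (a : E) :
    q (((m.1, m.2.1, a), (m.2.2, Lag m, fderiv ℝ Lag m (m.2.1, a, Lag m))), 0) = f m := by
  have sL : SmoothNear Lag m := hLag.smoothNear_phase hU hm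
  have sΛ : SmoothNear (fun y : (E × E × ℝ) × ℝ => Lag y.1) (m, 0) :=
    SmoothNear.comp (f := fun y : (E × E × ℝ) × ℝ => y.1) sL (by fun_prop)
  have sφ : SmoothNear (fun _ : (E × E × ℝ) × ℝ => a) (m, 0) := SmoothNear.const _ _
  have sV := sφ.secondOrderField sΛ
  -- a solution with initial acceleration `a`
  obtain ⟨Φ, hΦ⟩ := exists_localFlow sV
  obtain ⟨B, A, hB, hA, hnode, hB0, hA0⟩ := hΦ.exists_node sV.differentiableAt
  have hc : ContinuousAt (fun t : ℝ => (t, (m, (0 : ℝ)))) 0 := by fun_prop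
  have sX : SmoothNear (fun t : ℝ => (Φ (t, (m, 0))).1) 0 :=
    (SmoothNear.comp (f := fun t : ℝ => (t, (m, (0 : ℝ)))) hΦ.smooth (by fun_prop)).fst
  have sZ : SmoothNear (fun t : ℝ => (Φ (t, (m, 0))).2.2) 0 :=
    (SmoothNear.comp (f := fun t : ℝ => (t, (m, (0 : ℝ)))) hΦ.smooth (by fun_prop)).snd.snd
  obtain ⟨X, hX, -, hX'⟩ := sX.exists_contDiff
  obtain ⟨Z, hZ, -, hZ'⟩ := sZ.exists_contDiff
  have hΦ0 : Φ (0, (m, 0)) = m := hΦ.zero.self_of_nhds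
  have hjet : ∀ᶠ t : ℝ in 𝓝 0, jet X Z t = Φ (t, (m, 0)) ∧ HasDerivAt Z (Lag (jet X Z t)) t := by
    filter_upwards [hc.eventually hΦ.eventually_jet_eq, hX'.eventually_nhds, hZ'.eventually_nhds]
      with t k1 k2 k3
    have e1 : jet X Z t = Φ (t, (m, 0)) := by
      rw [← k1.1, jet, jet, EventuallyEq.deriv_eq k2, k2.self_of_nhds, k3.self_of_nhds]
    refine ⟨e1, ?_⟩
    rw [e1]
    exact HasDerivAt.congr_of_eventuallyEq k1.2.1 k3
  have hjet0 : jet X Z 0 = m := hjet.self_of_nhds.1.trans hΦ0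
  have hX0 : X 0 = m.1 := congrArg Prod.fst hjet0
  have hZ0 : Z 0 = m.2.2 := congrArg (fun m => m.2.2) hjet0
  have h1 := hF.consistent X Z hX hZ 0 (by rw [hX0]; exact hm) (hjet.mono fun t ht => ht.2)
  rw [hjet0] at h1
  -- the node data of the solution
  let s : ℝ → NodeData E := fun h =>
    (((m.1, (B ((m, 0), h)).1, (A ((m, 0), h)).1),
      (m.2.2, (B ((m, 0), h)).2.2, (A ((m, 0), h)).2.2)), h)
  have hs0 : s 0 = (((m.1, m.2.1, a), (m.2.2, Lag m, fderiv ℝ Lag m (m.2.1, a, Lag m))), 0) := by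
    have hd : fderiv ℝ (fun y : (E × E × ℝ) × ℝ => Lag y.1) (m, 0) ((m.2.1, a, Lag m), 0)
        = fderiv ℝ Lag m (m.2.1, a, Lag m) := by
      have : HasFDerivAt (fun y : (E × E × ℝ) × ℝ => Lag y.1)
          ((fderiv ℝ Lag m).comp (ContinuousLinearMap.fst ℝ (E × E × ℝ) ℝ)) (m, 0) :=
        HasFDerivAt.comp (f := fun y : (E × E × ℝ) × ℝ => y.1) (m, (0 : ℝ))
          sL.differentiableAt.hasFDerivAt hasFDerivAt_fst
      rw [this.fderiv]
      rfl
    simp only [s, hB0, hA0]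
    rw [fderiv_secondOrderField sφ sΛ]
    simp only [secondOrderField]
    rw [hd]
  have hsc : ContinuousAt s 0 := by
    have c1 : ContinuousAt (fun h : ℝ => B ((m, 0), h)) 0 :=
      ContinuousAt.comp (f := fun h : ℝ => ((m, (0 : ℝ)), h)) hB.continuousAt (by fun_prop)
    have c2 : ContinuousAt (fun h : ℝ => A ((m, 0), h)) 0 :=
      ContinuousAt.comp (f := fun h : ℝ => ((m, (0 : ℝ)), h)) hA.continuousAt (by fun_prop)
    exact ((continuousAt_const.prodMk (c1.fst.prodMk c2.fst)).prodMk
      (continuousAt_const.prodMk (c1.snd.snd.prodMk c2.snd.snd))).prodMk continuousAt_id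
  have hst : Tendsto s (𝓝[>] 0) (𝓝 (s 0)) := hsc.tendsto.mono_left nhdsWithin_le_nhds
  have hs0' : s 0 = ((s 0).1, 0) := rfl
  have hsm : SmoothNear q (s 0) := by
    rw [hs0']
    exact hq.smooth _ hm
  have h2 : Tendsto (fun h => q (s h) - f m) (𝓝[>] 0) (𝓝 (q (s 0) - f m)) :=
    (hsm.continuousAt.tendsto.comp hst).sub_const _
  have h3 : Tendsto (fun h => q (s h) - f m) (𝓝[>] 0) (𝓝 0) := by
    refine (h1.trans_tendsto (tendsto_id.mono_left nhdsWithin_le_nhds)).congr' ?_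
    have hneg : Tendsto (fun t : ℝ => -t) (𝓝 0) (𝓝 0) := Continuous.tendsto' (by fun_prop) _ _ neg_zero
    have hcc : ContinuousAt (fun h : ℝ => ((m, (0 : ℝ)), h)) 0 := by fun_prop
    have heq := hq.eq (s 0).1 hm
    filter_upwards [self_mem_nhdsWithin, nhdsWithin_le_nhds hX', nhdsWithin_le_nhds hZ',
      nhdsWithin_le_nhds (hneg.eventually hX'), nhdsWithin_le_nhds (hneg.eventually hZ'),
      nhdsWithin_le_nhds (hcc.eventually hnode), hst.eventually heq] with h h0 k1 k2 k3 k4 k5 k6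
    rw [← k6 h0, zero_sub, zero_add, k1, k2, k3, k4, hX0, hZ0]
    have e1 := k5.1
    have e2 := k5.2
    rw [e1, e2]
    rfl
  have h4 := sub_eq_zero.1 (tendsto_nhds_unique h2 h3)
  rwa [hs0] at h4

end NodeData

section StepDifference

lemma hasDerivAt_node_neg {G : Type*} [NormedAddCommGroup G] [NormedSpace ℝ G] (p v a : G) :
    HasDerivAt (fun h : ℝ => node p v a (-h)) (-v) 0 := by
  have hid : HasDerivAt (fun h : ℝ => h) 1 0 := hasDerivAt_id 0
  have := ((hid.neg.smul_const v).const_add p).add (((hid.neg.pow 2).div_const 2).smul_const a)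
  refine (this.congr_of_eventuallyEq (f := fun h : ℝ => node p v a (-h))
    (Eventually.of_forall fun h => ?_)).congr_deriv (by simp)
  simp [node]

variable {E : Type*} [NormedAddCommGroup E] [NormedSpace ℝ E]
  {U : Set E} {Lag : E × E × ℝ → ℝ} {L : E → E → ℝ → ℝ → ℝ → ℝ}
  {W : Set ((E × E × ℝ × ℝ) × ℝ)} {l : (E × E × ℝ × ℝ) × ℝ → ℝ}

lemma IsQuotientForm.smoothNear_nextStep (hl : IsQuotientForm U Lag L W l)
    {p : (E × E × E) × (ℝ × ℝ × ℝ)} (hp : p.1.1 ∈ U) :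
    SmoothNear (fun s => l (nextStep s)) (p, 0) :=
  SmoothNear.comp (f := nextStep)
    (by rw [nextStep_zero]; exact hl.smoothNear (hl.mem _ hp _ _ _)) (contDiff_nextStep.smoothNear _)

lemma IsQuotientForm.smoothNear_prevStep (hl : IsQuotientForm U Lag L W l)
    {p : (E × E × E) × (ℝ × ℝ × ℝ)} (hp : p.1.1 ∈ U) :
    SmoothNear (fun s => l (prevStep s)) (p, 0) :=
  SmoothNear.comp (f := prevStep)
    (by rw [prevStep_zero]; exact hl.smoothNear (hl.mem _ hp _ _ _)) (contDiff_prevStep.smoothNear _)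

variable [FiniteDimensional ℝ E]

/-- The difference quotient of the discrete Lagrangians of two consecutive steps extends smoothly to
`h = 0`, where it is the time derivative of `ℒ`. -/
lemma IsQuotientForm.exists_stepDifference (hl : IsQuotientForm U Lag L W l) (hU : IsOpen U)
    (hLag : ContDiffOn ℝ ∞ Lag (phase U)) {p : (E × E × E) × (ℝ × ℝ × ℝ)} (hp : p.1.1 ∈ U) :
    ∃ H : NodeData E → ℝ, SmoothNear H (p, 0) ∧
      (∀ᶠ s in 𝓝 (p, (0 : ℝ)), l (nextStep s) - l (prevStep s) = s.2 * H s) ∧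
      ∀ᶠ r in 𝓝 p, H (r, 0)
        = fderiv ℝ Lag (r.1.1, r.1.2.1, r.2.1) (r.1.2.1, r.1.2.2, r.2.2.1) := by
  obtain ⟨H, hH, hHeq⟩ :=
    ((hl.smoothNear_nextStep hp).sub (hl.smoothNear_prevStep hp)).exists_eq_add_smul
  have hHeq' : ∀ᶠ s in 𝓝 (p, (0 : ℝ)), l (nextStep s) - l (prevStep s) = s.2 * H s := by
    filter_upwards [hHeq] with s hs
    rw [hs, nextStep_zero, prevStep_zero, sub_self, zero_add, smul_eq_mul]
  refine ⟨H, hH, hHeq', ?_⟩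
  have hc : ContinuousAt (fun r : (E × E × E) × (ℝ × ℝ × ℝ) => (r, (0 : ℝ))) p := by fun_prop
  have hUp : ∀ᶠ r : (E × E × E) × (ℝ × ℝ × ℝ) in 𝓝 p, r.1.1 ∈ U :=
    (by fun_prop : ContinuousAt (fun r : (E × E × E) × (ℝ × ℝ × ℝ) => r.1.1) p).eventually
      (hU.mem_nhds hp)
  filter_upwards [hc.eventually hH.eventually, hc.eventually hHeq'.eventually_nhds, hUp]
    with r k1 k2 k3
  obtain ⟨⟨x, v, a⟩, z, w, c⟩ := r
  have hcr : ContinuousAt (fun h : ℝ => (((x, v, a), (z, w, c)), h)) 0 := by fun_prop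
  have d0 : DifferentiableAt ℝ (fun h : ℝ => H (((x, v, a), (z, w, c)), h)) 0 :=
    DifferentiableAt.comp (f := fun h : ℝ => (((x, v, a), (z, w, c)), h)) 0 k1.differentiableAt
      (by fun_prop)
  have d1 := ((hasDerivAt_id (0 : ℝ)).mul d0.hasDerivAt)
  have hl0 := (hl.smoothNear (hl.mem x k3 v z w)).differentiableAt.hasFDerivAt
  have hid : HasDerivAt (fun h : ℝ => h) 1 0 := hasDerivAt_id 0
  have hh2 : HasDerivAt (fun h : ℝ => h / 2) (1 / 2) 0 := hid.div_const 2
  have n1 : HasDerivAt (fun h : ℝ => nextStep (((x, v, a), (z, w, c)), h))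
      ((0, (1 / 2 : ℝ) • a, 0, 1 / 2 * c), 1) 0 :=
    ((hasDerivAt_const _ x).prodMk (((hh2.smul_const a).const_add v).prodMk
      ((hasDerivAt_const _ z).prodMk ((hh2.mul_const c).const_add w)))).prodMk hid
  have n2 : HasDerivAt (fun h : ℝ => prevStep (((x, v, a), (z, w, c)), h))
      ((-v, -((1 / 2 : ℝ) • a), -w, -(1 / 2 * c)), 1) 0 :=
    ((hasDerivAt_node_neg x v a).prodMk (((hh2.smul_const a).const_sub v).prodMk
      ((hasDerivAt_node_neg z w c).prodMk ((hh2.mul_const c).const_sub w)))).prodMk hid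
  have d2 := HasFDerivAt.comp_hasDerivAt (0 : ℝ) (l := l) (by rw [nextStep_zero]; exact hl0) n1
  have d3 := HasFDerivAt.comp_hasDerivAt (0 : ℝ) (l := l) (by rw [prevStep_zero]; exact hl0) n2
  have d4 := (d2.sub d3).unique (d1.congr_of_eventuallyEq (by
    filter_upwards [hcr.eventually k2] with h hh
    exact hh))
  rw [← map_sub] at d4
  have e1 := hl.fderiv_zero hU k3 v z w
    (hLag.smoothNear_phase hU (m := (x, v, z)) k3).differentiableAt v a w c
  have e2 : (((0, (1 / 2 : ℝ) • a, 0, 1 / 2 * c), 1) : (E × E × ℝ × ℝ) × ℝ)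
      - ((-v, -((1 / 2 : ℝ) • a), -w, -(1 / 2 * c)), 1) = ((v, a, w, c), 0) := by
    simp only [Prod.mk_sub_mk, sub_neg_eq_add, zero_add, sub_self, ← add_smul, ← add_mul]
    norm_num
  rw [e2, e1] at d4
  simpa using d4.symm

end StepDifference

/-! ### Defect of the discrete Euler-Lagrange equation -/

section MomentumDefect

variable {E : Type*} [NormedAddCommGroup E] [NormedSpace ℝ E]

lemma isInvertible_of_forall_eq_zero {C : Type*} [NormedAddCommGroup C] [NormedSpace ℝ C]
    [FiniteDimensional ℝ C] {A : C →L[ℝ] C} (h : ∀ ξ, A ξ = 0 → ξ = 0) : A.IsInvertible := by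
  have hinj : Function.Injective A.toLinearMap :=
    (injective_iff_map_eq_zero A.toLinearMap).2 h
  exact ⟨(LinearEquiv.ofInjectiveEndo A.toLinearMap hinj).toContinuousLinearEquiv, by ext; rfl⟩

lemma quotientPoint_node_left (s : NodeData E) (h0 : s.2 ≠ 0) :
    quotientPoint (node s.1.1.1 s.1.1.2.1 s.1.1.2.2 (-s.2)) s.1.1.1
      (node s.1.2.1 s.1.2.2.1 s.1.2.2.2 (-s.2)) s.1.2.1 s.2 = prevStep s := by
  obtain ⟨⟨⟨x, v, a⟩, z, w, c⟩, h⟩ := s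
  simp only at h0
  simp only [quotientPoint, prevStep, Prod.mk.injEq, true_and, and_true]
  refine ⟨?_, ?_⟩
  · rw [show x - node x v a (-h) = h • (v - (h / 2) • a) by simp only [node]; module,
      inv_smul_smul₀ h0]
  · simp only [node, smul_eq_mul]
    field_simp
    ring

lemma quotientPoint_node_right (s : NodeData E) (h0 : s.2 ≠ 0) :
    quotientPoint s.1.1.1 (node s.1.1.1 s.1.1.2.1 s.1.1.2.2 s.2) s.1.2.1
      (node s.1.2.1 s.1.2.2.1 s.1.2.2.2 s.2) s.2 = nextStep s := by
  obtain ⟨⟨⟨x, v, a⟩, z, w, c⟩, h⟩ := s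
  simp only at h0
  simp only [quotientPoint, nextStep, Prod.mk.injEq, true_and, and_true]
  refine ⟨?_, ?_⟩
  · rw [show node x v a h - x = h • (v + (h / 2) • a) by simp only [node]; module,
      inv_smul_smul₀ h0]
  · simp only [node, smul_eq_mul]
    field_simp
    ring

lemma secondDifference_node (x v a : E) {h : ℝ} (h0 : h ≠ 0) :
    secondDifference (node x v a (-h)) x (node x v a h) h = a := by
  rw [secondDifference,
    show node x v a h - (2 : ℝ) • x + node x v a (-h) = h ^ 2 • a by simp only [node]; module,
    inv_smul_smul₀ (pow_ne_zero 2 h0)]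

/-- Node data from the parameters `(x, v, z; h)` and the unknowns `(a, w, c)`. -/
def nodeData (r : ((E × E × ℝ) × ℝ) × (E × ℝ × ℝ)) : NodeData E :=
  (((r.1.1.1, r.1.1.2.1, r.2.1), (r.1.1.2.2, r.2.2.1, r.2.2.2)), r.1.2)

lemma contDiff_nodeData : ContDiff ℝ ∞ (nodeData (E := E)) := by
  unfold nodeData
  fun_prop

/-- The difference system for the unknowns `(a, w, c)`: the first component is the second order
equation, the other two are the sum and the difference quotient of the discrete evolutions of the
action for the two steps. -/
def nodeEquation (l : (E × E × ℝ × ℝ) × ℝ → ℝ) (q : NodeData E → E) (H : NodeData E → ℝ)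
    (r : ((E × E × ℝ) × ℝ) × (E × ℝ × ℝ)) : E × ℝ × ℝ :=
  (r.2.1 - q (nodeData r),
    r.2.2.1 - (l (nextStep (nodeData r)) + l (prevStep (nodeData r))) / 2,
    r.2.2.2 - H (nodeData r))

variable {U : Set E} {Lag : E × E × ℝ → ℝ} {f : E × E × ℝ → E} {L : E → E → ℝ → ℝ → ℝ → ℝ}
  {W : Set ((E × E × ℝ × ℝ) × ℝ)} {l : (E × E × ℝ × ℝ) × ℝ → ℝ}
  {F : E → E → E → ℝ → ℝ → ℝ → ℝ → E} {q : NodeData E → E} {H : NodeData E → ℝ} {m : E × E × ℝ}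

/-- The node data of a solution of `ẍ = f`, `ż = ℒ` at step size zero. -/
def limitNode (Lag : E × E × ℝ → ℝ) (f : E × E × ℝ → E) (m : E × E × ℝ) :
    ((E × E × ℝ) × ℝ) × (E × ℝ × ℝ) :=
  ((m, 0), (f m, Lag m, fderiv ℝ Lag m (m.2.1, f m, Lag m)))

lemma SmoothNear.comp_nodeData {G : Type*} [NormedAddCommGroup G] [NormedSpace ℝ G]
    {g : NodeData E → G} {r : ((E × E × ℝ) × ℝ) × (E × ℝ × ℝ)} (hg : SmoothNear g (nodeData r)) :
    SmoothNear (fun r => g (nodeData r)) r :=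
  SmoothNear.comp (f := nodeData) hg (contDiff_nodeData.smoothNear _)

lemma smoothNear_nodeEquation (hl : IsQuotientForm U Lag L W l) (hq : IsAccelerationForm U F q)
    (hm : m ∈ phase U) (hH : SmoothNear H (nodeData (limitNode Lag f m))) :
    SmoothNear (nodeEquation l q H) (limitNode Lag f m) := by
  have s1 : SmoothNear (fun r => q (nodeData r)) (limitNode Lag f m) :=
    SmoothNear.comp_nodeData (hq.smooth _ hm)
  have s2 : SmoothNear (fun r => l (nextStep (nodeData r))) (limitNode Lag f m) :=
    SmoothNear.comp_nodeData (g := fun s => l (nextStep s)) (hl.smoothNear_nextStep hm)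
  have s3 : SmoothNear (fun r => l (prevStep (nodeData r))) (limitNode Lag f m) :=
    SmoothNear.comp_nodeData (g := fun s => l (prevStep s)) (hl.smoothNear_prevStep hm)
  have s4 := SmoothNear.comp_nodeData hH
  have s5 : SmoothNear (fun r : ((E × E × ℝ) × ℝ) × (E × ℝ × ℝ) => r.2) (limitNode Lag f m) := by
    fun_prop
  exact (s5.fst.sub s1).prodMk ((s5.snd.fst.sub ((s2.add s3).div_const 2)).prodMk
    (s5.snd.snd.sub s4))

/-- At step size zero the difference system is nondegenerate: the acceleration drops out
of its right hand side when `w` and `c` are eliminated. -/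
lemma isInvertible_fderiv_nodeEquation [FiniteDimensional ℝ E] (hl : IsQuotientForm U Lag L W l)
    (hq : IsAccelerationForm U F q) (hF : IsSecondOrderForm U Lag f L F) (hU : IsOpen U)
    (hLag : ContDiffOn ℝ ∞ Lag (phase U)) (hm : m ∈ phase U)
    (hH : SmoothNear H (nodeData (limitNode Lag f m)))
    (hH0 : ∀ᶠ r in 𝓝 (nodeData (limitNode Lag f m)).1, H (r, 0)
        = fderiv ℝ Lag (r.1.1, r.1.2.1, r.2.1) (r.1.2.1, r.1.2.2, r.2.2.1)) :
    (fderiv ℝ (nodeEquation l q H) (limitNode Lag f m) ∘L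
      .inr ℝ ((E × E × ℝ) × ℝ) (E × ℝ × ℝ)).IsInvertible := by
  refine isInvertible_of_forall_eq_zero fun ξ hξ => ?_
  obtain ⟨α, β, γ⟩ := ξ
  have line : ∀ (c b : ℝ), HasDerivAt (fun s : ℝ => c + s * b) b 0 := fun c b => by
    simpa using ((hasDerivAt_id (0 : ℝ)).mul_const b).const_add c
  have lineE : ∀ (c b : E), HasDerivAt (fun s : ℝ => c + s • b) b 0 := fun c b => by
    simpa using ((hasDerivAt_id (0 : ℝ)).smul_const b).const_add c
  -- derivative of the equation along the line through the base point in direction `ξ`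
  have d := HasFDerivAt.comp_hasDerivAt (0 : ℝ)
    (f := fun s : ℝ => (((m, 0), (f m + s • α, Lag m + s * β,
      fderiv ℝ Lag m (m.2.1, f m, Lag m) + s * γ)) : ((E × E × ℝ) × ℝ) × (E × ℝ × ℝ)))
    (l := nodeEquation l q H) (l' := fderiv ℝ (nodeEquation l q H) (limitNode Lag f m))
    (by simpa [limitNode] using (smoothNear_nodeEquation hl hq hm hH).differentiableAt.hasFDerivAt)
    ((hasDerivAt_const _ _).prodMk ((lineE _ _).prodMk ((line _ _).prodMk (line _ _))))
  have hz : fderiv ℝ (nodeEquation l q H) (limitNode Lag f m) (0, (α, β, γ)) = 0 := hξ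
  rw [hz] at d
  have hstep : ∀ s : ℝ, (l (nextStep (((m.1, m.2.1, f m + s • α), (m.2.2, Lag m + s * β,
      fderiv ℝ Lag m (m.2.1, f m, Lag m) + s * γ)), 0))
      + l (prevStep (((m.1, m.2.1, f m + s • α), (m.2.2, Lag m + s * β,
      fderiv ℝ Lag m (m.2.1, f m, Lag m) + s * γ)), 0))) / 2 = Lag m := by
    intro s
    rw [nextStep_zero, prevStep_zero, hl.zero _ hm]
    simp
  have d2 : HasDerivAt (fun s : ℝ => s * β) 0 0 := by
    refine HasDerivAt.congr_of_eventuallyEq d.snd.fst (Eventually.of_forall fun s => ?_)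
    simp only [nodeEquation, nodeData, Function.comp]
    rw [hstep]
    ring
  have hβ : β = 0 := by
    have := (line 0 β).unique (by simpa using d2)
    exact this
  subst hβ
  have hsplit : ∀ s : ℝ, fderiv ℝ Lag m (m.2.1, f m + s • α, Lag m)
      = fderiv ℝ Lag m (m.2.1, f m, Lag m) + s * fderiv ℝ Lag m (0, α, 0) := by
    intro s
    rw [← smul_eq_mul, ← map_smul, ← map_add]
    simp
  have d3 : HasDerivAt (fun s : ℝ => s * (γ - fderiv ℝ Lag m (0, α, 0))) 0 0 := by
    refine HasDerivAt.congr_of_eventuallyEq d.snd.snd ?_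
    have hc : Tendsto (fun s : ℝ => (nodeData (((m, 0), (f m + s • α, Lag m + s * 0,
      fderiv ℝ Lag m (m.2.1, f m, Lag m) + s * γ)) : ((E × E × ℝ) × ℝ) × (E × ℝ × ℝ))).1) (𝓝 0)
      (𝓝 (nodeData (limitNode Lag f m)).1) := by
      refine Continuous.tendsto' (continuous_fst.comp (contDiff_nodeData.continuous.comp ?_)) _ _
        (by simp [limitNode])
      fun_prop
    filter_upwards [hc.eventually hH0] with s hs
    simp only [nodeData] at hs
    simp only [nodeEquation, nodeData, Function.comp]
    rw [hs]
    simp only [mul_zero, add_zero]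
    rw [show ((m.1, m.2.1, m.2.2) : E × E × ℝ) = m from rfl, hsplit]
    ring
  have hγ : γ = fderiv ℝ Lag m (0, α, 0) := by
    have := (line 0 (γ - fderiv ℝ Lag m (0, α, 0))).unique (by simpa using d3)
    exact sub_eq_zero.1 this
  have d1 : HasDerivAt (fun s : ℝ => s • α) 0 0 := by
    refine HasDerivAt.congr_of_eventuallyEq d.fst (Eventually.of_forall fun s => ?_)
    simp only [nodeEquation, nodeData, Function.comp]
    rw [hγ, ← hsplit, mul_zero, add_zero, hq.apply_zero hF hU hLag hm]
    simp
  have hα : α = 0 := (lineE 0 α).unique (by simpa using d1)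
  subst hα
  rw [hγ, show ((0, 0, 0) : E × E × ℝ) = 0 from rfl, map_zero]
  rfl

/-- An exact solution of the difference system solves the discrete Euler-Lagrange equation, so that
its momenta match. -/
lemma momentumEnd_sub_momentumStart_eq_zero (hl : IsQuotientForm U Lag L W l)
    (hq : IsAccelerationForm U F q) (hF : IsSecondOrderForm U Lag f L F) (hm : m ∈ phase U)
    (hHeq : ∀ᶠ s in 𝓝 (nodeData (limitNode Lag f m)),
      l (nextStep s) - l (prevStep s) = s.2 * H s) :
    ∀ᶠ r in 𝓝 (limitNode Lag f m), 0 < r.1.2 → nodeEquation l q H r = 0 →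
      momentumEnd l (prevStep (nodeData r)) - momentumStart l (nextStep (nodeData r)) = 0 := by
  have hn : Tendsto (fun r : ((E × E × ℝ) × ℝ) × (E × ℝ × ℝ) => nodeData r)
      (𝓝 (limitNode Lag f m)) (𝓝 (nodeData (limitNode Lag f m))) :=
    contDiff_nodeData.continuous.tendsto _
  have hlim : nodeData (limitNode Lag f m) = ((nodeData (limitNode Lag f m)).1, 0) := rfl
  have hQ0 : ((m.1, m.2.1, m.2.2, Lag m), (0 : ℝ)) ∈ W := hl.mem _ hm _ _ _
  have hnext : Tendsto (fun r : ((E × E × ℝ) × ℝ) × (E × ℝ × ℝ) => nextStep (nodeData r))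
      (𝓝 (limitNode Lag f m)) (𝓝 ((m.1, m.2.1, m.2.2, Lag m), 0)) := by
    refine ((contDiff_nextStep.continuous.tendsto _).comp hn).mono_right (le_of_eq ?_)
    rw [hlim, nextStep_zero]
    rfl
  have hprev : Tendsto (fun r : ((E × E × ℝ) × ℝ) × (E × ℝ × ℝ) => prevStep (nodeData r))
      (𝓝 (limitNode Lag f m)) (𝓝 ((m.1, m.2.1, m.2.2, Lag m), 0)) := by
    refine ((contDiff_prevStep.continuous.tendsto _).comp hn).mono_right (le_of_eq ?_)
    rw [hlim, prevStep_zero]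
    rfl
  have hW := hl.isOpen.mem_nhds hQ0
  have sl := hl.smoothNear hQ0
  have hw0 : quotW l ((m.1, m.2.1, m.2.2, Lag m), 0) = 0 := hl.quotW_zero hm _ _ _
  have hne1 : ∀ᶠ Q in 𝓝 ((m.1, m.2.1, m.2.2, Lag m), (0 : ℝ)), 1 - quotW l Q ≠ 0 :=
    (continuousAt_const.sub sl.quotW.continuousAt).eventually_ne (by simp [hw0])
  have hne2 : ∀ᶠ Q in 𝓝 ((m.1, m.2.1, m.2.2, Lag m), (0 : ℝ)),
      1 - quotW l Q + Q.2 * quotZ l Q ≠ 0 :=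
    ((continuousAt_const.sub sl.quotW.continuousAt).add
      (continuousAt_snd.mul sl.quotZ.continuousAt)).eventually_ne (by simp [hw0])
  filter_upwards [hn.eventually (hq.eq _ hm), hn.eventually (hF.equiv _ hm), hn.eventually hHeq,
    hnext.eventually hW, hprev.eventually hW, hprev.eventually hne1, hnext.eventually hne2]
    with r k1 k2 k3 k4 k5 k6 k7 h0 hr
  have h0' : 0 < (nodeData r).2 := h0
  have g1 : (nodeData r).1.1.2.2 = q (nodeData r) := sub_eq_zero.1 (congrArg Prod.fst hr)
  have g2 : (nodeData r).1.2.2.1 = (l (nextStep (nodeData r)) + l (prevStep (nodeData r))) / 2 :=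
    sub_eq_zero.1 (congrArg (fun p => p.2.1) hr)
  have g3 : (nodeData r).1.2.2.2 = H (nodeData r) :=
    sub_eq_zero.1 (congrArg (fun p => p.2.2) hr)
  generalize nodeData r = s at *
  have e1 := quotientPoint_node_left s h0'.ne'
  have e2 := quotientPoint_node_right s h0'.ne'
  rw [← g3] at k3
  have z1 : DiscreteZ L (node s.1.1.1 s.1.1.2.1 s.1.1.2.2 (-s.2)) s.1.1.1
      (node s.1.2.1 s.1.2.2.1 s.1.2.2.2 (-s.2)) s.1.2.1 s.2 := by
    rw [DiscreteZ, hl.eq _ _ _ _ _ h0' (by rw [e1]; exact k5), e1, div_eq_inv_mul]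
    have : (quotientPoint (node s.1.1.1 s.1.1.2.1 s.1.1.2.2 (-s.2)) s.1.1.1
      (node s.1.2.1 s.1.2.2.1 s.1.2.2.2 (-s.2)) s.1.2.1 s.2).1.2.2.2 = (prevStep s).1.2.2.2 := by
      rw [e1]
    refine this.trans ?_
    simp only [prevStep] at k3 g2 ⊢
    linarith
  have z2 : DiscreteZ L s.1.1.1 (node s.1.1.1 s.1.1.2.1 s.1.1.2.2 s.2) s.1.2.1
      (node s.1.2.1 s.1.2.2.1 s.1.2.2.2 s.2) s.2 := by
    rw [DiscreteZ, hl.eq _ _ _ _ _ h0' (by rw [e2]; exact k4), e2, div_eq_inv_mul]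
    have : (quotientPoint s.1.1.1 (node s.1.1.1 s.1.1.2.1 s.1.1.2.2 s.2) s.1.2.1
      (node s.1.2.1 s.1.2.2.1 s.1.2.2.2 s.2) s.2).1.2.2.2 = (nextStep s).1.2.2.2 := by
      rw [e2]
    refine this.trans ?_
    simp only [nextStep] at k3 g2 ⊢
    linarith
  have hEL := (k2 h0' _ _ _ _ _ _ _ rfl rfl rfl rfl rfl rfl rfl z1 z2).2
    (by rw [secondDifference_node _ _ _ h0'.ne', k1 h0', g1])
  have := hl.momentum_eq_of_discreteGeneralizedEL h0' (by rw [e1]; exact k5) (by rw [e2]; exact k4)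
    (by rw [e1]; exact k6) (by rw [e2]; exact k7) hEL
  rw [e1, e2] at this
  exact sub_eq_zero.2 this

/-- If node data satisfy the difference system up to `O(hⁿ⁺¹)`, then the discrete momenta at the
central node match up to `O(hⁿ)`. -/
lemma IsQuotientForm.momentum_isBigO [FiniteDimensional ℝ E] (hl : IsQuotientForm U Lag L W l)
    (hF : IsSecondOrderForm U Lag f L F) (hq : IsAccelerationForm U F q) (hU : IsOpen U)
    (hLag : ContDiffOn ℝ ∞ Lag (phase U)) (hm : m ∈ phase U)
    {σ : ℝ → E × E × ℝ} {u : ℝ → E × ℝ × ℝ}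
    (hσ : Tendsto σ (𝓝[>] 0) (𝓝 m)) (hu : Tendsto u (𝓝[>] 0) (𝓝 (limitNode Lag f m).2)) {n : ℕ}
    (hacc : (fun h => (u h).1 - q (nodeData ((σ h, h), u h))) =O[𝓝[>] 0] fun h => h ^ (n + 1))
    (hnext : (fun h => (nextStep (nodeData ((σ h, h), u h))).1.2.2.2
      - l (nextStep (nodeData ((σ h, h), u h)))) =O[𝓝[>] 0] fun h => h ^ (n + 1))
    (hprev : (fun h => (prevStep (nodeData ((σ h, h), u h))).1.2.2.2
      - l (prevStep (nodeData ((σ h, h), u h)))) =O[𝓝[>] 0] fun h => h ^ (n + 1)) :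
    (fun h => momentumEnd l (prevStep (nodeData ((σ h, h), u h)))
      - momentumStart l (nextStep (nodeData ((σ h, h), u h)))) =O[𝓝[>] 0] fun h => h ^ n := by
  have : CompleteSpace E := FiniteDimensional.complete ℝ E
  have hlim : nodeData (limitNode Lag f m) = ((nodeData (limitNode Lag f m)).1, 0) := rfl
  obtain ⟨H, hH, hHeq, hH0⟩ := hl.exists_stepDifference hU hLag
    (p := (nodeData (limitNode Lag f m)).1) hm
  have hid : Tendsto (fun h : ℝ => h) (𝓝[>] 0) (𝓝 0) := tendsto_id.mono_left nhdsWithin_le_nhds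
  have hσh : Tendsto (fun h => (σ h, h)) (𝓝[>] 0) (𝓝 (limitNode Lag f m).1) := hσ.prodMk_nhds hid
  have hr : Tendsto (fun h => ((σ h, h), u h)) (𝓝[>] 0) (𝓝 (limitNode Lag f m)) :=
    hσh.prodMk_nhds hu
  have hs : Tendsto (fun h => nodeData ((σ h, h), u h)) (𝓝[>] 0)
      (𝓝 (nodeData (limitNode Lag f m))) := (contDiff_nodeData.continuous.tendsto _).comp hr
  have hpow : (fun h : ℝ => h ^ (n + 1)) =O[𝓝[>] 0] fun h => h ^ n := by
    have := (isBigO_refl (fun h : ℝ => h ^ n) (𝓝[>] 0)).mul (hid.isBigO_one ℝ)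
    simpa [pow_succ] using this
  have hdefect : (fun h => nodeEquation l q H ((σ h, h), u h)) =O[𝓝[>] 0] fun h => h ^ n := by
    refine (hacc.trans hpow).prod_left (IsBigO.prod_left ?_ ?_)
    · refine (((hnext.trans hpow).add (hprev.trans hpow)).const_mul_left (1 / 2)).congr_left
        fun h => ?_
      simp only [nextStep, prevStep, nodeData]
      ring
    · -- the difference of the two evolution equations is divided by `h`
      have := (isBigO_refl (fun h : ℝ => h⁻¹) (𝓝[>] 0)).mul (hnext.sub hprev)
      refine (this.congr' ?_ ?_)
      · filter_upwards [hs.eventually hHeq, self_mem_nhdsWithin] with h k1 k2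
        have k2' : h ≠ 0 := (Set.mem_Ioi.1 k2).ne'
        have k3 : H (nodeData ((σ h, h), u h)) = h⁻¹ * (l (nextStep (nodeData ((σ h, h), u h)))
            - l (prevStep (nodeData ((σ h, h), u h)))) := by
          rw [k1, show (nodeData ((σ h, h), u h)).2 = h from rfl, inv_mul_cancel_left₀ k2']
        rw [k3]
        simp only [nextStep, prevStep, nodeData]
        field_simp
        ring
      · filter_upwards [self_mem_nhdsWithin] with h k2
        have k2' : h ≠ 0 := (Set.mem_Ioi.1 k2).ne'
        rw [pow_succ']
        exact inv_mul_cancel_left₀ k2' _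
  have hQ0 : ((m.1, m.2.1, m.2.2, Lag m), (0 : ℝ)) ∈ W := hl.mem _ hm _ _ _
  have hw0 : quotW l ((m.1, m.2.1, m.2.2, Lag m), 0) = 0 := hl.quotW_zero hm _ _ _
  have sl := hl.smoothNear hQ0
  have en : nextStep (nodeData (limitNode Lag f m)) = ((m.1, m.2.1, m.2.2, Lag m), 0) := by
    rw [hlim, nextStep_zero]
    rfl
  have ep : prevStep (nodeData (limitNode Lag f m)) = ((m.1, m.2.1, m.2.2, Lag m), 0) := by
    rw [hlim, prevStep_zero]
    rfl
  have s1 : SmoothNear (fun r => momentumEnd l (prevStep (nodeData r))) (limitNode Lag f m) :=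
    SmoothNear.comp_nodeData (g := fun s => momentumEnd l (prevStep s))
      (SmoothNear.comp (f := prevStep) (by rw [ep]; exact sl.momentumEnd (by simp [hw0]))
        (contDiff_prevStep.smoothNear _))
  have s2 : SmoothNear (fun r => momentumStart l (nextStep (nodeData r))) (limitNode Lag f m) :=
    SmoothNear.comp_nodeData (g := fun s => momentumStart l (nextStep s))
      (SmoothNear.comp (f := nextStep) (by rw [en]; exact sl.momentumStart (by simp [hw0]))
        (contDiff_nextStep.smoothNear _))
  have hzero : nodeEquation l q H (limitNode Lag f m) = 0 := by
    have e1 : q (nodeData (limitNode Lag f m)) = f m := hq.apply_zero hF hU hLag hm (f m)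
    have e2 : l ((m.1, m.2.1, m.2.2, Lag m), 0) = Lag m := hl.zero _ hm _ _ _
    have e3 : H (nodeData (limitNode Lag f m)) = fderiv ℝ Lag m (m.2.1, f m, Lag m) :=
      hH0.self_of_nhds
    unfold nodeEquation
    rw [e1, en, ep, e2, e3]
    simp [limitNode]
  exact (isBigO_of_forall_eq_zero (g := nodeEquation l q H)
    (μ := fun r => momentumEnd l (prevStep (nodeData r)) - momentumStart l (nextStep (nodeData r)))
    (smoothNear_nodeEquation hl hq hm hH) hzero
    (isInvertible_fderiv_nodeEquation hl hq hF hU hLag hm hH hH0) (s1.sub s2) hσh hu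
    (fun p => 0 < p.2) self_mem_nhdsWithin
    (momentumEnd_sub_momentumStart_eq_zero hl hq hF hm hHeq)).trans hdefect

end MomentumDefect

/-! ### The residual of the truncated modified equations -/

section Modified

variable {E : Type*} [NormedAddCommGroup E] [NormedSpace ℝ E]
  {U : Set E} {Lag : E × E × ℝ → ℝ} {f : E × E × ℝ → E} {L : E → E → ℝ → ℝ → ℝ → ℝ}
  {F : E → E → E → ℝ → ℝ → ℝ → ℝ → E} {Lmod : ℕ → E × E × ℝ → ℝ} {fmod : ℕ → E × E × ℝ → E}
  {m m₀ : E × E × ℝ}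

/-- The truncation as a function of the point and the step size jointly. -/
def jointTruncation {G : Type*} [AddCommGroup G] [Module ℝ G] (c : ℕ → E × E × ℝ → G) (k : ℕ)
    (y : (E × E × ℝ) × ℝ) : G := truncation c k y.2 y.1

lemma smoothNear_jointTruncation {G : Type*} [NormedAddCommGroup G] [NormedSpace ℝ G]
    {c : ℕ → E × E × ℝ → G} (hc : ∀ i, ContDiffOn ℝ ∞ (c i) (phase U)) (hU : IsOpen U)
    (hm : m ∈ phase U) (k : ℕ) (h : ℝ) : SmoothNear (jointTruncation c k) (m, h) := by
  unfold jointTruncation truncation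
  refine SmoothNear.sum fun i _ => ?_
  have h1 : SmoothNear (fun y : (E × E × ℝ) × ℝ => c i y.1) (m, h) :=
    SmoothNear.comp (f := fun y : (E × E × ℝ) × ℝ => y.1) ((hc i).smoothNear_phase hU hm)
      (by fun_prop)
  exact SmoothNear.smul (by fun_prop) h1

omit [NormedAddCommGroup E] [NormedSpace ℝ E] in
lemma truncation_zero {G : Type*} [AddCommGroup G] [Module ℝ G] (c : ℕ → E × E × ℝ → G) (k : ℕ)
    (m : E × E × ℝ) : truncation c k 0 m = c 0 m := by
  rw [truncation, Finset.sum_range_succ', Finset.sum_eq_zero (by intro i _; simp)]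
  simp

/-- The vector field of the modified equations truncated after order `h^k`. -/
def modField (Lmod : ℕ → E × E × ℝ → ℝ) (fmod : ℕ → E × E × ℝ → E) (k : ℕ) :
    (E × E × ℝ) × ℝ → E × E × ℝ :=
  secondOrderField (jointTruncation fmod k) (jointTruncation Lmod k)

lemma IsModifiedSystem.modField_zero (hmod : IsModifiedSystem U Lag f L F Lmod fmod)
    (hm : m ∈ phase U) (k : ℕ) : modField Lmod fmod k (m, 0) = (m.2.1, f m, Lag m) := by
  simp only [modField, secondOrderField, jointTruncation, truncation_zero, hmod.leading_L m hm,
    hmod.leading_f m hm]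

lemma IsModifiedSystem.fderiv_jointTruncation_zero (hmod : IsModifiedSystem U Lag f L F Lmod fmod)
    (hU : IsOpen U) (hm : m ∈ phase U) (k : ℕ) (ξ : E × E × ℝ) :
    fderiv ℝ (jointTruncation Lmod k) (m, 0) (ξ, 0) = fderiv ℝ Lag m ξ := by
  have h1 := hasFDerivAt_slice
    (smoothNear_jointTruncation hmod.smooth_L hU hm k 0).differentiableAt
  have h2 : Lag =ᶠ[𝓝 m] fun m => jointTruncation Lmod k (m, 0) := by
    filter_upwards [(hU.preimage continuous_fst).mem_nhds hm] with m' hm'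
    simp only [jointTruncation, truncation_zero, hmod.leading_L m' hm']
  rw [(HasFDerivAt.congr_of_eventuallyEq h1 h2).fderiv]
  rfl

variable {Φ : ℝ × ((E × E × ℝ) × ℝ) → E × E × ℝ} {k : ℕ}

/-- The defect estimates of the modified system, along its flow. -/
lemma IsModifiedSystem.defect_flow (hmod : IsModifiedSystem U Lag f L F Lmod fmod) (hU : IsOpen U)
    (hΦ : IsLocalFlow (modField Lmod fmod k) Φ (m, 0)) (hm : m ∈ phase U) :
    ((fun h : ℝ => ((Φ (h, (m, h))).2.2 - m.2.2) / h
        - L m.1 (Φ (h, (m, h))).1 m.2.2 (Φ (h, (m, h))).2.2 h)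
      =O[𝓝[>] 0] (fun h : ℝ => h ^ (k + 1))) ∧
    ((fun h : ℝ => secondDifference (Φ (-h, (m, h))).1 m.1 (Φ (h, (m, h))).1 h
        - F (Φ (-h, (m, h))).1 m.1 (Φ (h, (m, h))).1 (Φ (-h, (m, h))).2.2 m.2.2
          (Φ (h, (m, h))).2.2 h)
      =O[𝓝[>] 0] (fun h : ℝ => h ^ (k + 1))) := by
  have hΦ0 : Φ (0, (m, 0)) = m := hΦ.zero.self_of_nhds
  have hUΦ : ∀ᶠ p in 𝓝 ((0 : ℝ), (m, (0 : ℝ))), (Φ p).1 ∈ U :=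
    hΦ.smooth.fst.continuousAt.eventually (hU.mem_nhds (by simp only [hΦ0]; exact hm))
  have hc : ContinuousAt (fun h : ℝ => (m, h)) 0 := by fun_prop
  have hzero : ∀ᶠ h : ℝ in 𝓝 0, Φ (0, (m, h)) = m := hc.eventually hΦ.zero
  have hc2 : Tendsto (fun p : ℝ × ℝ => (p.1, (m, p.2))) (𝓝 (0, 0)) (𝓝 (0, (m, 0))) :=
    Continuous.tendsto' (by fun_prop) _ _ rfl
  obtain ⟨δ, hδ, hball⟩ := Metric.eventually_nhds_iff_ball.1
    ((hc2.eventually (hΦ.eventually_jet_eq.and hUΦ)).and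
      ((continuous_snd.tendsto ((0 : ℝ), (0 : ℝ))).eventually hzero))
  have key := hmod.defect k m hm δ (fun h t => (Φ (t, (m, h))).1) (fun h t => (Φ (t, (m, h))).2.2)
    hδ fun h hh => by
      have hmem : ∀ t ∈ Set.Ioo (-δ) δ, (t, h) ∈ Metric.ball ((0 : ℝ), (0 : ℝ)) δ := by
        intro t ht
        rw [Metric.mem_ball, Prod.dist_eq]
        exact max_lt (by simpa using abs_lt.2 ht) (by simpa [abs_of_pos hh.1] using hh.2)
      constructor
      · have h1 := hball _ (hmem 0 ⟨by linarith, hδ⟩)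
        exact h1.1.1.1.trans h1.2
      · intro t ht
        obtain ⟨⟨⟨k1, k2, k3, k4⟩, k5⟩, -⟩ := hball _ (hmem t ht)
        refine ⟨k5, ?_, ?_, ?_⟩
        · rw [k1]
          exact k2
        · rw [k3.deriv]
          exact k3
        · rw [k1]
          exact k4
  have hz : ∀ᶠ h : ℝ in 𝓝[>] 0, Φ (0, (m, h)) = m := nhdsWithin_le_nhds hzero
  refine ⟨key.1.congr' ?_ EventuallyEq.rfl, key.2.congr' ?_ EventuallyEq.rfl⟩
  · filter_upwards [hz] with h hh
    rw [hh]
  · filter_upwards [hz] with h hh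
    rw [hh]

lemma quotientPoint_flow {Ψ : ((E × E × ℝ) × ℝ) × ℝ → E × E × ℝ} {m m' : E × E × ℝ} {h : ℝ}
    (h0 : h ≠ 0) (hm' : m' = m + h • Ψ ((m, h), h)) :
    quotientPoint m.1 m'.1 m.2.2 m'.2.2 h = stepPoint Ψ (m, h) := by
  subst hm'
  simp [quotientPoint, stepPoint, inv_smul_smul₀ h0, inv_mul_cancel_left₀ h0]

variable [FiniteDimensional ℝ E]

/-- The Euler-Lagrange equations of the modified Lagrangian truncated after order `h^(n+1)` hold
along the equally truncated modified equations up to `O(hⁿ)`. -/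
theorem IsModifiedSystem.residual_isBigO (hmod : IsModifiedSystem U Lag f L F Lmod fmod)
    (hU : IsOpen U) (hLag : ContDiffOn ℝ ∞ Lag (phase U))
    (hL : IsConsistentDiscretization U Lag L) (hF : IsSecondOrderForm U Lag f L F)
    (hm₀ : m₀ ∈ phase U) (n : ℕ) :
    (fun h : ℝ => residual (jointTruncation Lmod (n + 1)) (modField Lmod fmod (n + 1)) (m₀, h))
      =O[𝓝[>] 0] fun h => h ^ n := by
  obtain ⟨W, l, hl⟩ := hL.exists_isQuotientForm
  obtain ⟨q, hq⟩ := hF.exists_isAccelerationForm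
  have sφ := fun {m} (hm : m ∈ phase U) =>
    smoothNear_jointTruncation hmod.smooth_f hU hm (n + 1) 0
  have sΛ := fun {m} (hm : m ∈ phase U) =>
    smoothNear_jointTruncation hmod.smooth_L hU hm (n + 1) 0
  obtain ⟨Φ, hΦ⟩ := exists_localFlow ((sφ hm₀).secondOrderField (sΛ hm₀))
  obtain ⟨Ψ, hΨ, hΦΨ, hΨ0⟩ := hΦ.exists_quotient
  have hphase : ∀ᶠ m in 𝓝 m₀, m ∈ phase U := (hU.preimage continuous_fst).mem_nhds hm₀
  have hm : ContinuousAt (fun m : E × E × ℝ => (m, (0 : ℝ))) m₀ := by fun_prop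
  have hm' : ContinuousAt (fun m : E × E × ℝ => ((m, (0 : ℝ)), (0 : ℝ))) m₀ := by fun_prop
  have hstep0 : ∀ᶠ m in 𝓝 m₀, m ∈ phase U ∧
      stepPoint Ψ (m, 0) = ((m.1, m.2.1, m.2.2, Lag m), 0) := by
    filter_upwards [hm.eventually hΨ0, hphase] with m k1 k2
    refine ⟨k2, ?_⟩
    have := hmod.modField_zero k2 (n + 1)
    rw [modField] at this
    rw [this] at k1
    rw [stepPoint, k1]
  have hQ0 := hstep0.self_of_nhds.2
  have hlQ : SmoothNear l (stepPoint Ψ (m₀, 0)) := by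
    rw [hQ0]
    exact hl.smoothNear (hl.mem _ hm₀ _ _ _)
  have hid : Tendsto (fun h : ℝ => h) (𝓝[>] 0) (𝓝 0) := tendsto_id.mono_left nhdsWithin_le_nhds
  -- the defect of the discrete evolution of the action
  have hd : ∀ᶠ m in 𝓝 m₀, (fun h : ℝ => (Ψ ((m, h), h)).2.2 - l (stepPoint Ψ (m, h)))
      =O[𝓝[>] 0] fun h => h ^ (n + 1 + 1) := by
    filter_upwards [hm.eventually hΦ.eventually, hm'.eventually hΨ.eventually,
      hm'.eventually hΦΨ.eventually_nhds, hstep0] with m k1 k2 k3 k4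
    have ht : Tendsto (fun h : ℝ => (m, h)) (𝓝[>] 0) (𝓝 (m, 0)) :=
      tendsto_const_nhds.prodMk_nhds hid
    have ht2 : Tendsto (fun h : ℝ => ((m, h), h)) (𝓝[>] 0) (𝓝 ((m, 0), 0)) := ht.prodMk_nhds hid
    have hW : ∀ᶠ h in 𝓝[>] (0 : ℝ), stepPoint Ψ (m, h) ∈ W :=
      (k2.stepPoint.continuousAt.tendsto.comp ht).eventually
        (hl.isOpen.mem_nhds (by rw [k4.2]; exact hl.mem _ k4.1 _ _ _))
    refine (hmod.defect_flow hU k1 k4.1).1.congr' ?_ EventuallyEq.rfl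
    filter_upwards [ht2.eventually k3, hW, self_mem_nhdsWithin] with h e1 e2 e3
    have e3' : 0 < h := e3
    have e4 := quotientPoint_flow e3'.ne' e1
    rw [hl.eq _ _ _ _ _ e3' (by rw [e4]; exact e2), e4, e1]
    simp only [Prod.snd_add, Prod.smul_snd, smul_eq_mul, add_sub_cancel_left]
    rw [mul_div_cancel_left₀ _ e3'.ne']
  -- its bound is uniform, so that it holds along convergent initial points
  have hsd : SmoothNear (fun y : (E × E × ℝ) × ℝ => (Ψ (y, y.2)).2.2 - l (stepPoint Ψ y))
      (m₀, 0) := by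
    have h1 : SmoothNear (fun y : (E × E × ℝ) × ℝ => Ψ (y, y.2)) (m₀, 0) :=
      SmoothNear.comp (f := fun y : (E × E × ℝ) × ℝ => (y, y.2)) hΨ (by fun_prop)
    exact h1.snd.snd.sub (SmoothNear.comp (f := stepPoint Ψ) hlQ hΨ.stepPoint)
  obtain ⟨e, he, heq⟩ := hsd.exists_eq_pow_smul (n + 1 + 1) hd
  have hdO : (fun y : (E × E × ℝ) × ℝ => (Ψ (y, y.2)).2.2 - l (stepPoint Ψ y))
      =O[𝓝 (m₀, 0)] fun y => y.2 ^ (n + 1 + 1) :=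
    (he.pow_smul_isBigO (n + 1 + 1)).congr' (heq.mono fun y hy => hy.symm) EventuallyEq.rfl
  have hdO' : ∀ᶠ m in 𝓝 m₀, (fun y : (E × E × ℝ) × ℝ => (Ψ (y, y.2)).2.2 - l (stepPoint Ψ y))
      =O[𝓝 (m, 0)] fun y => y.2 ^ (n + 1 + 1) := by
    obtain ⟨C, hC⟩ := hdO.bound
    filter_upwards [hm.eventually hC.eventually_nhds] with m hmC
    exact IsBigO.of_bound C hmC
  refine hΦ.residual_isBigO_of_defect (sφ hm₀) (sΛ hm₀) hΨ hΦΨ hlQ ?_ (hd.mono fun m hm => ?_) ?_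
  · filter_upwards [hstep0] with m k
    rw [k.2]
    exact hl.quotW_zero k.1 _ _ _
  · refine hm.trans ?_
    have := (isBigO_refl (fun h : ℝ => h ^ (n + 1)) (𝓝[>] 0)).mul (hid.isBigO_one ℝ)
    simpa [pow_succ _ (n + 1)] using this
  filter_upwards [hm.eventually hΦ.eventually, hm'.eventually hΦΨ.eventually_nhds, hstep0, hd, hdO']
    with m k1 k3 k4 k5 k6
  have ht : Tendsto (fun h : ℝ => (m, h)) (𝓝[>] 0) (𝓝 (m, 0)) :=
    tendsto_const_nhds.prodMk_nhds hid
  have ht2 : Tendsto (fun h : ℝ => ((m, h), h)) (𝓝[>] 0) (𝓝 ((m, 0), 0)) := ht.prodMk_nhds hid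
  have hneg : Tendsto (fun h : ℝ => -h) (𝓝[>] 0) (𝓝 0) := by simpa using hid.neg
  have hback : Tendsto (fun h : ℝ => (Φ (-h, (m, h)), h)) (𝓝[>] 0) (𝓝 (m, 0)) :=
    k1.tendsto hneg ht
  have hback2 : Tendsto (fun h : ℝ => ((Φ (-h, (m, h)), h), h)) (𝓝[>] 0) (𝓝 ((m, 0), 0)) :=
    hback.prodMk_nhds hid
  have sV : SmoothNear (modField Lmod fmod (n + 1)) (m, 0) :=
    (sφ k4.1).secondOrderField (sΛ k4.1)
  obtain ⟨B, A, hB, hA, hnode, hB0, hA0⟩ := k1.exists_node sV.differentiableAt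
  rw [← modField, hmod.modField_zero k4.1] at hB0 hA0
  rw [modField, fderiv_secondOrderField (sφ k4.1) (sΛ k4.1),
    hmod.fderiv_jointTruncation_zero hU k4.1] at hA0
  have hA01 : jointTruncation fmod (n + 1) (m, 0) = f m := by
    simp only [jointTruncation, truncation_zero, hmod.leading_f m k4.1]
  have cB : Tendsto (fun h : ℝ => B ((m, h), h)) (𝓝[>] 0) (𝓝 (m.2.1, f m, Lag m)) := by
    rw [← hB0]
    exact hB.continuousAt.tendsto.comp ht2
  have cA : Tendsto (fun h : ℝ => A ((m, h), h)) (𝓝[>] 0)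
      (𝓝 (f m, fderiv ℝ (jointTruncation fmod (n + 1)) (m, 0) ((m.2.1, f m, Lag m), 0),
        fderiv ℝ Lag m (m.2.1, f m, Lag m))) := by
    rw [← hA0]
    exact hA.continuousAt.tendsto.comp ht2
  let σ : ℝ → E × E × ℝ := fun h => (m.1, (B ((m, h), h)).1, m.2.2)
  let u : ℝ → E × ℝ × ℝ := fun h =>
    ((A ((m, h), h)).1, (B ((m, h), h)).2.2, (A ((m, h), h)).2.2)
  have hσ : Tendsto σ (𝓝[>] 0) (𝓝 m) :=
    tendsto_const_nhds.prodMk_nhds (((continuous_fst.tendsto _).comp cB).prodMk_nhds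
      tendsto_const_nhds)
  have hu : Tendsto u (𝓝[>] 0) (𝓝 (limitNode Lag f m).2) :=
    ((continuous_fst.tendsto _).comp cA).prodMk_nhds
      ((((continuous_snd.comp continuous_snd).tendsto _).comp cB).prodMk_nhds
        (((continuous_snd.comp continuous_snd).tendsto _).comp cA))
  have hnodes := ht2.eventually hnode
  -- the two steps of the flow through `m`, in terms of node data
  have hnext : ∀ᶠ h in 𝓝[>] (0 : ℝ),
      nextStep (nodeData ((σ h, h), u h)) = stepPoint Ψ (m, h) := by
    filter_upwards [hnodes, ht2.eventually k3, self_mem_nhdsWithin] with h e1 e2 e3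
    have e3' : h ≠ 0 := (Set.mem_Ioi.1 e3).ne'
    rw [← quotientPoint_node_right _ e3', ← quotientPoint_flow e3' e2, e1.1]
    rfl
  have hprev : ∀ᶠ h in 𝓝[>] (0 : ℝ),
      prevStep (nodeData ((σ h, h), u h)) = stepPoint Ψ (Φ (-h, (m, h)), h) := by
    have hadd : ∀ᶠ h in 𝓝[>] (0 : ℝ),
        Φ (-h + h, (m, h)) = Φ (h, (Φ (-h, (m, h)), h)) :=
      (hneg.prodMk_nhds (hid.prodMk_nhds ht)).eventually k1.add
    filter_upwards [hnodes, hback2.eventually k3, hadd, ht.eventually k1.zero, self_mem_nhdsWithin]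
      with h e1 e2 e4 e5 e3
    have e3' : h ≠ 0 := (Set.mem_Ioi.1 e3).ne'
    rw [neg_add_cancel, e5, e2] at e4
    rw [← quotientPoint_node_left _ e3', ← quotientPoint_flow e3' e4, e1.2]
    rfl
  have key := hl.momentum_isBigO hF hq hU hLag k4.1 hσ hu (n := n + 1) ?_ ?_ ?_
  · refine key.congr' ?_ EventuallyEq.rfl
    filter_upwards [hnext, hprev] with h e1 e2
    rw [e1, e2]
  · refine (hmod.defect_flow hU k1 k4.1).2.congr' ?_ EventuallyEq.rfl
    have hs : Tendsto (fun h => nodeData ((σ h, h), u h)) (𝓝[>] 0)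
        (𝓝 (nodeData (limitNode Lag f m))) :=
      (contDiff_nodeData.continuous.tendsto _).comp ((hσ.prodMk_nhds hid).prodMk_nhds hu)
    filter_upwards [hnodes, hs.eventually (hq.eq _ k4.1), self_mem_nhdsWithin] with h e1 e2 e3
    have e3' : h ≠ 0 := (Set.mem_Ioi.1 e3).ne'
    rw [← e2 e3, e1.1, e1.2]
    congr 1
    exact secondDifference_node _ _ _ e3'
  · refine k5.congr' ?_ EventuallyEq.rfl
    filter_upwards [hnext] with h e1
    rw [e1]
    rfl
  · refine (k6.comp_tendsto hback).congr' ?_ EventuallyEq.rfl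
    filter_upwards [hprev] with h e1
    rw [e1]
    rfl

end Modified

/-! ### Truncation of the residual -/

section TruncatedResidual

variable {E : Type*} [NormedAddCommGroup E] [NormedSpace ℝ E]

/-- Perturbations of order `h^p` commute with derivatives in directions that keep `h` fixed. -/
lemma fderiv_add_pow_smul {M G : Type*} [NormedAddCommGroup M] [NormedSpace ℝ M]
    [NormedAddCommGroup G] [NormedSpace ℝ G] {g e g' : M × ℝ → G} {y : M × ℝ}
    (hg : DifferentiableAt ℝ g y) (he : DifferentiableAt ℝ e y) {p : ℕ}
    (hg' : ∀ᶠ y' in 𝓝 y, g' y' = g y' + y'.2 ^ p • e y') (ξ : M) :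
    fderiv ℝ g' y (ξ, 0) = fderiv ℝ g y (ξ, 0) + y.2 ^ p • fderiv ℝ e y (ξ, 0) := by
  have h1 : HasFDerivAt (fun y : M × ℝ => y.2) (ContinuousLinearMap.snd ℝ M ℝ) y := hasFDerivAt_snd
  have h2 := hg.hasFDerivAt.add ((h1.pow p).smul he.hasFDerivAt)
  have h3 : HasFDerivAt g' _ y := h2.congr_of_eventuallyEq hg'
  rw [h3.fderiv]
  simp

variable {Λ Λ' T : (E × E × ℝ) × ℝ → ℝ} {φ φ' S : (E × E × ℝ) × ℝ → E} {y : (E × E × ℝ) × ℝ}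
  {m₀ : E × E × ℝ} {p : ℕ}

lemma momentum_add_pow_smul (hΛ : DifferentiableAt ℝ Λ y) (hT : DifferentiableAt ℝ T y)
    (h : ∀ᶠ y' in 𝓝 y, Λ' y' = Λ y' + y'.2 ^ p • T y') :
    momentum Λ' y = momentum Λ y + y.2 ^ p • momentum T y :=
  ContinuousLinearMap.ext fun a => fderiv_add_pow_smul hΛ hT h (0, a, 0)

/-- A perturbation of order `h^p` of the Lagrangian and of the vector field changes the residual by
`O(h^p)`. -/
lemma residual_sub_isBigO (hΛ : SmoothNear Λ (m₀, 0)) (hT : SmoothNear T (m₀, 0))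
    (hφ : SmoothNear φ (m₀, 0)) (hS : SmoothNear S (m₀, 0))
    (hΛ' : ∀ y, Λ' y = Λ y + y.2 ^ p • T y) (hφ' : ∀ y, φ' y = φ y + y.2 ^ p • S y) :
    (fun y => residual Λ' (secondOrderField φ' Λ') y - residual Λ (secondOrderField φ Λ) y)
      =O[𝓝 (m₀, 0)] fun y => y.2 ^ p := by
  have sΛ' : SmoothNear Λ' (m₀, 0) := by
    rw [show Λ' = fun y => Λ y + y.2 ^ p • T y from funext hΛ']
    fun_prop
  have sφ' : SmoothNear φ' (m₀, 0) := by
    rw [show φ' = fun y => φ y + y.2 ^ p • S y from funext hφ']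
    fun_prop
  have mΛ := hΛ.momentum
  have mΛ' := sΛ'.momentum
  have mT := hT.momentum
  let e : (E × E × ℝ) × ℝ → E →L[ℝ] ℝ := fun y =>
    (fderiv ℝ T y).comp (dirX E)
      - (fderiv ℝ (momentum Λ) y ((0, S y, T y), 0)
        + fderiv ℝ (momentum T) y ((y.1.2.1, φ' y, Λ' y), 0))
      + (fderiv ℝ T y ((0, 0, 1), 0) • momentum Λ' y
        + fderiv ℝ Λ y ((0, 0, 1), 0) • momentum T y)
  have he : SmoothNear e (m₀, 0) := by
    show SmoothNear (fun y => (fderiv ℝ T y).comp (dirX E)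
      - (fderiv ℝ (momentum Λ) y ((0, S y, T y), 0)
        + fderiv ℝ (momentum T) y ((y.1.2.1, φ' y, Λ' y), 0))
      + (fderiv ℝ T y ((0, 0, 1), 0) • momentum Λ' y
        + fderiv ℝ Λ y ((0, 0, 1), 0) • momentum T y)) (m₀, 0)
    fun_prop
  refine (he.pow_smul_isBigO p).congr' ?_ EventuallyEq.rfl
  have hmom : ∀ᶠ y in 𝓝 (m₀, (0 : ℝ)),
      momentum Λ' y = momentum Λ y + y.2 ^ p • momentum T y := by
    filter_upwards [hΛ, hT] with y k1 k2
    exact momentum_add_pow_smul (k1.differentiableAt (by simp)) (k2.differentiableAt (by simp))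
      (Eventually.of_forall hΛ')
  filter_upwards [hΛ, hT, mΛ, mT, hmom.eventually_nhds] with y k1 k2 k3 k4 k5
  have d := fun ξ => fderiv_add_pow_smul (k1.differentiableAt (by simp))
    (k2.differentiableAt (by simp)) (Eventually.of_forall hΛ') ξ
  have d' := fun ξ => fderiv_add_pow_smul (k3.differentiableAt (by simp))
    (k4.differentiableAt (by simp)) k5 ξ
  have hX : (fderiv ℝ Λ' y).comp (dirX E)
      = (fderiv ℝ Λ y).comp (dirX E) + y.2 ^ p • (fderiv ℝ T y).comp (dirX E) :=
    ContinuousLinearMap.ext fun a => d (a, 0, 0)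
  have hV : ((y.1.2.1, φ' y, Λ' y) : E × E × ℝ)
      = (y.1.2.1, φ y, Λ y) + y.2 ^ p • (0, S y, T y) := by
    rw [hφ', hΛ']
    simp
  have hV2 : fderiv ℝ (momentum Λ) y ((y.1.2.1, φ' y, Λ' y), 0)
      = fderiv ℝ (momentum Λ) y ((y.1.2.1, φ y, Λ y), 0)
        + y.2 ^ p • fderiv ℝ (momentum Λ) y ((0, S y, T y), 0) := by
    rw [hV, ← map_smul, ← map_add]
    simp
  simp only [residual, secondOrderField, e]
  rw [hX, d', hV2, d, k5.self_of_nhds]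
  module

end TruncatedResidual

/-! ### Explicit form of the generalized Euler-Lagrange equations -/

section Explicit

variable {E : Type*} [NormedAddCommGroup E] [NormedSpace ℝ E]
  {Λ : (E × E × ℝ) × ℝ → ℝ} {φ : (E × E × ℝ) × ℝ → E} {m : E × E × ℝ} {h : ℝ}

/-- The Hessian `∂²Λ/∂ẋ²`. -/
def hessian (Λ : (E × E × ℝ) × ℝ → ℝ) (y : (E × E × ℝ) × ℝ) : E →L[ℝ] E →L[ℝ] ℝ :=
  (fderiv ℝ (momentum Λ) y).comp (dirV E)

/-- The terms of the generalized Euler-Lagrange equations that do not contain the acceleration. -/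
def force (Λ : (E × E × ℝ) × ℝ → ℝ) (y : (E × E × ℝ) × ℝ) : E →L[ℝ] ℝ :=
  residual Λ (secondOrderField 0 Λ) y

/-- The acceleration solved from the generalized Euler-Lagrange equations. It is zero where the Hessian
is not invertible. -/
def eulerLagrangeAcceleration (Λ : (E × E × ℝ) × ℝ → ℝ) (y : (E × E × ℝ) × ℝ) : E :=
  (hessian Λ y).inverse (force Λ y)

lemma residual_eq_force_sub (Λ : (E × E × ℝ) × ℝ → ℝ) (φ : (E × E × ℝ) × ℝ → E)
    (y : (E × E × ℝ) × ℝ) :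
    residual Λ (secondOrderField φ Λ) y = force Λ y - hessian Λ y (φ y) := by
  have h1 : fderiv ℝ (momentum Λ) y (secondOrderField φ Λ y, 0)
      = fderiv ℝ (momentum Λ) y (secondOrderField 0 Λ y, 0) + hessian Λ y (φ y) := by
    rw [hessian, ContinuousLinearMap.comp_apply, dirV_apply, ← map_add]
    simp [secondOrderField]
  rw [force, residual, residual, h1]
  abel

lemma eulerLagrangeAcceleration_sub {y : (E × E × ℝ) × ℝ} (hy : (hessian Λ y).IsInvertible) :
    eulerLagrangeAcceleration Λ y - φ y
      = (hessian Λ y).inverse (residual Λ (secondOrderField φ Λ) y) := by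
  rw [residual_eq_force_sub, map_sub, hy.inverse_apply_self, eulerLagrangeAcceleration]

lemma hasFDerivAt_dirX (m : E × E × ℝ) (h : ℝ) :
    HasFDerivAt (fun x : E => (((x, m.2.1, m.2.2), h) : (E × E × ℝ) × ℝ)) (dirX E) m.1 :=
  HasFDerivAt.comp (f := fun x : E => (x, m.2)) (g := fun p : E × E × ℝ => (p, h)) m.1
    (hasFDerivAt_prodMk_left m h) (hasFDerivAt_prodMk_left m.1 m.2)

lemma hasFDerivAt_dirV (m : E × E × ℝ) (h : ℝ) :
    HasFDerivAt (fun w : E => (((m.1, w, m.2.2), h) : (E × E × ℝ) × ℝ)) (dirV E) m.2.1 :=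
  HasFDerivAt.comp (f := fun w : E => (m.1, w, m.2.2)) (g := fun p : E × E × ℝ => (p, h)) m.2.1
    (hasFDerivAt_prodMk_left m h)
    (HasFDerivAt.comp (f := fun w : E => (w, m.2.2)) (g := fun p : E × ℝ => (m.1, p)) m.2.1
      (hasFDerivAt_prodMk_right m.1 m.2) (hasFDerivAt_prodMk_left m.2.1 m.2.2))

lemma partialV_eq_momentum (hΛ : DifferentiableAt ℝ Λ (m, h)) :
    partialV (fun m => Λ (m, h)) m = momentum Λ (m, h) := by
  have h1 := hasFDerivAt_dirV m h
  exact (HasFDerivAt.comp m.2.1 (g := Λ) hΛ.hasFDerivAt h1).fderiv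

lemma partialX_eq (hΛ : DifferentiableAt ℝ Λ (m, h)) :
    partialX (fun m => Λ (m, h)) m = (fderiv ℝ Λ (m, h)).comp (dirX E) := by
  have h1 := hasFDerivAt_dirX m h
  exact (HasFDerivAt.comp m.1 (g := Λ) hΛ.hasFDerivAt h1).fderiv

lemma partialZ_eq (hΛ : DifferentiableAt ℝ Λ (m, h)) :
    partialZ (fun m => Λ (m, h)) m = fderiv ℝ Λ (m, h) ((0, 0, 1), 0) := by
  have h1 : HasDerivAt (fun s : ℝ => (((m.1, m.2.1, s), h) : (E × E × ℝ) × ℝ)) ((0, 0, 1), 0)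
      m.2.2 :=
    ((hasDerivAt_const _ m.1).prodMk ((hasDerivAt_const _ m.2.1).prodMk
      (hasDerivAt_id m.2.2))).prodMk (hasDerivAt_const _ h)
  exact (HasFDerivAt.comp_hasDerivAt m.2.2 (l := Λ) hΛ.hasFDerivAt h1).deriv

lemma fderiv_partialV_eq_hessian (hΛ : SmoothNear Λ (m, h)) :
    fderiv ℝ (fun w => partialV (fun m => Λ (m, h)) (m.1, w, m.2.2)) m.2.1
      = hessian Λ (m, h) := by
  have h1 := hasFDerivAt_dirV m h
  have h2 := HasFDerivAt.comp m.2.1 (g := momentum Λ) hΛ.momentum.differentiableAt.hasFDerivAt h1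
  refine (h2.congr_of_eventuallyEq ?_).fderiv
  filter_upwards [h1.continuousAt.eventually hΛ] with w hw
  exact partialV_eq_momentum (hw.differentiableAt (by simp))

/-- Along a curve with `ż = Λ(·; h)`, the generalized Euler-Lagrange equations say that the
acceleration is `eulerLagrangeAcceleration`. -/
lemma hasGeneralizedEL_eulerLagrangeAcceleration {S : Set (E × E × ℝ)}
    (hΛ : ∀ m ∈ S, SmoothNear Λ (m, h)) (hreg : ∀ m ∈ S, (hessian Λ (m, h)).IsInvertible) :
    HasGeneralizedEL S (fun m => Λ (m, h)) (fun m => eulerLagrangeAcceleration Λ (m, h)) := by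
  intro x z t hx hz hm
  have hx1 : HasDerivAt x (deriv x t) t := (hx.differentiableAt (by simp)).hasDerivAt
  have hx2 : HasDerivAt (deriv x) (deriv (deriv x) t) t := by
    have h1 : ContDiffAt ℝ 1 (deriv x) t := by
      have h2 : ContDiffAt ℝ 1 (fderiv ℝ x) t := hx.fderiv_right (by norm_num)
      exact h2.clm_apply contDiffAt_const
    exact (h1.differentiableAt (by simp)).hasDerivAt
  have hjet : HasDerivAt (fun s => (jet x z s, h))
      (((jet x z t).2.1, deriv (deriv x) t, Λ (jet x z t, h)), 0) t :=
    (hx1.prodMk (hx2.prodMk hz.self_of_nhds)).prodMk (hasDerivAt_const t h)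
  have sΛ := hΛ _ hm
  have hdΛ := sΛ.differentiableAt
  have hd : HasDerivAt (fun s => partialV (fun m => Λ (m, h)) (jet x z s))
      (fderiv ℝ (momentum Λ) (jet x z t, h)
        (((jet x z t).2.1, deriv (deriv x) t, Λ (jet x z t, h)), 0)) t := by
    have h1 := HasFDerivAt.comp_hasDerivAt t (l := momentum Λ)
      sΛ.momentum.differentiableAt.hasFDerivAt hjet
    refine h1.congr_of_eventuallyEq ?_
    filter_upwards [hjet.continuousAt.eventually sΛ] with s hs
    exact partialV_eq_momentum (hs.differentiableAt (by simp))
  have hres := residual_eq_force_sub Λ (fun _ => deriv (deriv x) t) (jet x z t, h)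
  rw [GeneralizedEL, hd.deriv, partialX_eq hdΛ, partialV_eq_momentum hdΛ, partialZ_eq hdΛ]
  change residual Λ (secondOrderField (fun _ => deriv (deriv x) t) Λ) (jet x z t, h) = 0 ↔
    deriv (deriv x) t = (hessian Λ (jet x z t, h)).inverse (force Λ (jet x z t, h))
  rw [hres, sub_eq_zero]
  obtain ⟨A, hA⟩ := hreg _ hm
  rw [← hA, ContinuousLinearMap.inverse_equiv]
  constructor
  · intro hf
    rw [hf]
    simp
  · intro hf
    rw [hf]
    simp

end Explicit

/-! ### Order of accuracy of the truncated modified Lagrangian -/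

section Main

variable {E : Type*} [NormedAddCommGroup E] [NormedSpace ℝ E]
  {U : Set E} {Lag : E × E × ℝ → ℝ} {f : E × E × ℝ → E} {L : E → E → ℝ → ℝ → ℝ → ℝ}
  {F : E → E → E → ℝ → ℝ → ℝ → ℝ → E} {Lmod : ℕ → E × E × ℝ → ℝ} {fmod : ℕ → E × E × ℝ → E}
  {m m₀ : E × E × ℝ}

omit [NormedAddCommGroup E] [NormedSpace ℝ E] in
lemma jointTruncation_add {G : Type*} [AddCommGroup G] [Module ℝ G] (c : ℕ → E × E × ℝ → G)
    (k n : ℕ) (y : (E × E × ℝ) × ℝ) : jointTruncation c (k + (n + 1)) y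
      = jointTruncation c k y + y.2 ^ (k + 1) • jointTruncation (fun i => c (k + 1 + i)) n y := by
  rw [jointTruncation, truncation, show k + (n + 1) + 1 = (k + 1) + (n + 1) by ring,
    Finset.sum_range_add, jointTruncation, truncation, jointTruncation, truncation,
    Finset.smul_sum]
  simp only [pow_add, mul_smul]

variable [FiniteDimensional ℝ E]

/-- The residual is `O(h^(k+1))` for the truncation after order `h^(k+2)`, and the truncation after
order `h^k` differs from it by terms of order `h^(k+1)`. -/
lemma IsModifiedSystem.residual_truncation_isBigO (hmod : IsModifiedSystem U Lag f L F Lmod fmod)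
    (hU : IsOpen U) (hLag : ContDiffOn ℝ ∞ Lag (phase U))
    (hL : IsConsistentDiscretization U Lag L) (hF : IsSecondOrderForm U Lag f L F)
    (hm₀ : m₀ ∈ phase U) (k : ℕ) :
    (fun h : ℝ => residual (jointTruncation Lmod k) (modField Lmod fmod k) (m₀, h))
      =O[𝓝[>] 0] fun h => h ^ (k + 1) := by
  have h1 := hmod.residual_isBigO hU hLag hL hF hm₀ (k + 1)
  have h2 := residual_sub_isBigO
    (smoothNear_jointTruncation hmod.smooth_L hU hm₀ k 0)
    (smoothNear_jointTruncation (fun i => hmod.smooth_L (k + 1 + i)) hU hm₀ 1 0)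
    (smoothNear_jointTruncation hmod.smooth_f hU hm₀ k 0)
    (smoothNear_jointTruncation (fun i => hmod.smooth_f (k + 1 + i)) hU hm₀ 1 0)
    (jointTruncation_add Lmod k 1) (jointTruncation_add fmod k 1)
  have ht : Tendsto (fun h : ℝ => (m₀, h)) (𝓝[>] 0) (𝓝 (m₀, 0)) :=
    (Continuous.tendsto' (by fun_prop) _ _ rfl).mono_left nhdsWithin_le_nhds
  refine (h1.sub (h2.comp_tendsto ht)).congr_left fun h => ?_
  simp only [Function.comp, modField]
  abel

/-- At `h = 0` the truncated modified Lagrangian is regular, because it is `ℒ` there. -/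
lemma IsModifiedSystem.hessian_isInvertible (hmod : IsModifiedSystem U Lag f L F Lmod fmod)
    (hU : IsOpen U) (hreg : IsRegularOn (phase U) Lag) (hm : m ∈ phase U) (k : ℕ) :
    (hessian (jointTruncation Lmod k) (m, 0)).IsInvertible := by
  have : CompleteSpace E := FiniteDimensional.complete ℝ E
  have hs := smoothNear_jointTruncation hmod.smooth_L hU hm k 0
  rw [← fderiv_partialV_eq_hessian hs]
  have h1 : (fun w => partialV (fun m => jointTruncation Lmod k (m, 0)) (m.1, w, m.2.2))
      = fun w => partialV Lag (m.1, w, m.2.2) := by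
    funext w
    have : (fun w' => jointTruncation Lmod k ((m.1, w', m.2.2), 0))
        = fun w' => Lag (m.1, w', m.2.2) := by
      funext w'
      rw [jointTruncation, truncation_zero]
      exact hmod.leading_L _ hm
    simp only [partialV, this]
  rw [h1]
  have hb := hreg m hm
  exact ⟨ContinuousLinearEquiv.ofBijective _ (LinearMap.ker_eq_bot.2 hb.1)
    (LinearMap.range_eq_top.2 hb.2), by ext; rfl⟩

/-- Near each point of the phase space and for small step sizes, the truncated modified Lagrangian
is regular and its Euler-Lagrange acceleration is the truncated `f_mod` up to `O(h^(k+1))`. -/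
lemma IsModifiedSystem.acceleration_sub_isBigO (hmod : IsModifiedSystem U Lag f L F Lmod fmod)
    (hU : IsOpen U) (hLag : ContDiffOn ℝ ∞ Lag (phase U)) (hreg : IsRegularOn (phase U) Lag)
    (hL : IsConsistentDiscretization U Lag L) (hF : IsSecondOrderForm U Lag f L F)
    (hm₀ : m₀ ∈ phase U) (k : ℕ) :
    (∀ᶠ y in 𝓝 (m₀, (0 : ℝ)), (hessian (jointTruncation Lmod k) y).IsInvertible) ∧
    (fun y => eulerLagrangeAcceleration (jointTruncation Lmod k) y - jointTruncation fmod k y)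
      =O[𝓝 (m₀, (0 : ℝ))] fun y => y.2 ^ (k + 1) := by
  have : CompleteSpace E := FiniteDimensional.complete ℝ E
  have sΛ := smoothNear_jointTruncation hmod.smooth_L hU hm₀ k 0
  have sφ := smoothNear_jointTruncation hmod.smooth_f hU hm₀ k 0
  have hinv := hmod.hessian_isInvertible hU hreg hm₀ k
  have hcont : ContinuousAt (hessian (jointTruncation Lmod k)) (m₀, 0) := by
    have h1 := sΛ.momentum.fderiv
    have h2 : SmoothNear (fun y => (fderiv ℝ (momentum (jointTruncation Lmod k)) y).comp (dirV E))
        (m₀, 0) := by fun_prop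
    exact h2.continuousAt
  have hev : ∀ᶠ y in 𝓝 (m₀, (0 : ℝ)), (hessian (jointTruncation Lmod k) y).IsInvertible := by
    obtain ⟨A, hA⟩ := hinv
    exact hcont.eventually (by rw [← hA]; exact A.nhds)
  refine ⟨hev, ?_⟩
  have hphase : ∀ᶠ m in 𝓝 m₀, m ∈ phase U := (hU.preimage continuous_fst).mem_nhds hm₀
  have sR : SmoothNear (residual (jointTruncation Lmod k) (modField Lmod fmod k)) (m₀, 0) :=
    sΛ.residual (sφ.secondOrderField sΛ)
  -- the estimate at each point is locally uniform because the residual is smooth up to `h = 0`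
  obtain ⟨e, he, heq⟩ := sR.exists_eq_pow_smul (k + 1)
    (hphase.mono fun m hm => hmod.residual_truncation_isBigO hU hLag hL hF hm k)
  have hR := (he.pow_smul_isBigO (k + 1)).congr' (heq.mono fun y hy => hy.symm) EventuallyEq.rfl
  have hI : (fun y => (hessian (jointTruncation Lmod k) y).inverse)
      =O[𝓝 (m₀, (0 : ℝ))] fun _ => (1 : ℝ) := by
    obtain ⟨A, hA⟩ := hinv
    have h1 : ContinuousAt ContinuousLinearMap.inverse (hessian (jointTruncation Lmod k) (m₀, 0)) := by
      rw [← hA]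
      exact (contDiffAt_map_inverse (n := 0) A).continuousAt
    have h2 : Tendsto (fun y => (hessian (jointTruncation Lmod k) y).inverse) (𝓝 (m₀, 0))
        (𝓝 (hessian (jointTruncation Lmod k) (m₀, 0)).inverse) :=
      ContinuousAt.comp (f := hessian (jointTruncation Lmod k)) h1 hcont
    exact Filter.Tendsto.isBigO_one (E' := (E →L[ℝ] ℝ) →L[ℝ] E) ℝ h2
  obtain ⟨C₁, hC₁⟩ := hI.bound
  obtain ⟨C₂, hC₂⟩ := hR.bound
  refine IsBigO.of_bound (C₁ * C₂) ?_
  filter_upwards [hev, hC₁, hC₂] with y k1 k2 k3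
  rw [eulerLagrangeAcceleration_sub k1]
  rw [norm_one, mul_one] at k2
  calc _ ≤ _ := ContinuousLinearMap.le_opNorm _ _
    _ ≤ C₁ * (C₂ * ‖y.2 ^ (k + 1)‖) :=
      mul_le_mul k2 k3 (norm_nonneg _)
        (le_trans (norm_nonneg (hessian (jointTruncation Lmod k) y).inverse) k2)
    _ = _ := by ring

end Main

end Herglotz

end

theorem mainTheorem4 {E : Type*} [NormedAddCommGroup E] [NormedSpace ℝ E] [FiniteDimensional ℝ E]
    (U : Set E) (hU : IsOpen U)
    (Lag : E × E × ℝ → ℝ) (hLag : ContDiffOn ℝ ∞ Lag (Herglotz.phase U))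
    (hreg : Herglotz.IsRegularOn (Herglotz.phase U) Lag)
    (f : E × E × ℝ → E) (hf : Herglotz.HasGeneralizedEL (Herglotz.phase U) Lag f)
    (L : E → E → ℝ → ℝ → ℝ → ℝ) (hL : Herglotz.IsConsistentDiscretization U Lag L)
    (F : E → E → E → ℝ → ℝ → ℝ → ℝ → E) (hF : Herglotz.IsSecondOrderForm U Lag f L F)
    (Lmod : ℕ → E × E × ℝ → ℝ) (fmod : ℕ → E × E × ℝ → E)
    (hmod : Herglotz.IsModifiedSystem U Lag f L F Lmod fmod) (k : ℕ) :
    ∃ g : ℝ → E × E × ℝ → E, ∀ K ⊆ Herglotz.phase U, IsCompact K →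
      ∃ h₀ > 0, ∃ C : ℝ, ∀ h ∈ Set.Ioo 0 h₀,
        Herglotz.IsRegularOn K (Herglotz.truncation Lmod k h) ∧
        Herglotz.HasGeneralizedEL K (Herglotz.truncation Lmod k h) (g h) ∧
        ∀ m ∈ K, ‖g h m - Herglotz.truncation fmod k h m‖ ≤ C * h ^ (k + 1) := by
  refine ⟨fun h m => Herglotz.eulerLagrangeAcceleration (Herglotz.jointTruncation Lmod k) (m, h),
    fun K hKU hK => ?_⟩
  have hsm := fun (m : E × E × ℝ) (hm : m ∈ Herglotz.phase U) (h : ℝ) =>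
    Herglotz.smoothNear_jointTruncation hmod.smooth_L hU hm k h
  have key : ∃ h₀ > 0, ∃ C : ℝ, ∀ m ∈ K, ∀ h ∈ Set.Ioo 0 h₀,
      (Herglotz.hessian (Herglotz.jointTruncation Lmod k) (m, h)).IsInvertible ∧
      ‖Herglotz.eulerLagrangeAcceleration (Herglotz.jointTruncation Lmod k) (m, h)
        - Herglotz.truncation fmod k h m‖ ≤ C * h ^ (k + 1) := by
    refine hK.induction_on (p := fun s => ∃ h₀ > 0, ∃ C : ℝ, ∀ m ∈ s, ∀ h ∈ Set.Ioo 0 h₀,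
      (Herglotz.hessian (Herglotz.jointTruncation Lmod k) (m, h)).IsInvertible ∧
      ‖Herglotz.eulerLagrangeAcceleration (Herglotz.jointTruncation Lmod k) (m, h)
        - Herglotz.truncation fmod k h m‖ ≤ C * h ^ (k + 1)) ?_ ?_ ?_ ?_
    · exact ⟨1, one_pos, 0, by simp⟩
    · rintro s t hst ⟨h₀, hh₀, C, hC⟩
      exact ⟨h₀, hh₀, C, fun m hm => hC m (hst hm)⟩
    · rintro s t ⟨h₁, hh₁, C₁, hC₁⟩ ⟨h₂, hh₂, C₂, hC₂⟩
      refine ⟨min h₁ h₂, lt_min hh₁ hh₂, max C₁ C₂, fun m hm h hh => ?_⟩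
      have hpow : 0 ≤ h ^ (k + 1) := pow_nonneg hh.1.le _
      rcases hm with hm | hm
      · have := hC₁ m hm h ⟨hh.1, hh.2.trans_le (min_le_left _ _)⟩
        exact ⟨this.1, this.2.trans (mul_le_mul_of_nonneg_right (le_max_left _ _) hpow)⟩
      · have := hC₂ m hm h ⟨hh.1, hh.2.trans_le (min_le_right _ _)⟩
        exact ⟨this.1, this.2.trans (mul_le_mul_of_nonneg_right (le_max_right _ _) hpow)⟩
    · intro m₀ hm₀
      obtain ⟨hinv, hO⟩ := hmod.acceleration_sub_isBigO hU hLag hreg hL hF (hKU hm₀) k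
      obtain ⟨C, hC⟩ := hO.bound
      obtain ⟨r, hr, hball⟩ := Metric.eventually_nhds_iff_ball.1 (hinv.and hC)
      refine ⟨Metric.ball m₀ r, mem_nhdsWithin_of_mem_nhds (Metric.ball_mem_nhds _ hr), r, hr, C,
        fun m hm h hh => ?_⟩
      have := hball (m, h) (by
        rw [Metric.mem_ball, Prod.dist_eq]
        exact max_lt hm (by simpa [abs_of_pos hh.1] using hh.2))
      refine ⟨this.1, ?_⟩
      simpa [abs_of_pos hh.1, Herglotz.jointTruncation] using this.2
  obtain ⟨h₀, hh₀, C, hC⟩ := key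
  refine ⟨h₀, hh₀, C, fun h hh => ⟨fun m hm => ?_, ?_, fun m hm => (hC m hm h hh).2⟩⟩
  · have := Herglotz.fderiv_partialV_eq_hessian (hsm m (hKU hm) h)
    obtain ⟨A, hA⟩ := (hC m hm h hh).1
    rw [← hA] at this
    change Function.Bijective (fderiv ℝ (fun w => Herglotz.partialV
      (fun m => Herglotz.jointTruncation Lmod k (m, h)) (m.1, w, m.2.2)) m.2.1)
    rw [this]
    exact A.bijective
  · exact Herglotz.hasGeneralizedEL_eulerLagrangeAcceleration (fun m hm => hsm m (hKU hm) h)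
      fun m hm => (hC m hm h hh).1
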